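/- Chain complexes are $\mathbb{Z}$-graded complexes of abelian groups with differential of degree $-1$; dg-categories are categories enriched in them, $\mathrm{Ch}$ is the dg-category of chain complexes with homogeneous linear maps of all degrees, and composition is written in diagrammatic order ($f\cdot g$ means first $f$, then $g$). A *prop* is a strict symmetric monoidal dg-category whose objects are the natural numbers, with $a\otimes b=a+b$. A *prop with $A_\infty$-multiplication* is a prop $\mathcal{E}$ with a symmetric monoidal dg-functor $i:\mathcal{A}_\infty\to\mathcal{E}$, identity on objects; here $\mathcal{A}_\infty$ is the prop generated by morphisms $m_s:s\to 1$ of degree $s-2$ ($s\ge 2$) with $$d\,m_n=\sum_{a+s+b=n,\ 2\le s<n}(-1)^{a+s+as}\,(\mathrm{id}_a\otimes m_s\otimes \mathrm{id}_b)\cdot m_{a+1+b},$$ so $i$ amounts to a choice of such $m_s\in\mathcal{E}(s,1)$. For $1\le k<n$ let $f_{n,k}\in\mathcal{E}(n,k)$ be the element of degree $n-k-1$ $$f_{n,k}=-\sum_{a=0}^{k-1}(-1)^{a(n-k)}\,\mathrm{id}_a\otimes m_{n-k+1}\otimes\mathrm{id}_{k-1-a}\;-\;\sum_{j=k}^{n-1}(-1)^{j(n-j)}\,\sigma_{j,n-j}\cdot(m_{n-k+1}\otimes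 \mathrm{id}_{k-1}),$$ where $\sigma_{j,n-j}:j+(n-j)\to(n-j)+j$ is the symmetry: it multiplies $n-k+1$ cyclically consecutive entries in all possible ways. The *Hochschild complex* of a dg-functor $\Phi:\mathcal{E}\to\mathrm{Ch}$ is the dg-functor $C(\Phi):\mathcal{E}\to\mathrm{Ch}$ with $$C(\Phi)(m)=\bigoplus_{n\ge 1}\Phi(n+m)\otimes \mathbb{Z}l_n,\quad |l_n|=n-1,\qquad d(x\otimes l_n)=dx\otimes l_n+(-1)^{|x|}\sum_{1\le k<n}\Phi(f_{n,k}\otimes \mathrm{id}_m)(x)\otimes l_k,$$ on which $g\in\mathcal{E}(m,m')$ acts by $x\otimes l_n\mapsto(-1)^{(n-1)|g|}\Phi(\mathrm{id}_n\otimes g)(x)\otimes l_n$. Let $C^n$ be its $n$-fold iterate. For $n,m\ge 0$ let $C_{\mathcal{E}}^{(n,m)}:\mathrm{Fun}(\mathcal{E},\mathrm{Ch})\to\mathrm{Ch}$ be the dg-functor $\Phi\mapsto C^n(\Phi)(m)$, where $\mathrm{Fun}(\mathcal{E},\mathrm{Ch})$ is the dg-category of dg-functors and natural transformations of all degrees.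 The dg-category $\mathrm{Nat}_{\mathcal{E}}$ of formal operations has as objects the pairs $(n,m)$ of natural numbers, and as morphism complex from $(n_1,m_1)$ to $(n_2,m_2)$ the complex $\mathrm{Hom}(C_{\mathcal{E}}^{(n_1,m_1)},C_{\mathcal{E}}^{(n_2,m_2)})$ of natural transformations of dg-functors. Let $\mathcal{E}$ and $\mathcal{E}'$ be props with $A_\infty$-multiplication, and let $\varphi:\mathcal{E}\to\mathcal{E}'$ be a dg-functor, compatible with the functors from $\mathcal{A}_\infty$ (that is, $\varphi\circ i=i'$), which is a quasi-isomorphism of categories: it is the identity on objects and a quasi-isomorphism on every morphism complex. For dg-functors $\Phi':\mathcal{E}'\to\mathrm{Ch}$ one has $C_{\mathcal{E}}^{(n,m)}(\varphi^*\Phi')=C_{\mathcal{E}'}^{(n,m)}(\Phi')$, so that $\nu\mapsto(\nu_{\varphi^*\Phi'})_{\Phi'}$ defines a dg-functor $\mathrm{Nat}_{\mathcal{E}}\to\mathrm{Nat}_{\mathcal{E}'}$ which is the identity on objects. **Claim.** This dg-functor $\mathrm{Nat}_{\mathcal{E}}\to\mathrm{Nat}_{\mathcal{E}'}$ is a quasi-isomorphism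 of categories: for all $n_1,m_1,n_2,m_2\ge 0$ the induced chain map $$\mathrm{Hom}(C_{\mathcal{E}}^{(n_1,m_1)},C_{\mathcal{E}}^{(n_2,m_2)})\longrightarrow\mathrm{Hom}(C_{\mathcal{E}'}^{(n_1,m_1)},C_{\mathcal{E}'}^{(n_2,m_2)})$$ is a quasi-isomorphism. -/

import Mathlib

open CategoryTheory

universe u v w

/-- The sign `(-1)^p` as an integer. -/
def sgn (p : ℤ) : ℤ := (p.negOnePow : ℤ)

lemma sgn_add (p q : ℤ) : sgn (p + q) = sgn p * sgn q := by
  simp [sgn, Int.negOnePow_add]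

lemma sgn_zero : sgn 0 = 1 := by simp [sgn]

lemma sgn_one : sgn 1 = -1 := by simp [sgn]

lemma sgn_congr {p q : ℤ} (h : Even (p - q)) : sgn p = sgn q := by
  have : p.negOnePow = q.negOnePow := (Int.negOnePow_eq_iff p q).2 h
  simp [sgn, this]

lemma sgn_mul_self (p : ℤ) : sgn p * sgn p = 1 := by
  rw [← sgn_add, ← sgn_zero]; exact sgn_congr ⟨p, by ring⟩

/-- A dg-category with set of objects `O`: a category enriched in chain complexes of
`ℤ`-modules. Composition is written in diagrammatic order, and is a chain map
`hom a b ⊗ hom b c ⟶ hom a c`. -/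
structure DGCat (O : Type w) where
  hom : O → O → ChainComplex AddCommGrpCat.{v} ℤ
  comp {a b c : O} {p q r : ℤ} (h : p + q = r) :
    (hom a b).X p →+ (hom b c).X q →+ (hom a c).X r
  id (a : O) : (hom a a).X 0
  id_comp {a b : O} {p : ℤ} (f : (hom a b).X p) : comp (zero_add p) (id a) f = f
  comp_id {a b : O} {p : ℤ} (f : (hom a b).X p) : comp (add_zero p) f (id b) = f
  assoc {a b c e : O} {p q r pq qr s : ℤ} (h₁ : p + q = pq) (h₂ : pq + r = s)
    (h₃ : q + r = qr) (h₄ : p + qr = s)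
    (f : (hom a b).X p) (g : (hom b c).X q) (k : (hom c e).X r) :
    comp h₂ (comp h₁ f g) k = comp h₄ f (comp h₃ g k)
  d_comp {a b c : O} {p q r p' q' r' : ℤ} (h : p + q = r)
    (hp : p' + 1 = p) (hq : q' + 1 = q) (hr : r' + 1 = r)
    (f : (hom a b).X p) (g : (hom b c).X q) :
    (hom a c).d r r' (comp h f g) =
      comp (by omega) ((hom a b).d p p' f) g
        + sgn p • comp (by omega) f ((hom b c).d q q' g)

/-- A dg-functor that is the identity on objects. -/
structure DGCat.Functor {O : Type w} (A B : DGCat.{v} O) where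
  map (a b : O) : A.hom a b ⟶ B.hom a b
  map_id (a : O) : (map a a).f 0 (A.id a) = B.id a
  map_comp {a b c : O} {p q r : ℤ} (h : p + q = r)
    (f : (A.hom a b).X p) (g : (A.hom b c).X q) :
    (map a c).f r (A.comp h f g) = B.comp h ((map a b).f p f) ((map b c).f q g)

/-- A quasi-isomorphism of dg-categories: a dg-functor which is the identity on objects and
a quasi-isomorphism on each morphism complex. -/
def DGCat.Functor.IsQuasiIso {O : Type w} {A B : DGCat.{v} O} (F : A.Functor B) : Prop :=
  ∀ a b : O, _root_.QuasiIso (F.map a b)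

/-- A prop in chain complexes: a strict symmetric monoidal dg-category whose objects are the
natural numbers, with tensor product of objects given by addition. The tensor product
`tens` of morphisms is a chain map, `braid` is the symmetry `a + b ⟶ b + a`; equalities
between natural numbers are carried as hypotheses. -/
structure DGProp extends DGCat.{u} ℕ where
  tens {a b a' b' c e : ℕ} {p q r : ℤ} (hs : a + a' = c) (ht : b + b' = e) (h : p + q = r) :
    (hom a b).X p →+ (hom a' b').X q →+ (hom c e).X r
  id_tens_id {a b c : ℕ} (h : a + b = c) : tens h h (add_zero 0) (id a) (id b) = id c
  tens_comp_tens {a₁ b₁ c₁ a₂ b₂ c₂ a b c : ℕ} {p₁ p₂ q₁ q₂ p q r₁ r₂ r : ℤ}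
    (ha : a₁ + a₂ = a) (hb : b₁ + b₂ = b) (hc : c₁ + c₂ = c)
    (hp : p₁ + p₂ = p) (hq : q₁ + q₂ = q) (h₁ : p₁ + q₁ = r₁) (h₂ : p₂ + q₂ = r₂)
    (h : p + q = r) (h' : r₁ + r₂ = r)
    (f₁ : (hom a₁ b₁).X p₁) (f₂ : (hom a₂ b₂).X p₂)
    (g₁ : (hom b₁ c₁).X q₁) (g₂ : (hom b₂ c₂).X q₂) :
    comp h (tens ha hb hp f₁ f₂) (tens hb hc hq g₁ g₂) =
      sgn (p₂ * q₁) • tens ha hc h' (comp h₁ f₁ g₁) (comp h₂ f₂ g₂)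
  tens_assoc {a₁ b₁ a₂ b₂ a₃ b₃ a₁₂ b₁₂ a₂₃ b₂₃ a b : ℕ} {p₁ p₂ p₃ p₁₂ p₂₃ p : ℤ}
    (ha₁₂ : a₁ + a₂ = a₁₂) (hb₁₂ : b₁ + b₂ = b₁₂) (hp₁₂ : p₁ + p₂ = p₁₂)
    (ha₂₃ : a₂ + a₃ = a₂₃) (hb₂₃ : b₂ + b₃ = b₂₃) (hp₂₃ : p₂ + p₃ = p₂₃)
    (ha : a₁₂ + a₃ = a) (hb : b₁₂ + b₃ = b) (hp : p₁₂ + p₃ = p)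
    (ha' : a₁ + a₂₃ = a) (hb' : b₁ + b₂₃ = b) (hp' : p₁ + p₂₃ = p)
    (f₁ : (hom a₁ b₁).X p₁) (f₂ : (hom a₂ b₂).X p₂) (f₃ : (hom a₃ b₃).X p₃) :
    tens ha hb hp (tens ha₁₂ hb₁₂ hp₁₂ f₁ f₂) f₃ =
      tens ha' hb' hp' f₁ (tens ha₂₃ hb₂₃ hp₂₃ f₂ f₃)
  id_zero_tens {a b : ℕ} {p : ℤ} (f : (hom a b).X p) :
    tens (zero_add a) (zero_add b) (zero_add p) (id 0) f = f
  tens_id_zero {a b : ℕ} {p : ℤ} (f : (hom a b).X p) :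
    tens (add_zero a) (add_zero b) (add_zero p) f (id 0) = f
  d_tens {a b a' b' c e : ℕ} {p q r p' q' r' : ℤ} (hs : a + a' = c) (ht : b + b' = e)
    (h : p + q = r) (hp : p' + 1 = p) (hq : q' + 1 = q) (hr : r' + 1 = r)
    (f : (hom a b).X p) (g : (hom a' b').X q) :
    (hom c e).d r r' (tens hs ht h f g) =
      tens hs ht (by omega) ((hom a b).d p p' f) g
        + sgn p • tens hs ht (by omega) f ((hom a' b').d q q' g)
  braid (a b : ℕ) {c c' : ℕ} (h : a + b = c) (h' : b + a = c') : (hom c c').X 0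
  d_braid {a b c c' : ℕ} (h : a + b = c) (h' : b + a = c') :
    (hom c c').d 0 (-1) (braid a b h h') = 0
  tens_braid {a b a' b' c e c' e' : ℕ} {p q r : ℤ} (hs : a + a' = c) (ht : b + b' = e)
    (hs' : a' + a = c') (ht' : b' + b = e') (h : p + q = r) (h' : q + p = r)
    (f : (hom a b).X p) (g : (hom a' b').X q) :
    comp (add_zero r) (tens hs ht h f g) (braid b b' ht ht') =
      sgn (p * q) • comp (zero_add r) (braid a a' hs hs') (tens hs' ht' h' g f)
  braid_braid {a b c c' : ℕ} (h : a + b = c) (h' : b + a = c') :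
    comp (add_zero 0) (braid a b h h') (braid b a h' h) = id c
  braid_add {a b c ab bc cb ac ca n n' n'' : ℕ} (hab : a + b = ab) (hbc : b + c = bc)
    (hcb : c + b = cb) (hac : a + c = ac) (hca : c + a = ca) (hn : ab + c = n)
    (hn₁ : a + bc = n) (hn₂ : a + cb = n') (hn₃ : ac + b = n') (hn₄ : ca + b = n'')
    (hn'' : c + ab = n'') :
    braid ab c hn hn'' =
      comp (add_zero 0) (tens hn₁ hn₂ (add_zero 0) (id a) (braid b c hbc hcb))
        (tens hn₃ hn₄ (add_zero 0) (braid a c hac hca) (id b))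

namespace DGProp

variable (E : DGProp.{u})

/-- `id_a ⊗ f ⊗ id_b`. -/
def win (a b : ℕ) {s t n m : ℕ} {p : ℤ} (hn : a + s + b = n) (hm : a + t + b = m) :
    (E.hom s t).X p →+ (E.hom n m).X p :=
  ((E.tens hn hm (add_zero p)).flip (E.id b)).comp (E.tens rfl rfl (zero_add p) (E.id a))

variable {E}

lemma win_apply (a b : ℕ) {s t n m : ℕ} {p : ℤ} (hn : a + s + b = n) (hm : a + t + b = m)
    (f : (E.hom s t).X p) :
    E.win a b hn hm f =
      E.tens hn hm (add_zero p) (E.tens rfl rfl (zero_add p) (E.id a) f) (E.id b) := rfl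

lemma d_id {q : ℤ} (a : ℕ) (hq : q + 1 = 0) : (E.hom a a).d 0 q (E.id a) = 0 := by
  have h := E.d_comp (add_zero 0) hq hq hq (E.id a) (E.id a)
  rw [E.comp_id, E.comp_id, E.id_comp, sgn_zero, one_smul] at h
  simpa using h

lemma d_win (a b : ℕ) {s t n m : ℕ} {p q : ℤ} (hn : a + s + b = n) (hm : a + t + b = m)
    (hq : q + 1 = p) (f : (E.hom s t).X p) :
    (E.hom n m).d p q (E.win a b hn hm f) = E.win a b hn hm ((E.hom s t).d p q f) := by
  have h0 : (-1 : ℤ) + 1 = 0 := by norm_num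
  rw [win_apply, E.d_tens hn hm _ hq h0 hq, E.d_tens rfl rfl _ h0 hq hq, d_id a h0, d_id b h0]
  simp [sgn_zero, win_apply]

lemma comp_win (a b : ℕ) {s t k n m l : ℕ} {p q r : ℤ} (h : p + q = r)
    (hn : a + s + b = n) (hm : a + t + b = m) (hl : a + k + b = l)
    (f : (E.hom s t).X p) (g : (E.hom t k).X q) :
    E.comp h (E.win a b hn hm f) (E.win a b hm hl g) = E.win a b hn hl (E.comp h f g) := by
  rw [win_apply, win_apply, win_apply,
    E.tens_comp_tens hn hm hl _ _ h (add_zero 0) h (add_zero r),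
    E.tens_comp_tens rfl rfl rfl _ _ (add_zero 0) h h (zero_add r)]
  simp [sgn_zero, E.comp_id]

lemma win_id (a b : ℕ) {s n : ℕ} (hn : a + s + b = n) : E.win a b hn hn (E.id s) = E.id n := by
  rw [win_apply, E.id_tens_id, E.id_tens_id]

lemma win_zero_zero {s t : ℕ} {p : ℤ} (hn : 0 + s + 0 = s) (hm : 0 + t + 0 = t)
    (f : (E.hom s t).X p) : E.win 0 0 hn hm f = f := by
  have : ∀ {s' t' : ℕ} (h1 : 0 + s = s') (h2 : 0 + t = t') (h3 : s' = s) (h4 : t' = t)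
    (hn : s' + 0 = s) (hm : t' + 0 = t),
      E.tens hn hm (add_zero p) (E.tens h1 h2 (zero_add p) (E.id 0) f) (E.id 0) = f := by
    rintro s' t' h1 h2 rfl rfl hn hm
    rw [E.tens_id_zero, E.id_zero_tens]
  exact this _ _ (by omega) (by omega) _ _

lemma win_eq (a b : ℕ) {s t n m sb tb : ℕ} {p : ℤ} (hn : a + s + b = n) (hm : a + t + b = m)
    (hsb : s + b = sb) (htb : t + b = tb) (hn' : a + sb = n) (hm' : a + tb = m)
    (f : (E.hom s t).X p) :
    E.win a b hn hm f =
      E.tens hn' hm' (zero_add p) (E.id a) (E.tens hsb htb (add_zero p) f (E.id b)) := by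
  rw [win_apply]; exact E.tens_assoc ..

lemma win_win (a b a' b' : ℕ) {s t n m n' m' a'' b'' : ℕ} {p : ℤ} (hn : a + s + b = n)
    (hm : a + t + b = m) (hn' : a' + n + b' = n') (hm' : a' + m + b' = m')
    (ha : a' + a = a'') (hb : b + b' = b'') (hn'' : a'' + s + b'' = n') (hm'' : a'' + t + b'' = m')
    (f : (E.hom s t).X p) :
    E.win a' b' hn' hm' (E.win a b hn hm f) = E.win a'' b'' hn'' hm'' f := by
  rw [win_apply a' b', win_apply a b,
    ← E.tens_assoc (p₁₂ := p) (a₁₂ := a'' + s) (b₁₂ := a'' + t) (by omega) (by omega)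
      (zero_add p) hn hm (add_zero p) (by omega) (by omega) (add_zero p),
    ← E.tens_assoc (p₁₂ := 0) (a₁₂ := a'') (b₁₂ := a'') ha ha (add_zero 0) rfl rfl
      (zero_add p) rfl rfl (zero_add p), E.id_tens_id,
    E.tens_assoc (p₂₃ := 0) (a₂₃ := b'') (b₂₃ := b'') _ _ _ hb hb (add_zero 0)
      hn' hm' (add_zero p) hn'' hm'' (add_zero p), E.id_tens_id, win_apply]

/-- Operations on disjoint blocks commute up to the Koszul sign. -/
lemma win_disj (a b c : ℕ) {s t s' t' n k k' m bl bl' br br' : ℕ} {p q r : ℤ}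
    (hbl : a + s + b = bl) (hbl' : a + t + b = bl') (hbr : b + s' + c = br)
    (hbr' : b + t' + c = br')
    (h : p + q = r) (h' : q + p = r)
    (h1 : a + s + br = n) (h2 : a + t + br = k) (h3 : bl' + s' + c = k) (h4 : bl' + t' + c = m)
    (h5 : bl + s' + c = n) (h6 : bl + t' + c = k') (h7 : a + s + br' = k') (h8 : a + t + br' = m)
    (f : (E.hom s t).X p) (g : (E.hom s' t').X q) :
    E.comp h (E.win a br h1 h2 f) (E.win bl' c h3 h4 g) =
      sgn (p * q) • E.comp h' (E.win bl c h5 h6 g) (E.win a br' h7 h8 f) := by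
  -- write `f = f ⊗ id`, `g = id ⊗ g` over the splitting `(a + s) + br`
  have e1 : E.win bl' c h3 h4 g = E.tens (a := a + t) (b := a + t) (a' := br) (b' := br') h2 h8
      (zero_add q) (E.id (a + t)) (E.win b c hbr hbr' g) := by
    have := win_win (E := E) b c (a + t) 0 hbr hbr' (n' := k) (m' := m) (by omega) (by omega)
      (a'' := bl') (b'' := c) (by omega) (by omega) h3 h4 g
    rw [← this, win_eq (a + t) 0 _ _ (add_zero _) (add_zero _) h2 h8, E.tens_id_zero]
  have e2 : E.win bl c h5 h6 g = E.tens (a := a + s) (b := a + s) (a' := br) (b' := br') h1 h7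
      (zero_add q) (E.id (a + s)) (E.win b c hbr hbr' g) := by
    have := win_win (E := E) b c (a + s) 0 hbr hbr' (n' := n) (m' := k') (by omega) (by omega)
      (a'' := bl) (b'' := c) (by omega) (by omega) h5 h6 g
    rw [← this, win_eq (a + s) 0 _ _ (add_zero _) (add_zero _) h1 h7, E.tens_id_zero]
  rw [e1, e2, win_apply, E.tens_comp_tens h1 h2 h8 _ _ (add_zero p) (zero_add q) h h,
    win_apply a br' h7 h8 f, E.tens_comp_tens h1 h7 h8 _ _ (zero_add p) (add_zero q) h' h]
  simp only [E.comp_id, E.id_comp, smul_smul]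
  rw [← sgn_add, mul_zero, sgn_zero, one_smul]
  have : p * q + q * p = p * q + p * q := by ring
  rw [this, sgn_add, sgn_mul_self, one_smul]

lemma win_braid_left (a b c : ℕ) {s t n m n' m' bc x y ca : ℕ} {p : ℤ}
    (hbc : b + c = bc) (hca : c + a = ca)
    (hx : a + s + b = x) (hy : a + t + b = y)
    (hn : a + s + bc = n) (hm : a + t + bc = m) (hb : y + c = m) (hb' : c + y = m')
    (hd : x + c = n) (hd' : c + x = n') (hn' : ca + s + b = n') (hm' : ca + t + b = m')
    (f : (E.hom s t).X p) :
    E.comp (add_zero p) (E.win a bc hn hm f) (E.braid y c hb hb') =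
      E.comp (zero_add p) (E.braid x c hd hd') (E.win ca b hn' hm' f) := by
  have e1 : E.win a bc hn hm f = E.tens hd hb (add_zero p) (E.win a b hx hy f) (E.id c) := by
    rw [← win_win (E := E) a b 0 c hx hy (by omega) (by omega) (zero_add a) hbc hn hm f,
      win_eq 0 c _ _ hd hb (zero_add _) (zero_add _), E.id_zero_tens]
  have e2 : E.win ca b hn' hm' f = E.tens hd' hb' (zero_add p) (E.id c) (E.win a b hx hy f) := by
    rw [← win_win (E := E) a b c 0 hx hy (by omega) (by omega) hca (add_zero b) hn' hm' f,
      win_eq c 0 _ _ (add_zero _) (add_zero _) hd' hb', E.tens_id_zero]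
  rw [e1, e2, E.tens_braid hd hb hd' hb' (add_zero p) (zero_add p), mul_zero, sgn_zero, one_smul]

lemma win_braid_right (a b c : ℕ) {s t n m n' m' bc x y ca : ℕ} {p : ℤ}
    (hbc : b + c = bc) (hca : c + a = ca)
    (hx : a + s + b = x) (hy : a + t + b = y)
    (hn : ca + s + b = n) (hm : ca + t + b = m) (hb : c + y = m) (hb' : y + c = m')
    (hd : c + x = n) (hd' : x + c = n') (hn' : a + s + bc = n') (hm' : a + t + bc = m')
    (f : (E.hom s t).X p) :
    E.comp (add_zero p) (E.win ca b hn hm f) (E.braid c y hb hb') =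
      E.comp (zero_add p) (E.braid c x hd hd') (E.win a bc hn' hm' f) := by
  have e1 : E.win a bc hn' hm' f = E.tens hd' hb' (add_zero p) (E.win a b hx hy f) (E.id c) := by
    rw [← win_win (E := E) a b 0 c hx hy (by omega) (by omega) (zero_add a) hbc hn' hm' f,
      win_eq 0 c _ _ hd' hb' (zero_add _) (zero_add _), E.id_zero_tens]
  have e2 : E.win ca b hn hm f = E.tens hd hb (zero_add p) (E.id c) (E.win a b hx hy f) := by
    rw [← win_win (E := E) a b c 0 hx hy (by omega) (by omega) hca (add_zero b) hn hm f,
      win_eq c 0 _ _ (add_zero _) (add_zero _) hd hb, E.tens_id_zero]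
  rw [e1, e2, E.tens_braid hd hb hd' hb' (zero_add p) (add_zero p), zero_mul, sgn_zero, one_smul]

lemma braid_cyc (a b c : ℕ) {ab ca bc n : ℕ} (hab : a + b = ab) (hca : c + a = ca)
    (hbc : b + c = bc) (h1 : ab + c = n) (h2 : c + ab = n) (h3 : ca + b = n) (h4 : b + ca = n)
    (h5 : a + bc = n) (h6 : bc + a = n) :
    E.comp (add_zero 0) (E.braid ab c h1 h2) (E.braid ca b h3 h4) = E.braid a bc h5 h6 := by
  have hx := E.braid_add (a := c) (b := a) (c := b) hca hab (by omega : b + a = ab)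
    (by omega : c + b = bc) hbc h3 h2 h2 (by omega : bc + a = n) (by omega : bc + a = n) h4
  have hy := E.braid_add (a := b) (b := a) (c := c) (by omega : b + a = ab) (by omega : a + c = ca)
    hca hbc (by omega : c + b = bc) h1 h4 h4 (by omega : bc + a = n) (by omega : bc + a = n) h2
  have hz := E.braid_add (a := b) (b := c) (c := a) hbc hca (by omega : a + c = ca)
    (by omega : b + a = ab) hab h6 h4 h4 h1 h1 h5
  have nat := E.tens_braid (a := ab) (b := ab) (a' := c) (b' := c) h1 h1 h2 h2 (add_zero 0)
    (add_zero 0) (E.braid a b hab (by omega)) (E.id c)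
  rw [zero_mul, sgn_zero, one_smul] at nat
  -- the claim after composing with the inverse of `braid a bc`
  have key : E.comp (add_zero 0) (E.braid ab c h1 h2) (E.braid ca b h3 h4) =
      E.comp (add_zero 0) (E.tens h1 h1 (add_zero 0) (E.braid a b hab (by omega)) (E.id c))
        (E.tens h4 h4 (add_zero 0) (E.id b) (E.braid a c (by omega) hca)) := by
    rw [hx, ← E.assoc (add_zero 0) (add_zero 0) (add_zero 0) (add_zero 0), ← nat, hy,
      E.assoc (add_zero 0) (add_zero 0) (add_zero 0) (add_zero 0),
      E.assoc (add_zero 0) (add_zero 0) (add_zero 0) (add_zero 0),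
      E.tens_comp_tens _ _ _ _ _ (add_zero 0) (add_zero 0) (add_zero 0) (add_zero 0),
      E.braid_braid, E.comp_id, E.id_tens_id, mul_zero, sgn_zero, one_smul, E.comp_id]
  have inv : E.comp (add_zero 0)
      (E.comp (add_zero 0) (E.braid ab c h1 h2) (E.braid ca b h3 h4)) (E.braid bc a h6 h5) =
        E.id n := by
    rw [key, hz, E.assoc (add_zero 0) (add_zero 0) (add_zero 0) (add_zero 0),
      ← E.assoc (add_zero 0) (add_zero 0) (add_zero 0) (add_zero 0) _ _
        (E.tens h1 h1 _ _ (E.id c)),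
      E.tens_comp_tens _ _ _ _ _ (add_zero 0) (add_zero 0) (add_zero 0) (add_zero 0),
      E.braid_braid, E.comp_id, E.id_tens_id, mul_zero, sgn_zero, one_smul, E.id_comp,
      E.tens_comp_tens _ _ _ _ _ (add_zero 0) (add_zero 0) (add_zero 0) (add_zero 0),
      E.braid_braid, E.comp_id, E.id_tens_id, mul_zero, sgn_zero, one_smul]
  have := congrArg (fun z => E.comp (add_zero 0) z (E.braid a bc h5 h6)) inv
  rw [E.assoc (add_zero 0) (add_zero 0) (add_zero 0) (add_zero 0) _ (E.braid bc a h6 h5),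
    E.braid_braid, E.comp_id, E.id_comp] at this
  exact this

end DGProp

/-- A prop with `A_∞`-multiplication: a prop with morphisms `m_s : s ⟶ 1` of degree `s - 2`
for `s ≥ 2`, satisfying the `A_∞`-relations
`d m_n = ∑ (-1)^(a + s + a s) (id_a ⊗ m_s ⊗ id_b) ≫ m_(a + 1 + b)`, the sum being over all
`a + s + b = n` with `2 ≤ s < n`. -/
structure AinfProp extends DGProp.{u} where
  mul (s : ℕ) (p : ℤ) (hs : 2 ≤ s) (hp : p + 2 = s) : (hom s 1).X p
  d_mul (n : ℕ) (p q : ℤ) (hn : 2 ≤ n) (hp : p + 2 = n) (hq : q + 1 = p) :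
    (hom n 1).d p q (mul n p hn hp) =
      ∑ s ∈ Finset.range n, ∑ a ∈ Finset.range n,
        if h : 2 ≤ s ∧ s < n ∧ a + s ≤ n then
          sgn (a + s + a * s) • comp (p := s - 2) (q := n - s - 1) (by omega)
            (toDGProp.win a (n - s - a) (by omega) rfl (mul s (s - 2) (by omega) (by omega)))
            (mul (a + 1 + (n - s - a)) (n - s - 1) (by omega) (by omega))
        else 0

namespace AinfProp

variable (E : AinfProp.{u})

/-- The morphism `n ⟶ k` applying the multiplication `m_(n-k+1)` to the entries
`a + 1, …, a + n - k + 1` (for `a < k < n`). -/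
def block (n k a : ℕ) : (E.hom n k).X ((n : ℤ) - k - 1) :=
  if h : k < n ∧ a < k then
    E.win a (k - 1 - a) (by omega) (by omega)
      (E.mul (n - k + 1) ((n : ℤ) - k - 1) (by omega) (by omega))
  else 0

/-- The morphism `n ⟶ k`, with its sign, applying `m_(n-k+1)` to the `n - k + 1` cyclically
consecutive entries that start at the entry `i + 1`. For `i < k` the entries do not wrap around
and the product is placed at position `i + 1`. For `k ≤ i < n` they are
`i + 1, …, n, 1, …, i + 1 - k`, and the product is placed at the first position. -/
def cyc (n k i : ℕ) : (E.hom n k).X ((n : ℤ) - k - 1) :=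
  if i < k then sgn (i * (n - k)) • E.block n k i
  else if h : i < n then
    sgn (i * (n - i)) • E.comp (zero_add _) (E.braid i (n - i) (by omega) (by omega))
      (E.block n k 0)
  else 0

/-- The morphisms `f_{n,k} : n ⟶ k` of the Hochschild differential `l_n ↦ ∑ f_{n,k} ⊗ l_k`. -/
def hochTerm (n k : ℕ) : (E.hom n k).X ((n : ℤ) - k - 1) :=
  - ∑ i ∈ Finset.range n, E.cyc n k i

variable {E}

lemma block_pos {n k a : ℕ} (h : k < n) (h' : a < k) {b s : ℕ} (hb : a + 1 + b = k)
    (hs : s + k = n + 1) :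
    E.block n k a = E.win a b (by omega) (by omega)
      (E.mul s ((n : ℤ) - k - 1) (by omega) (by omega)) := by
  obtain rfl : b = k - 1 - a := by omega
  obtain rfl : s = n - k + 1 := by omega
  simp [block, h, h']

lemma d_block {n j I : ℕ} {p : ℤ} (hp : p + 1 = n - j - 1) (h : j < n) (h' : I < j) :
    (E.hom n j).d ((n : ℤ) - j - 1) p (E.block n j I) =
      ∑ k ∈ Finset.Ioo j n, ∑ a ∈ Finset.range (k - j + 1),
        sgn (a + (n - k + 1) * (1 + a)) •
          E.comp (by omega) (E.block n k (I + a)) (E.block k j I) := by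
  rw [block_pos h h' (b := j - 1 - I) (s := n - j + 1) (by omega) (by omega),
    DGProp.d_win _ _ _ _ hp, E.d_mul _ _ _ _ _ hp, map_sum]
  simp only [map_sum]
  have e1 : Finset.Ico 2 (n - j + 1) ⊆ Finset.range (n - j + 1) := by
    intro x; simp
  rw [← Finset.sum_subset e1]
  · refine Finset.sum_nbij' (fun s => n + 1 - s) (fun k => n + 1 - k) ?_ ?_ ?_ ?_ ?_
    · intro s hs; simp only [Finset.mem_Ico, Finset.mem_Ioo] at hs ⊢; omega
    · intro s hs; simp only [Finset.mem_Ico, Finset.mem_Ioo] at hs ⊢; omega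
    · intro s hs; simp only [Finset.mem_Ico] at hs ⊢; omega
    · intro s hs; simp only [Finset.mem_Ioo] at hs ⊢; omega
    · intro s hs
      simp only [Finset.mem_Ico] at hs
      have e2 : Finset.range (n + 1 - s - j + 1) ⊆ Finset.range (n - j + 1) := by
        intro x; simp only [Finset.mem_range]; omega
      rw [← Finset.sum_subset e2]
      · refine Finset.sum_congr rfl fun a ha => ?_
        simp only [Finset.mem_range] at ha
        obtain ⟨k, hk⟩ : ∃ k, k = n + 1 - s := ⟨_, rfl⟩
        rw [dif_pos (by omega), ← hk, map_zsmul]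
        rw [block_pos (k := k) (b := j - 1 - I + (n - j + 1 - s - a)) (s := s)
            (by omega) (by omega) (by omega) (by omega),
          block_pos (n := k) (b := j - 1 - I) (s := a + 1 + (n - j + 1 - s - a)) (by omega)
            (by omega) (by omega) (by omega),
          ← DGProp.win_win (E := E.toDGProp) a (n - j + 1 - s - a) I (j - 1 - I) (n := n - j + 1)
            (m := a + 1 + (n - j + 1 - s - a)) (by omega) (by omega) (by omega) (by omega) rfl
            (by omega) (by omega) (by omega),
          DGProp.comp_win _ _ _ _ _ (by omega)]
        have hsg : sgn ((a : ℤ) + s + a * s) = sgn (a + (n - k + 1) * (1 + a)) := by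
          have : (s : ℤ) = n - k + 1 := by omega
          rw [this]; exact sgn_congr ⟨0, by ring⟩
        rw [hsg]
        congr 2
        have : ∀ (x y x' y' : ℤ) (h1 h2 h3 h4 h5 h6) (_ : x = x') (_ : y = y'),
            E.comp (p := x) (q := y) (r := p) h5
              (E.win a (n - j + 1 - s - a) (n := n - j + 1) (by omega) rfl (E.mul s x (by omega) h1))
              (E.mul (a + 1 + (n - j + 1 - s - a)) y (by omega) h2) =
            E.comp (p := x') (q := y') (r := p) h6
              (E.win a (n - j + 1 - s - a) (n := n - j + 1) (by omega) rfl (E.mul s x' (by omega) h3))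
              (E.mul (a + 1 + (n - j + 1 - s - a)) y' (by omega) h4) := by
          rintro x y x' y' h1 h2 h3 h4 h5 h6 rfl rfl
          rfl
        exact this _ _ _ _ _ _ _ _ _ _ (by omega) (by omega)
      · intro a _ ha
        simp only [Finset.mem_range] at ha
        rw [dif_neg (by omega), map_zero]
  · intro s hs hs'
    simp only [Finset.mem_Ico, Finset.mem_range] at hs hs'
    refine Finset.sum_eq_zero fun a ha => ?_
    rw [dif_neg (by omega), map_zero]

lemma block_braid_left {n k x y c a a' : ℕ} (h1 : x + c = n) (h1' : c + x = n)
    (h2 : y + c = k) (h2' : c + y = k) (hk : k < n) (ha : a < y) (ha' : a' = c + a) :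
    E.comp (zero_add _) (E.braid x c h1 h1') (E.block n k a') =
      E.comp (add_zero _) (E.block n k a) (E.braid y c h2 h2') := by
  subst ha'
  rw [block_pos hk (a := c + a) (b := y - 1 - a) (s := n + 1 - k) (by omega) (by omega) (by omega),
    block_pos hk (a := a) (b := y - 1 - a + c) (s := n + 1 - k) (by omega) (by omega) (by omega)]
  exact (DGProp.win_braid_left a (y - 1 - a) c rfl rfl (by omega) (by omega) _ _ _ _ _ _ _ _ _).symm

lemma block_braid_right {n k x y c a a' : ℕ} (h1 : c + x = n) (h1' : x + c = n)
    (h2 : c + y = k) (h2' : y + c = k) (hk : k < n) (ha : a < y) (ha' : a' = c + a) :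
    E.comp (zero_add _) (E.braid c x h1 h1') (E.block n k a) =
      E.comp (add_zero _) (E.block n k a') (E.braid c y h2 h2') := by
  subst ha'
  rw [block_pos hk (a := c + a) (b := y - 1 - a) (s := n + 1 - k) (by omega) (by omega) (by omega),
    block_pos hk (a := a) (b := y - 1 - a + c) (s := n + 1 - k) (by omega) (by omega) (by omega)]
  exact (DGProp.win_braid_right a (y - 1 - a) c rfl rfl (by omega) (by omega) _ _ _ _ _ _ _ _ _).symm

lemma block_comm {n k j k' i i' : ℕ} {r : ℤ} (hr : r = n - j - 2) (hk : k < n) (hj : j < k)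
    (hk' : k + k' = n + j) (hi : i < i') (hi' : i' < j) :
    E.comp (r := r) (by omega) (E.block n k i) (E.block k j i') =
      sgn ((n - k - 1) * (k - j - 1)) •
        E.comp (by omega) (E.block n k' (i' + n - k)) (E.block k' j i) := by
  have key : ∀ (p q p' q' : ℤ) (h1 h2 h3 h4 h5 h6) (_ : p = p') (_ : q = q'),
      E.comp (p := p) (q := q) (r := r) h1
        (E.win i (k - 1 - i) (n := n) (m := k) (by omega) (by omega)
          (E.mul (n + 1 - k) p (by omega) h2))
        (E.win i' (j - 1 - i') (n := k) (m := j) (by omega) (by omega)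
          (E.mul (k + 1 - j) q (by omega) h3)) =
      sgn (p * q) • E.comp (p := q') (q := p') (r := r) h4
        (E.win (i' + n - k) (j - 1 - i') (n := n) (m := k') (by omega) (by omega)
          (E.mul (k + 1 - j) q' (by omega) h5))
        (E.win i (j - 1 - i) (n := k') (m := j) (by omega) (by omega)
          (E.mul (n + 1 - k) p' (by omega) h6)) := by
    rintro p q p' q' h1 h2 h3 h4 h5 h6 rfl rfl
    exact DGProp.win_disj i (i' - i - 1) (j - 1 - i') (by omega) (by omega) (by omega) (by omega)
      h1 (by omega) (by omega) (by omega) (by omega) (by omega) (by omega) (by omega) (by omega)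
      (by omega) _ _
  rw [block_pos hk (a := i) (b := k - 1 - i) (s := n + 1 - k) (by omega) (by omega) (by omega),
    block_pos hj (a := i') (b := j - 1 - i') (s := k + 1 - j) (by omega) (by omega) (by omega),
    block_pos (n := n) (k := k') (a := i' + n - k) (b := j - 1 - i') (s := k + 1 - j) (by omega)
      (by omega) (by omega) (by omega),
    block_pos (n := k') (k := j) (a := i) (b := j - 1 - i) (s := n + 1 - k) (by omega)
      (by omega) (by omega) (by omega)]
  exact key _ _ _ _ _ _ _ _ _ _ (by omega) (by omega)

lemma cyc_lt {n k i : ℕ} (h : i < k) : E.cyc n k i = sgn (i * (n - k)) • E.block n k i := by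
  simp [cyc, h]

lemma cyc_ge {n k i c : ℕ} (h : k ≤ i) (hc : i + c = n) (hc' : 0 < c) :
    E.cyc n k i = sgn (i * c) • E.comp (zero_add _) (E.braid i c hc (by omega))
      (E.block n k 0) := by
  obtain rfl : c = n - i := by omega
  have : ((n - i : ℕ) : ℤ) = n - i := by omega
  rw [cyc, if_neg (by omega), dif_pos (by omega), this]

/-- the starting point of the inner block -/
def inn (n j I a : ℕ) : ℕ := if j ≤ I ∧ n - I ≤ a then a - (n - I) else I + a

/-- the starting point of the outer block -/
def out (n k j I a : ℕ) : ℕ :=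
  if I < j then I else if n - I ≤ a then k - (n - I) else if I + a < k then I else
    if a = 0 then 0 else k - a

lemma comp_nested {n k j I a : ℕ} {p : ℤ} (hp : p + 1 = n - j - 1) (hj : j < k) (hk : k < n)
    (hj1 : 1 ≤ j) (hI : j ≤ I) (hI' : I < n) (ha : a ≤ k - j) :
    (sgn (I * (n - I)) * sgn (a + (n - k + 1) * (1 + a))) •
      E.comp (p := 0) (q := p) (zero_add p) (E.braid I (n - I) (by omega) (by omega))
        (E.comp (by omega) (E.block n k a) (E.block k j 0)) =
      sgn (n - k - 1) • E.comp (r := p) (by omega) (E.cyc n k (inn n j I a))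
        (E.cyc k j (out n k j I a)) := by
  obtain ⟨c, hc⟩ : ∃ c, I + c = n := ⟨n - I, by omega⟩
  have hc' : n - I = c := by omega
  have hcz : (n : ℤ) - I = c := by omega
  simp only [hc']
  rw [← E.assoc (pq := n - k - 1) (zero_add _) (by omega) (by omega) (zero_add p)]
  unfold inn out
  simp only [hc']
  rw [if_neg (show ¬ I < j by omega)]
  by_cases h1 : c ≤ a
  · rw [if_pos ⟨hI, h1⟩, if_pos h1]
    rw [block_braid_left (a := a - c) (y := k - c) (c := c) (x := I) hc (by omega) (by omega)
      (by omega) hk (by omega) (by omega),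
      E.assoc (add_zero _) (by omega) (zero_add _) (by omega), cyc_lt (by omega),
      cyc_ge (n := k) (i := k - c) (c := c) (by omega) (by omega) (by omega)]
    simp only [map_zsmul, AddMonoidHom.zsmul_apply, smul_smul, ← sgn_add]
    congr 1
    apply sgn_congr
    rw [show ((a - c : ℕ) : ℤ) = a - c by omega, show ((k - c : ℕ) : ℤ) = k - c by omega]
    rw [show (n : ℤ) = I + c by omega]
    simp only [Int.even_add, Int.even_sub, Int.even_mul, Int.not_even_one]
    by_cases e1 : Even (I : ℤ) <;> by_cases e2 : Even (c : ℤ) <;> by_cases e3 : Even (a : ℤ) <;>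
      by_cases e4 : Even (k : ℤ) <;> simp [e1, e2, e3, e4]
  · rw [if_neg (by omega), if_neg h1]
    by_cases h2 : I + a < k
    · rw [if_pos h2]
      rw [block_braid_right (a := a) (a' := I + a) (y := k - I) (c := I) (x := c) hc (by omega)
        (by omega) (by omega) hk (by omega) (by omega),
        E.assoc (add_zero _) (by omega) (zero_add _) (by omega), cyc_lt (by omega),
        cyc_ge (n := k) (i := I) (c := k - I) (by omega) (by omega) (by omega)]
      simp only [map_zsmul, AddMonoidHom.zsmul_apply, smul_smul, ← sgn_add]
      congr 1
      apply sgn_congr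
      push_cast
      rw [show ((k - I : ℕ) : ℤ) = k - I by omega]
      rw [show (n : ℤ) = I + c by omega]
      simp only [Int.even_add, Int.even_sub, Int.even_mul, Int.not_even_one]
      by_cases e1 : Even (I : ℤ) <;> by_cases e2 : Even (c : ℤ) <;> by_cases e3 : Even (a : ℤ) <;>
        by_cases e4 : Even (k : ℤ) <;> simp [e1, e2, e3, e4]
    · rw [if_neg h2]
      by_cases h3 : a = 0
      · subst h3
        rw [if_pos rfl, add_zero, cyc_ge (n := n) (i := I) (c := c) (by omega) hc (by omega), 
          cyc_lt (by omega)]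
        simp only [map_zsmul, AddMonoidHom.zsmul_apply, smul_smul, ← sgn_add]
        congr 1
        apply sgn_congr
        simp only [Nat.cast_zero, zero_mul, add_zero, zero_add, mul_one]
        rw [show (n : ℤ) = I + c by omega]
        simp only [Int.even_add, Int.even_sub, Int.even_mul, Int.not_even_one]
        by_cases e1 : Even (I : ℤ) <;> by_cases e2 : Even (c : ℤ) <;> 
          by_cases e4 : Even (k : ℤ) <;> simp [e1, e2, e4]
      · rw [if_neg h3, cyc_ge (n := n) (i := I + a) (c := c - a) (by omega) (by omega) (by omega),
          cyc_ge (n := k) (i := k - a) (c := a) (by omega) (by omega) (by omega)]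
        simp only [map_zsmul, AddMonoidHom.zsmul_apply, smul_smul, ← sgn_add]
        rw [← E.assoc (pq := n - k - 1) (add_zero _) (by omega) (zero_add _) (by omega),
          E.assoc (pq := n - k - 1) (zero_add _) (by omega) (add_zero _) (by omega),
          ← block_braid_left (a := 0) (a' := a) (y := k - a) (c := a) (x := n - a) (by omega)
            (by omega) (by omega) (by omega) hk (by omega) (by omega),
          ← E.assoc (pq := 0) (add_zero 0) (zero_add _) (zero_add _) (zero_add _),
          DGProp.braid_cyc (E := E.toDGProp) (a := I) (b := a) (c := c - a) (ab := I + a) (ca := n - a)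
            (bc := c) (n := n) rfl (by omega) (by omega) (by omega) (by omega) (by omega) (by omega) hc
            (by omega)]
        congr 1
        apply sgn_congr
        push_cast
        rw [show ((k - a : ℕ) : ℤ) = k - a by omega, show ((c - a : ℕ) : ℤ) = c - a by omega]
        rw [show (n : ℤ) = I + c by omega]
        simp only [Int.even_add, Int.even_sub, Int.even_mul, Int.not_even_one]
        by_cases e1 : Even (I : ℤ) <;> by_cases e2 : Even (c : ℤ) <;> by_cases e3 : Even (a : ℤ) <;>
          by_cases e4 : Even (k : ℤ) <;> simp [e1, e2, e3, e4]

lemma d_cyc {n j I : ℕ} {p : ℤ} (hp : p + 1 = n - j - 1) (hj1 : 1 ≤ j) (h : j < n) (hI : I < n) :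
    (E.hom n j).d ((n : ℤ) - j - 1) p (E.cyc n j I) =
      ∑ k ∈ Finset.Ioo j n, ∑ a ∈ Finset.range (k - j + 1), sgn (n - k - 1) •
        E.comp (by omega) (E.cyc n k (inn n j I a)) (E.cyc k j (out n k j I a)) := by
  by_cases hIj : I < j
  · rw [cyc_lt hIj, map_zsmul, d_block hp h hIj, Finset.smul_sum]
    refine Finset.sum_congr rfl fun k hk => ?_
    rw [Finset.smul_sum]
    refine Finset.sum_congr rfl fun a ha => ?_
    simp only [Finset.mem_Ioo, Finset.mem_range] at hk ha
    rw [inn, out, if_neg (by omega), if_pos hIj, cyc_lt (by omega), cyc_lt hIj]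
    simp only [map_zsmul, AddMonoidHom.zsmul_apply, smul_smul, ← sgn_add]
    congr 1
    apply sgn_congr
    push_cast
    simp only [Int.even_add, Int.even_sub, Int.even_mul, Int.not_even_one]
    by_cases e1 : Even (I : ℤ) <;> by_cases e2 : Even (n : ℤ) <;> by_cases e3 : Even (a : ℤ) <;>
      by_cases e4 : Even (k : ℤ) <;> simp [e1, e2, e3, e4]
  · have h0 : (-1 : ℤ) + 1 = 0 := by norm_num
    rw [cyc_ge (c := n - I) (by omega) (by omega) (by omega), map_zsmul,
      E.d_comp (zero_add _) h0 hp hp, E.d_braid, d_block hp h (by omega)]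
    simp only [map_zero, AddMonoidHom.zero_apply, zero_add, sgn_zero, one_smul, map_sum,
      Finset.smul_sum, map_zsmul]
    refine Finset.sum_congr rfl fun k hk => Finset.sum_congr rfl fun a ha => ?_
    simp only [Finset.mem_Ioo, Finset.mem_range] at hk ha
    rw [smul_smul, ← comp_nested hp hk.1 hk.2 hj1 (by omega) hI (by omega)]
    rw [show ((n - I : ℕ) : ℤ) = n - I by omega]

lemma comp_disj {n k j k' i i' : ℕ} {r : ℤ} (hr : r = n - j - 2) (hk : k < n) (hj : j < k)
    (hk' : k + k' = n + j) (hi : i < i') (hi' : i' < j) :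
    sgn (n - k - 1) • E.comp (r := r) (by omega) (E.cyc n k i) (E.cyc k j i') +
      sgn (n - k' - 1) • E.comp (by omega) (E.cyc n k' (i' + n - k)) (E.cyc k' j i) = 0 := by
  rw [cyc_lt (by omega), cyc_lt (by omega), cyc_lt (by omega), cyc_lt (by omega)]
  simp only [map_zsmul, AddMonoidHom.zsmul_apply, smul_smul]
  rw [block_comm hr hk hj hk' hi hi', smul_smul, ← add_smul]
  simp only [← sgn_add]
  rw [show ((i' + n - k : ℕ) : ℤ) = i' + n - k by omega]
  convert zero_smul ℤ _
  rw [← neg_eq_iff_add_eq_zero, ← neg_one_mul, ← sgn_one, ← sgn_add]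
  apply sgn_congr
  rw [show (n : ℤ) = k + k' - j by omega]
  simp only [Int.even_add, Int.even_sub, Int.even_mul, Int.not_even_one]
  by_cases e1 : Even (i : ℤ) <;> by_cases e2 : Even (i' : ℤ) <;> by_cases e3 : Even (j : ℤ) <;>
    by_cases e4 : Even (k : ℤ) <;> by_cases e5 : Even (k' : ℤ) <;> simp [e1, e2, e3, e4, e5]

lemma comp_disj' {n k j k' i i' : ℕ} {r : ℤ} (hr : r = n - j - 2) (hk : k < n) (hj : j < k)
    (hk' : k + k' = n + j) (hi : k ≤ i) (hin : i < n) (hi0 : 0 < i') (hi' : i' < j) :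
    sgn (n - k - 1) • E.comp (r := r) (by omega) (E.cyc n k i) (E.cyc k j i') +
      sgn (n - k' - 1) • E.comp (by omega) (E.cyc n k' (i' + i - k))
        (E.cyc k' j (i + j - k)) = 0 := by
  obtain ⟨c, hc⟩ : ∃ c, i + c = n := ⟨n - i, by omega⟩
  rw [cyc_ge (c := c) (by omega) (by omega) (by omega), cyc_lt (by omega), cyc_lt (by omega),
    cyc_ge (i := i + j - k) (c := c) (by omega) (by omega) (by omega)]
  simp only [map_zsmul, AddMonoidHom.zsmul_apply, smul_smul]
  rw [E.assoc (qr := r) (zero_add _) (by omega) (by omega) (by omega), block_comm hr hk hj hk' hi0 hi',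
    map_zsmul, ← E.assoc (pq := n - k' - 1) (zero_add _) (by omega) (by omega) (by omega),
    block_braid_left (a := i' + i - k) (y := i + j - k) (c := c) (x := i) hc (by omega) (by omega)
      (by omega) (by omega) (by omega) (by omega),
    E.assoc (add_zero _) (by omega) (zero_add _) (by omega), smul_smul, ← add_smul]
  simp only [← sgn_add]
  rw [show ((i' + i - k : ℕ) : ℤ) = i' + i - k by omega,
    show ((i + j - k : ℕ) : ℤ) = i + j - k by omega]
  convert zero_smul ℤ _
  rw [← neg_eq_iff_add_eq_zero, ← neg_one_mul, ← sgn_one, ← sgn_add]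
  apply sgn_congr
  rw [show (n : ℤ) = i + c by omega, show (i : ℤ) = k + k' - j - c by omega]
  simp only [Int.even_add, Int.even_sub, Int.even_mul, Int.not_even_one]
  by_cases e1 : Even (c : ℤ) <;> by_cases e2 : Even (i' : ℤ) <;> by_cases e3 : Even (j : ℤ) <;>
    by_cases e4 : Even (k : ℤ) <;> by_cases e5 : Even (k' : ℤ) <;> simp [e1, e2, e3, e4, e5]

/-- whether the second block contains the value of the first one -/
def Nested (j k i i' : ℕ) : Prop :=
  (i' < j ∧ i < k ∧ i' ≤ i ∧ i + j ≤ i' + k) ∨ (i' < j ∧ k ≤ i ∧ i' = 0) ∨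
    (j ≤ i' ∧ i < k ∧ (i + j ≤ i' ∨ i' ≤ i)) ∨ (j ≤ i' ∧ k ≤ i)

instance (j k i i' : ℕ) : Decidable (Nested j k i i') := by
  unfold Nested; infer_instance

/-- starting point of the second block, when taken first -/
def swp₁ (n j k i i' : ℕ) : ℕ :=
  if i < k then (if i' < j then (if i < i' then i' + n - k else i') else n + i' - k)
  else i' + i - k

/-- starting point of the first block, when taken second -/
def swp₂ (j k i i' : ℕ) : ℕ :=
  if i < k then (if i' < j then (if i < i' then i else i + j - k) else i + j - i')
  else i + j - k

/-- triples of natural numbers -/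
abbrev Triple : Type := Σ _ : ℕ, Σ _ : ℕ, ℕ

lemma triple_ext {a b c a' b' c' : ℕ} (h : a = a') (h' : b = b') (h'' : c = c') :
    (⟨a, b, c⟩ : Triple) = ⟨a', b', c'⟩ := by
  subst h h' h''; rfl

set_option maxHeartbeats 2000000 in
/-- The twisting equation for the morphisms `f_{n,k}`. -/
theorem hochTerm_mc (n j : ℕ) (hj1 : 1 ≤ j) (h : j < n) {p : ℤ} (hp : p + 1 = n - j - 1) :
    (E.hom n j).d ((n : ℤ) - j - 1) p (E.hochTerm n j) +
      ∑ k ∈ Finset.Ioo j n, sgn (n - k - 1) •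
        E.comp (by omega) (E.hochTerm n k) (E.hochTerm k j) = 0 := by
  unfold hochTerm
  simp only [map_neg, map_sum, AddMonoidHom.neg_apply, AddMonoidHom.finsetSum_apply]
  rw [Finset.sum_congr rfl fun I hI => d_cyc hp hj1 h (Finset.mem_range.1 hI)]
  simp only [Finset.sum_neg_distrib, neg_neg, Finset.smul_sum]
  set T : Triple → (E.hom n j).X p := fun x =>
    sgn (n - x.1 - 1) • E.comp (by omega) (E.cyc n x.1 x.2.1) (E.cyc x.1 j x.2.2) with hT
  have e1 : ∑ k ∈ Finset.Ioo j n, ∑ i' ∈ Finset.range k, ∑ i ∈ Finset.range n,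
      sgn (n - k - 1) • E.comp (r := p) (by omega) (E.cyc n k i) (E.cyc k j i') =
      ∑ x ∈ (Finset.Ioo j n).sigma fun k => (Finset.range n).sigma fun _ => Finset.range k,
        T x := by
    rw [Finset.sum_sigma]
    refine Finset.sum_congr rfl fun k _ => ?_
    rw [Finset.sum_comm, Finset.sum_sigma]
  have e2 : ∑ I ∈ Finset.range n, ∑ k ∈ Finset.Ioo j n, ∑ a ∈ Finset.range (k - j + 1),
      sgn (n - k - 1) • E.comp (r := p) (by omega) (E.cyc n k (inn n j I a))
        (E.cyc k j (out n k j I a)) =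
      ∑ x ∈ (Finset.Ioo j n).sigma fun k => (Finset.range n).sigma fun _ =>
        Finset.range (k - j + 1), T ⟨x.1, inn n j x.2.1 x.2.2, out n x.1 j x.2.1 x.2.2⟩ := by
    rw [Finset.sum_comm, Finset.sum_sigma]
    refine Finset.sum_congr rfl fun k _ => ?_
    rw [Finset.sum_sigma]
  have e5 := Finset.sum_filter_add_sum_filter_not ((Finset.Ioo j n).sigma fun k =>
    (Finset.range n).sigma fun _ => Finset.range k)
    (fun x : Triple => Nested j x.1 x.2.1 x.2.2) T
  have e3 : ∑ x ∈ (((Finset.Ioo j n).sigma fun k => (Finset.range n).sigma fun _ =>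
      Finset.range k).filter fun x : Σ _ : ℕ, Σ _ : ℕ, ℕ => ¬ Nested j x.1 x.2.1 x.2.2), T x = 0 := by
    refine Finset.sum_involution (fun x _ => ⟨n + j - x.1, swp₁ n j x.1 x.2.1 x.2.2, swp₂ j x.1 x.2.1 x.2.2⟩) ?_ ?_ ?_ ?_
    · rintro ⟨k, i, i'⟩ hx
      simp only [Finset.mem_filter, Finset.mem_sigma, Finset.mem_Ioo, Finset.mem_range] at hx
      unfold Nested at hx
      obtain ⟨⟨⟨hk1, hk2⟩, hi, hi'⟩, hn⟩ := hx
      have hr : p = n - j - 2 := by omega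
      simp only [hT]
      by_cases h1 : i < k
      · by_cases h2 : i' < j
        · by_cases h3 : i < i'
          · simp only [swp₁, swp₂, h1, h2, h3, if_true]
            exact comp_disj hr hk2 hk1 (by omega) h3 h2
          · simp only [swp₁, swp₂, h1, h2, h3, if_true, if_false]
            have := comp_disj (E := E) (n := n) (k := n + j - k) (j := j) (k' := k) (i := i')
              (i' := i + j - k) hr (by omega) (by omega) (by omega) (by omega) (by omega)
            rw [add_comm]
            rwa [show i + j - k + n - (n + j - k) = i by omega] at this
        · simp only [swp₁, swp₂, h1, h2, if_true, if_false]
          have := comp_disj' (E := E) (n := n) (k := n + j - k) (j := j) (k' := k)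
            (i := n + i' - k) (i' := i + j - i') hr (by omega) (by omega) (by omega) (by omega)
            (by omega) (by omega) (by omega)
          rw [add_comm]
          rwa [show i + j - i' + (n + i' - k) - (n + j - k) = i by omega,
            show n + i' - k + j - (n + j - k) = i' by omega] at this
      · simp only [swp₁, swp₂, h1, if_false]
        exact comp_disj' hr hk2 hk1 (by omega) (by omega) hi (by omega) (by omega)
    · rintro ⟨k, i, i'⟩ hx _
      simp only [Finset.mem_filter, Finset.mem_sigma, Finset.mem_Ioo, Finset.mem_range] at hx
      unfold Nested at hx
      obtain ⟨⟨⟨hk1, hk2⟩, hi, hi'⟩, hn⟩ := hx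
      intro he
      have he1 : n + j - k = k := congrArg (fun x : Triple => x.1) he
      have he2 : swp₁ n j k i i' = i := congrArg (fun x : Triple => x.2.1) he
      have he3 : swp₂ j k i i' = i' := congrArg (fun x : Triple => x.2.2) he
      unfold swp₁ at he2
      unfold swp₂ at he3
      split_ifs at he2 he3 <;> omega
    · rintro ⟨k, i, i'⟩ hx
      simp only [Finset.mem_filter, Finset.mem_sigma, Finset.mem_Ioo, Finset.mem_range] at hx
      unfold Nested at hx
      obtain ⟨⟨⟨hk1, hk2⟩, hi, hi'⟩, hn⟩ := hx
      simp only [Finset.mem_filter, Finset.mem_sigma, Finset.mem_Ioo, Finset.mem_range]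
      unfold Nested swp₁ swp₂
      split_ifs with h1 h2 h3 <;> omega
    · rintro ⟨k, i, i'⟩ hx
      simp only [Finset.mem_filter, Finset.mem_sigma, Finset.mem_Ioo, Finset.mem_range] at hx
      unfold Nested at hx
      obtain ⟨⟨⟨hk1, hk2⟩, hi, hi'⟩, hn⟩ := hx
      dsimp only
      refine triple_ext (by omega) ?_ ?_
      · by_cases h1 : i < k
        · by_cases h2 : i' < j
          · by_cases h3 : i < i'
            · simp only [swp₁, swp₂, h1, h2, h3, if_true]
              split_ifs <;> omega
            · simp only [swp₁, swp₂, h1, h2, h3, if_true, if_false]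
              split_ifs <;> omega
          · simp only [swp₁, swp₂, h1, h2, if_true, if_false]
            split_ifs <;> omega
        · simp only [swp₁, swp₂, h1, if_false]
          split_ifs <;> omega
      · by_cases h1 : i < k
        · by_cases h2 : i' < j
          · by_cases h3 : i < i'
            · simp only [swp₁, swp₂, h1, h2, h3, if_true]
              split_ifs <;> omega
            · simp only [swp₁, swp₂, h1, h2, h3, if_true, if_false]
              split_ifs <;> omega
          · simp only [swp₁, swp₂, h1, h2, if_true, if_false]
            split_ifs <;> omega
        · simp only [swp₁, swp₂, h1, if_false]
          split_ifs <;> omega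
  have e4 : ∑ x ∈ (Finset.Ioo j n).sigma fun k => (Finset.range n).sigma fun _ =>
        Finset.range (k - j + 1), T ⟨x.1, inn n j x.2.1 x.2.2, out n x.1 j x.2.1 x.2.2⟩ =
      ∑ x ∈ (((Finset.Ioo j n).sigma fun k => (Finset.range n).sigma fun _ =>
      Finset.range k).filter fun x : Triple => Nested j x.1 x.2.1 x.2.2), T x := by
    refine Finset.sum_nbij' (fun x => ⟨x.1, inn n j x.2.1 x.2.2, out n x.1 j x.2.1 x.2.2⟩)
      (fun x => ⟨x.1,
        if x.2.2 < j then (if x.2.1 < x.1 then x.2.2 else x.2.1)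
        else if x.2.1 < x.1 then (if x.2.1 + j ≤ x.2.2 then n + x.2.2 - x.1 else x.2.2)
        else x.2.1 + x.2.2 - x.1,
        if x.2.2 < j then (if x.2.1 < x.1 then x.2.1 - x.2.2 else 0)
        else if x.2.1 < x.1 then
          (if x.2.1 + j ≤ x.2.2 then x.2.1 + x.1 - x.2.2 else x.2.1 - x.2.2)
        else x.1 - x.2.2⟩) ?_ ?_ ?_ ?_ ?_
    · rintro ⟨k, I, a⟩ hx
      simp only [Finset.mem_sigma, Finset.mem_Ioo, Finset.mem_range] at hx
      obtain ⟨⟨hk1, hk2⟩, hI, ha⟩ := hx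
      simp only [Finset.mem_filter, Finset.mem_sigma, Finset.mem_Ioo, Finset.mem_range]
      unfold Nested inn out
      split_ifs <;> omega
    · rintro ⟨k, i, i'⟩ hx
      simp only [Finset.mem_filter, Finset.mem_sigma, Finset.mem_Ioo, Finset.mem_range] at hx
      unfold Nested at hx
      obtain ⟨⟨⟨hk1, hk2⟩, hi, hi'⟩, hn⟩ := hx
      simp only [Finset.mem_sigma, Finset.mem_Ioo, Finset.mem_range]
      split_ifs <;> omega
    · rintro ⟨k, I, a⟩ hx
      simp only [Finset.mem_sigma, Finset.mem_Ioo, Finset.mem_range] at hx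
      obtain ⟨⟨hk1, hk2⟩, hI, ha⟩ := hx
      dsimp only
      refine triple_ext rfl ?_ ?_
      all_goals unfold inn out
      all_goals split_ifs <;> omega
    · rintro ⟨k, i, i'⟩ hx
      simp only [Finset.mem_filter, Finset.mem_sigma, Finset.mem_Ioo, Finset.mem_range] at hx
      unfold Nested at hx
      obtain ⟨⟨⟨hk1, hk2⟩, hi, hi'⟩, hn⟩ := hx
      dsimp only
      by_cases h1 : i' < j <;> by_cases h2 : i < k <;> by_cases h3 : i + j ≤ i' <;>
        simp only [h1, h2, h3, if_true, if_false]
      all_goals refine triple_ext rfl ?_ ?_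
      all_goals first | unfold inn | unfold out
      all_goals split_ifs <;> omega
    · rintro ⟨k, I, a⟩ _
      rfl
  rw [e1, e2, e4, ← e5, e3, add_zero, neg_add_cancel]

end AinfProp

/-- The action data of a dg-functor `A ⟶ Ch` with underlying graded groups `X a p`: the
differentials, and the action of the morphisms of `A`, given by chain maps
`X a ⊗ hom a b ⟶ X b`. -/
@[ext]
structure DGModule {O : Type w} (A : DGCat.{u} O) (X : O → ℤ → AddCommGrpCat.{u}) where
  d (a : O) (p q : ℤ) : X a p →+ X a q
  shape (a : O) (p q : ℤ) (h : q + 1 ≠ p) : d a p q = 0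
  d_d (a : O) (p q r : ℤ) (x : X a p) : d a q r (d a p q x) = 0
  act {a b : O} {p q r : ℤ} (h : p + q = r) : X a p →+ (A.hom a b).X q →+ X b r
  act_id {a : O} {p : ℤ} (x : X a p) : act (add_zero p) x (A.id a) = x
  act_comp {a b c : O} {p q r pq qr s : ℤ} (h₁ : p + q = pq) (h₂ : pq + r = s)
    (h₃ : q + r = qr) (h₄ : p + qr = s)
    (x : X a p) (f : (A.hom a b).X q) (g : (A.hom b c).X r) :
    act h₂ (act h₁ x f) g = act h₄ x (A.comp h₃ f g)
  d_act {a b : O} {p q r p' q' r' : ℤ} (h : p + q = r)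
    (hp : p' + 1 = p) (hq : q' + 1 = q) (hr : r' + 1 = r) (x : X a p) (f : (A.hom a b).X q) :
    d b r r' (act h x f) =
      act (by omega) (d a p p' x) f + sgn p • act (by omega) x ((A.hom a b).d q q' f)

/-- A dg-functor from `A` to the dg-category of chain complexes. -/
structure DGFunctor {O : Type w} (A : DGCat.{u} O) where
  X : O → ℤ → AddCommGrpCat.{u}
  str : DGModule A X

/-- Homogeneous maps of degree `s` between families of graded groups. -/
abbrev GrHom {O : Type w} (X Y : O → ℤ → AddCommGrpCat.{u}) (s : ℤ) : Type (max u w) :=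
  ∀ (a : O) (p q : ℤ), p + s = q → (X a p →+ Y a q)

/-- Naturality of a homogeneous map between dg-functors:
`(x ⬝ f) θ = (-1)^(|f||θ|) (x θ) ⬝ f`. -/
def GrHom.IsNat {O : Type w} {A : DGCat.{u} O} {X Y : O → ℤ → AddCommGrpCat.{u}}
    (S : DGModule A X) (T : DGModule A Y) {s : ℤ} (θ : GrHom X Y s) : Prop :=
  ∀ ⦃a b : O⦄ ⦃p q r p' r' : ℤ⦄ (h : p + q = r) (hp : p + s = p') (hr : r + s = r')
    (x : X a p) (f : (A.hom a b).X q),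
    θ b r r' hr (S.act h x f) = sgn (q * s) • T.act (by omega) (θ a p p' hp x) f

/-- The elements of degree `s` of the complex of natural transformations `Φ ⟶ Ψ`. -/
structure DGTrans {O : Type w} {A : DGCat.{u} O} (Φ Ψ : DGFunctor A) (s : ℤ) where
  app : GrHom Φ.X Ψ.X s
  naturality : GrHom.IsNat Φ.str Ψ.str app

section Hoch

variable (X Y : ℕ → ℤ → AddCommGrpCat.{u})

/-- The underlying graded groups `⨁_{n ≥ 1} X(n + m)[n - 1]` of the Hochschild complex; the
summand `n = j + 1` is indexed by `j`. -/
def hochX (m : ℕ) (p : ℤ) : AddCommGrpCat.{u} :=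
  AddCommGrpCat.of (DirectSum ℕ fun j => X (j + 1 + m) (p - j))

variable {X Y}

/-- The inclusion `x ↦ x ⊗ l_{j+1}` of a summand. -/
def hochInc (j : ℕ) {m : ℕ} {p' p : ℤ} (h : p' + j = p) : X (j + 1 + m) p' →+ hochX X m p :=
  (DirectSum.of (fun j : ℕ => X (j + 1 + m) (p - j)) j).comp
    (eqToHom (congrArg (X (j + 1 + m)) (by omega : p' = p - j))).hom

/-- Homomorphisms out of the direct sum. -/
def hochDesc {m : ℕ} {p : ℤ} {B : Type*} [AddCommGroup B]
    (F : ∀ (j : ℕ) (p' : ℤ), p' + j = p → (X (j + 1 + m) p' →+ B)) : hochX X m p →+ B :=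
  DirectSum.toAddMonoid fun j => F j (p - j) (by omega)

@[simp]
lemma hochDesc_inc {m : ℕ} {p : ℤ} {B : Type*} [AddCommGroup B]
    (F : ∀ (j : ℕ) (p' : ℤ), p' + j = p → (X (j + 1 + m) p' →+ B)) (j : ℕ) {p' : ℤ}
    (h : p' + j = p) (x : X (j + 1 + m) p') : hochDesc F (hochInc j h x) = F j p' h x := by
  obtain rfl : p' = p - j := by omega
  simp only [hochDesc, hochInc, eqToHom_refl]
  exact DirectSum.toAddMonoid_of _ _ _

lemma hoch_hom_ext {m : ℕ} {p : ℤ} {B : Type*} [AddCommGroup B] {f g : hochX X m p →+ B}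
    (h : ∀ (j : ℕ) (p' : ℤ) (hp : p' + j = p) (x : X (j + 1 + m) p'),
      f (hochInc j hp x) = g (hochInc j hp x)) : f = g := by
  refine DirectSum.addHom_ext fun j x => ?_
  have := h j (p - j) (by omega) x
  simp only [hochInc, eqToHom_refl] at this
  exact this

/-- The map induced on Hochschild complexes by a homogeneous map of degree `s`. -/
def hochMap {s : ℤ} (θ : GrHom X Y s) : GrHom (hochX X) (hochX Y) s := fun m p q h =>
  hochDesc fun j p' hp =>
    sgn (j * s) • (hochInc j (by omega)).comp (θ (j + 1 + m) p' (p' + s) rfl)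

lemma hochMap_inc {s : ℤ} (θ : GrHom X Y s) {m : ℕ} {p q p' q' : ℤ} (h : p + s = q) (j : ℕ)
    (hp : p' + j = p) (hq : q' + j = q) (hs : p' + s = q') (x : X (j + 1 + m) p') :
    hochMap θ m p q h (hochInc j hp x) = sgn (j * s) • hochInc j hq (θ _ p' q' hs x) := by
  subst hs
  simp [hochMap]

namespace AinfProp

variable (E : AinfProp.{u})

/-- `f_{j+1,i+1} ⊗ id_m` -/
def hochOp (m j i : ℕ) :
    (E.hom (j + 1 + m) (i + 1 + m)).X (((j + 1 : ℕ) : ℤ) - ((i + 1 : ℕ) : ℤ) - 1) :=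
  E.win 0 m (by omega) (by omega) (E.hochTerm (j + 1) (i + 1))

variable {E}

/-- The differential
`x ⊗ l_n ↦ dx ⊗ l_n + (-1)^|x| ∑_{k < n} x ⬝ (f_{n,k} ⊗ id_m) ⊗ l_k` of the Hochschild complex. -/
def hochD (S : DGModule E.toDGCat X) (m : ℕ) (p q : ℤ) : hochX X m p →+ hochX X m q :=
  if hq : q + 1 = p then
    hochDesc fun j p' hp =>
      (hochInc j (by omega)).comp (S.d (j + 1 + m) p' (p' - 1)) +
        sgn p' • ∑ i ∈ Finset.range j,
          (hochInc i (p' := q - i) (by omega)).comp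
            ((S.act (by omega)).flip (E.hochOp m j i))
  else 0

/-- The action `(x ⊗ l_n) ⬝ f = (-1)^((n-1)|f|) x ⬝ (id_n ⊗ f) ⊗ l_n` on the Hochschild complex. -/
def hochAct (S : DGModule E.toDGCat X) {m m' : ℕ} {p q r : ℤ} (h : p + q = r) :
    hochX X m p →+ (E.hom m m').X q →+ hochX X m' r :=
  hochDesc fun j p' hp => sgn (j * q) • AddMonoidHom.mk'
    (fun x => (hochInc j (p' := p' + q) (by omega)).comp
      ((S.act rfl x).comp (E.win (j + 1) 0 (by omega) (by omega))))
    (fun x y => by ext f; simp)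

lemma hochD_inc (S : DGModule E.toDGCat X) {m : ℕ} {p q p' q' : ℤ} (hq : q + 1 = p) {j : ℕ}
    (hp : p' + j = p) (hq' : q' + j = q) (x : X (j + 1 + m) p') :
    hochD S m p q (hochInc j hp x) = hochInc j hq' (S.d _ p' q' x) +
      sgn p' • ∑ i ∈ Finset.range j, hochInc i (p' := q - i) (by omega)
        (S.act (by omega) x (E.hochOp m j i)) := by
  obtain rfl : q' = p' - 1 := by omega
  simp [hochD, hq, AddMonoidHom.finsetSum_apply]

lemma hochAct_inc (S : DGModule E.toDGCat X) {m m' : ℕ} {p q r p' r' : ℤ} (h : p + q = r)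
    {j : ℕ} (hp : p' + j = p) (hr : r' + j = r) (h' : p' + q = r') (x : X (j + 1 + m) p')
    (f : (E.hom m m').X q) :
    hochAct S h (hochInc j hp x) f =
      sgn (j * q) • hochInc j hr (S.act h' x (E.win (j + 1) 0 (by omega) (by omega) f)) := by
  subst h'
  simp [hochAct]

lemma d_hochOp {m j l : ℕ} (h : l < j) {p : ℤ} (hp : p + 1 = (j + 1 : ℕ) - (l + 1 : ℕ) - 1) :
    (E.hom _ _).d _ p (E.hochOp m j l) + ∑ i ∈ Finset.Ioo l j, sgn (j - i - 1) •
      E.comp (by omega) (E.hochOp m j i) (E.hochOp m i l) = 0 := by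
  have := hochTerm_mc (E := E) (j + 1) (l + 1) (by omega) (by omega) hp
  have h2 : ∑ i ∈ Finset.Ioo l j, sgn (j - i - 1) •
      E.comp (r := p) (by omega) (E.hochOp m j i) (E.hochOp m i l) =
      E.win 0 m (by omega) (by omega) (∑ k ∈ Finset.Ioo (l + 1) (j + 1),
        sgn ((j + 1 : ℕ) - k - 1) •
          E.comp (by omega) (E.hochTerm (j + 1) k) (E.hochTerm k (l + 1))) := by
    rw [map_sum]
    refine Finset.sum_nbij' (fun i => i + 1) (fun k => k - 1) ?_ ?_ ?_ ?_ ?_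
    · intro i; simp only [Finset.mem_Ioo]; omega
    · intro i; simp only [Finset.mem_Ioo]; omega
    · intro i; simp only [Finset.mem_Ioo]; omega
    · intro i; simp only [Finset.mem_Ioo]; omega
    · intro i _
      simp only [hochOp]
      rw [DGProp.comp_win, map_zsmul]
      congr 1
      congr 1
      push_cast
      ring
  rw [h2, hochOp, DGProp.d_win _ _ _ _ hp, ← map_add, this, map_zero]

lemma hochOp_comm {m m' j i : ℕ} {q r : ℤ} (h : ((j + 1 : ℕ) : ℤ) - (i + 1 : ℕ) - 1 + q = r)
    (f : (E.hom m m').X q) :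
    E.comp h (E.hochOp m j i) (E.win (i + 1) 0 (by omega) (by omega) f) =
      sgn ((j - i - 1) * q) • E.comp (by omega) (E.win (j + 1) 0 (by omega) (by omega) f)
        (E.hochOp m' j i) := by
  have := DGProp.win_disj (E := E.toDGProp) 0 0 0 (bl := j + 1) (bl' := i + 1) (br := m)
    (br' := m') (n := j + 1 + m) (k := i + 1 + m) (k' := j + 1 + m') (m := i + 1 + m')
    (by omega) (by omega) (by omega) (by omega) h (by omega) (by omega) (by omega) (by omega)
    (by omega) (by omega) (by omega) (by omega) (by omega) (E.hochTerm (j + 1) (i + 1)) f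
  rw [hochOp, hochOp, this]
  congr 2
  push_cast
  ring

/-- The Hochschild complex `C(Φ)` of a dg-functor `Φ`, with its action of `E`. -/
def hochStr (S : DGModule E.toDGCat X) : DGModule E.toDGCat (hochX X) where
  d := hochD S
  shape m p q h := by simp [hochD, h]
  d_d m p q r x := by
    by_cases hq : q + 1 = p
    swap
    · simp [hochD, hq]
    by_cases hr : r + 1 = q
    swap
    · simp [hochD, hr]
    have : (hochD S m q r).comp (hochD S m p q) = 0 := by
      refine hoch_hom_ext fun j p' hp x => ?_
      have key : ∀ l ∈ Finset.range j, hochInc (X := X) (m := m) l (p' := r - l) (by omega)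
          (S.act (by omega) x ((E.hom _ _).d _ (j - l - 2) (E.hochOp m j l))) +
          ∑ i ∈ Finset.Ioo l j, sgn (j - i - 1) • hochInc l (p' := r - l) (p := r) (by omega)
            (S.act (q := (i + 1 : ℕ) - (l + 1 : ℕ) - 1) (p := q - i) (by omega)
              (S.act (by omega) x (E.hochOp m j i)) (E.hochOp m i l)) = 0 := by
        intro l hl
        have := d_hochOp (E := E) (m := m) (Finset.mem_range.1 hl) (p := j - l - 2) (by omega)
        have := congrArg (fun z => hochInc (X := X) (m := m) l (p' := r - l) (p := r) (by omega)
          (S.act (p := p') (by omega) x z)) this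
        simp only [map_add, map_sum, map_zsmul, map_zero] at this
        rw [← this]
        congr 1
        refine Finset.sum_congr rfl fun i _ => ?_
        congr 2
        exact S.act_comp ..
      have hs : sgn (p' - 1) = - sgn p' := by
        rw [sub_eq_add_neg, sgn_add, show sgn (-1) = -1 by simp [sgn], mul_neg_one]
      have e1 : ∀ i ∈ Finset.range j, hochD S m q r (hochInc i (p' := q - i) (by omega)
          (S.act (by omega) x (E.hochOp m j i))) =
          hochInc i (p' := r - i) (by omega) (S.act (by omega) (S.d _ p' (p' - 1) x)
            (E.hochOp m j i)) +
          sgn p' • hochInc i (p' := r - i) (by omega) (S.act (by omega) x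
            ((E.hom _ _).d _ (j - i - 2) (E.hochOp m j i))) +
          sgn (q - i) • ∑ l ∈ Finset.range i, hochInc l (p' := r - l) (by omega)
            (S.act (by omega) (S.act (p := p') (r := q - i) (by omega) x (E.hochOp m j i))
              (E.hochOp m i l)) := by
        intro i hi
        rw [hochD_inc S hr (q' := r - i) _ (by omega),
          S.d_act _ (p' := p' - 1) (q' := j - i - 2) (by omega) (by omega) (by omega), map_add,
          map_zsmul]
      rw [AddMonoidHom.comp_apply, AddMonoidHom.zero_apply, hochD_inc S hq (q' := p' - 1) hp
        (by omega), map_add, map_zsmul, map_sum, Finset.sum_congr rfl e1,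
        hochD_inc S hr (q' := p' - 2) (by omega) (by omega), S.d_d, map_zero, zero_add, hs]
      simp only [Finset.sum_add_distrib, smul_add, neg_smul]
      have e0 : ∀ A B C : hochX X m r, -A + (A + B + C) = B + C := by intros; abel
      rw [e0, ← Finset.smul_sum, smul_smul, sgn_mul_self, one_smul]
      have e2 : sgn p' • ∑ i ∈ Finset.range j, sgn (q - i) • ∑ l ∈ Finset.range i,
          hochInc (X := X) (m := m) l (p' := r - l) (p := r) (by omega)
            (S.act (by omega) (S.act (p := p') (r := q - i) (by omega) x (E.hochOp m j i))
              (E.hochOp m i l)) =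
          ∑ l ∈ Finset.range j, ∑ i ∈ Finset.Ioo l j, sgn (j - i - 1) •
            hochInc l (p' := r - l) (p := r) (by omega)
            (S.act (q := (i + 1 : ℕ) - (l + 1 : ℕ) - 1) (p := q - i) (by omega)
              (S.act (by omega) x (E.hochOp m j i)) (E.hochOp m i l)) := by
        simp only [Finset.smul_sum, smul_smul, ← sgn_add]
        rw [Finset.sum_comm' (t' := Finset.range j) (s' := fun l => Finset.Ioo l j)]
        · refine Finset.sum_congr rfl fun l _ => Finset.sum_congr rfl fun i _ => ?_
          congr 1
          apply sgn_congr
          exact ⟨p', by omega⟩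
        · intro i l
          simp only [Finset.mem_range, Finset.mem_Ioo]
          omega
      rw [e2, ← Finset.sum_add_distrib]
      exact Finset.sum_eq_zero key
    exact DFunLike.congr_fun this x
  act := hochAct S
  act_id {m p} x := by
    have : (hochAct S (add_zero p)).flip (E.id m) = AddMonoidHom.id _ := by
      refine hoch_hom_ext fun j p' hp x => ?_
      rw [AddMonoidHom.flip_apply, hochAct_inc S _ hp hp (add_zero p'), DGProp.win_id, S.act_id,
        mul_zero, sgn_zero, one_smul, AddMonoidHom.id_apply]
    exact DFunLike.congr_fun this x
  act_comp {a b c p q r pq qr s} h₁ h₂ h₃ h₄ x f g := by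
    have : ((hochAct S h₂).flip g).comp ((hochAct S h₁).flip f) =
        (hochAct S h₄).flip (E.comp h₃ f g) := by
      refine hoch_hom_ext fun j p' hp x => ?_
      simp only [AddMonoidHom.comp_apply, AddMonoidHom.flip_apply]
      rw [hochAct_inc S h₁ hp (r' := p' + q) (by omega) rfl, map_zsmul, AddMonoidHom.zsmul_apply,
        hochAct_inc S h₂ _ (r' := p' + q + r) (by omega) rfl,
        hochAct_inc S h₄ hp (r' := p' + q + r) (by omega) (by omega),
        S.act_comp rfl rfl h₃ (by omega), DGProp.comp_win, smul_smul, ← sgn_add]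
      congr 2
      rw [← h₃]; ring
    exact DFunLike.congr_fun this x
  d_act {a b p q r p' q' r'} h hp hq hr x f := by
    have : (hochD S b r r').comp ((hochAct S h).flip f) =
        ((hochAct S (by omega)).flip f).comp (hochD S a p p') +
          sgn p • (hochAct S (by omega)).flip ((E.hom a b).d q q' f) := by
      refine hoch_hom_ext fun j k hk x => ?_
      simp only [AddMonoidHom.comp_apply, AddMonoidHom.flip_apply, AddMonoidHom.add_apply,
        AddMonoidHom.zsmul_apply]
      have e1 : ∀ i ∈ Finset.range j, hochInc (X := X) (p := r') i (p' := r' - i) (by omega)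
          (S.act (by omega) (S.act (p := k) (r := k + q) rfl x
            (E.win (j + 1) 0 (by omega) (by omega) f)) (E.hochOp b j i)) =
          sgn ((j - i - 1) * q) • hochInc i (p' := r' - i) (by omega)
          (S.act (by omega) (S.act (p := k) (r := p' - i) (by omega) x (E.hochOp a j i))
            (E.win (i + 1) 0 (by omega) (by omega) f)) := by
        intro i _
        rw [S.act_comp rfl (by omega) (qr := r' - i - k) (by omega) (by omega),
          S.act_comp (by omega) (by omega) (qr := r' - i - k) (by omega) (by omega),
          hochOp_comm, map_zsmul, map_zsmul, smul_smul, sgn_mul_self, one_smul]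
      rw [hochAct_inc S h hk (r' := k + q) (by omega) rfl, map_zsmul,
        hochD_inc S hr (q' := k + q - 1) _ (by omega), Finset.sum_congr rfl e1,
        S.d_act rfl (p' := k - 1) (q' := q') (by omega) hq (by omega),
        hochD_inc S hp (q' := k - 1) hk (by omega)]
      have e3 : ∀ i ∈ Finset.range j, hochAct S (p := p') (r := r') (by omega) (hochInc i (p' := p' - i)
          (by omega) (S.act (p := k) (by omega) x (E.hochOp a j i))) f =
          sgn (i * q) • hochInc i (p := r') (p' := r' - i) (by omega)
          (S.act (by omega) (S.act (p := k) (r := p' - i) (by omega) x (E.hochOp a j i))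
            (E.win (i + 1) 0 (by omega) (by omega) f)) := by
        intro i _
        rw [hochAct_inc S _ _ (r' := r' - i) (by omega) (by omega)]
      simp only [map_add, map_zsmul, map_sum, AddMonoidHom.add_apply, AddMonoidHom.zsmul_apply,
        AddMonoidHom.finsetSum_apply]
      rw [Finset.sum_congr rfl e3, hochAct_inc S _ _ (r' := k + q - 1) (by omega) (by omega),
        hochAct_inc S _ _ (r' := k + q - 1) (by omega) (by omega), DGProp.d_win _ _ _ _ hq]
      simp only [smul_add, smul_smul, Finset.smul_sum, ← sgn_add]
      have e0 : ∀ A B B' C C' : hochX X b r', B = B' → C = C' → A + B + C = A + C' + B' := by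
        rintro A B B' C C' rfl rfl
        abel
      apply e0
      · congr 1
        apply sgn_congr
        rw [← hk, ← hq]
        exact ⟨0, by ring⟩
      · refine Finset.sum_congr rfl fun i _ => ?_
        congr 1
        apply sgn_congr
        exact ⟨j * q - i * q, by ring⟩
    exact DFunLike.congr_fun this x

end AinfProp
end Hoch

section GrHom

variable {O : Type w} {X Y Z W : O → ℤ → AddCommGrpCat.{u}}

instance {s : ℤ} : AddCommGroup (GrHom X Y s) where
  add θ η a p q h := θ a p q h + η a p q h
  zero _ _ _ _ := 0
  neg θ a p q h := - θ a p q h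
  sub θ η a p q h := θ a p q h - η a p q h
  nsmul n θ a p q h := n • θ a p q h
  zsmul n θ a p q h := n • θ a p q h
  add_assoc _ _ _ := by funext; exact add_assoc _ _ _
  zero_add _ := by funext; exact zero_add _
  add_zero _ := by funext; exact add_zero _
  add_comm _ _ := by funext; exact add_comm _ _
  neg_add_cancel _ := by funext; exact neg_add_cancel _
  sub_eq_add_neg _ _ := by funext; exact sub_eq_add_neg _ _
  nsmul_zero _ := by funext; exact zero_nsmul _
  nsmul_succ _ _ := by funext; exact succ_nsmul _ _
  zsmul_zero' _ := by funext; exact zero_zsmul _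
  zsmul_succ' _ _ := by funext; exact SubNegMonoid.zsmul_succ' _ _
  zsmul_neg' _ _ := by funext; exact SubNegMonoid.zsmul_neg' _ _

lemma GrHom.add_apply {s : ℤ} (θ η : GrHom X Y s) (a : O) {p q : ℤ} (h : p + s = q) (x : X a p) :
    (θ + η) a p q h x = θ a p q h x + η a p q h x := rfl

lemma GrHom.neg_apply {s : ℤ} (θ : GrHom X Y s) (a : O) {p q : ℤ} (h : p + s = q) (x : X a p) :
    (-θ) a p q h x = - θ a p q h x := rfl

lemma GrHom.zsmul_apply {s : ℤ} (n : ℤ) (θ : GrHom X Y s) (a : O) {p q : ℤ} (h : p + s = q)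
    (x : X a p) : (n • θ) a p q h x = n • θ a p q h x := rfl

lemma GrHom.zero_apply {s : ℤ} (a : O) {p q : ℤ} (h : p + s = q)
    (x : X a p) : (0 : GrHom X Y s) a p q h x = 0 := rfl

lemma GrHom.ext {s : ℤ} {θ η : GrHom X Y s}
    (H : ∀ (a : O) (p q : ℤ) (h : p + s = q) (x : X a p), θ a p q h x = η a p q h x) : θ = η := by
  funext a p q h
  exact AddMonoidHom.ext (H a p q h)

/-- Composition of homogeneous maps, in diagrammatic order. -/
def GrHom.comp {s t r : ℤ} (h : s + t = r) : GrHom X Y s →+ GrHom Y Z t →+ GrHom X Z r :=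
  AddMonoidHom.mk' (fun θ => AddMonoidHom.mk'
    (fun η a p q hq => (η a (p + s) q (by omega)).comp (θ a p (p + s) rfl))
    (fun η η' => GrHom.ext fun _ _ _ _ _ => rfl))
    (fun θ θ' => by
      ext1 η
      exact GrHom.ext fun a p q h x => map_add (η a (p + s) q (by omega)) _ _)

/-- The identity map. -/
def GrHom.id (X : O → ℤ → AddCommGrpCat.{u}) : GrHom X X 0 := fun a p _ h =>
  (eqToHom (congrArg (X a) (by omega))).hom

/-- The differential `x (dθ) = (-1)^|x| (d (x θ) - (dx) θ)` of homogeneous maps, for which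
`d (x θ) = (dx) θ + (-1)^|x| x (dθ)`. -/
def GrHom.diff (dX : ∀ a p q, X a p →+ X a q) (dY : ∀ a p q, Y a p →+ Y a q) {s t : ℤ}
    (h : t + 1 = s) : GrHom X Y s →+ GrHom X Y t :=
  AddMonoidHom.mk' (fun θ a p q hq => sgn p •
    ((dY a (q + 1) q).comp (θ a p (q + 1) (by omega)) -
      (θ a (p - 1) q (by omega)).comp (dX a p (p - 1))))
    (fun θ θ' => by
      refine GrHom.ext fun a p q h x => ?_
      simp only [GrHom.add_apply, AddMonoidHom.zsmul_apply, AddMonoidHom.sub_apply,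
        AddMonoidHom.comp_apply, map_add]
      rw [← smul_add]
      congr 1
      abel)

lemma GrHom.comp_apply {s t r : ℤ} (h : s + t = r) (θ : GrHom X Y s) (η : GrHom Y Z t)
    (a : O) {p p' q : ℤ} (hp : p + s = p') (hp' : p' + t = q) (hq : p + r = q) (x : X a p) :
    GrHom.comp h θ η a p q hq x = η a p' q hp' (θ a p p' hp x) := by
  subst hp; rfl

lemma GrHom.id_apply (a : O) {p : ℤ} (h : p + 0 = p) (x : X a p) :
    GrHom.id X a p p h x = x := by
  simp [GrHom.id]

lemma GrHom.diff_apply (dX : ∀ a p q, X a p →+ X a q) (dY : ∀ a p q, Y a p →+ Y a q)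
    {s t : ℤ} (h : t + 1 = s) (θ : GrHom X Y s) (a : O) {p q p' q' : ℤ} (hq : p + t = q)
    (hp' : p' + 1 = p) (hq' : q + 1 = q') (x : X a p) :
    GrHom.diff dX dY h θ a p q hq x =
      sgn p • (dY a q' q (θ a p q' (by omega) x) - θ a p' q (by omega) (dX a p p' x)) := by
  obtain rfl : p' = p - 1 := by omega
  subst hq'
  rfl

lemma sgn_sub_one (p : ℤ) : sgn (p - 1) = - sgn p := by
  rw [sub_eq_add_neg, sgn_add, show sgn (-1) = -1 by simp [sgn], mul_neg_one]

lemma GrHom.d_apply (dX : ∀ a p q, X a p →+ X a q) (dY : ∀ a p q, Y a p →+ Y a q)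
    {s t : ℤ} (h : t + 1 = s) (θ : GrHom X Y s) (a : O) {p q p' q' : ℤ} (hq : p + t = q)
    (hp' : p' + 1 = p) (hq' : q + 1 = q') (x : X a p) :
    dY a q' q (θ a p q' (by omega) x) = θ a p' q (by omega) (dX a p p' x) +
      sgn p • GrHom.diff dX dY h θ a p q hq x := by
  rw [GrHom.diff_apply dX dY h θ a hq hp' hq', smul_smul, sgn_mul_self, one_smul]
  abel

lemma GrHom.diff_diff (dX : ∀ a p q, X a p →+ X a q) (dY : ∀ a p q, Y a p →+ Y a q)
    (hX : ∀ a p q r x, dX a q r (dX a p q x) = 0) (hY : ∀ a p q r x, dY a q r (dY a p q x) = 0)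
    {s t r : ℤ} (h : t + 1 = s) (h' : r + 1 = t) (θ : GrHom X Y s) :
    GrHom.diff dX dY h' (GrHom.diff dX dY h θ) = 0 := by
  refine GrHom.ext fun a p q hq x => ?_
  rw [GrHom.diff_apply dX dY h' _ a hq (p' := p - 1) (q' := q + 1) (by omega) (by omega),
    GrHom.diff_apply dX dY h _ a _ (p' := p - 1) (q' := q + 2) (by omega) (by omega),
    GrHom.diff_apply dX dY h _ a _ (p' := p - 2) (q' := q + 1) (by omega) (by omega),
    hX, map_zero, map_zsmul, map_sub, hY, sgn_sub_one]
  simp [GrHom.zero_apply]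

lemma GrHom.diff_comp (dX : ∀ a p q, X a p →+ X a q) (dY : ∀ a p q, Y a p →+ Y a q)
    (dZ : ∀ a p q, Z a p →+ Z a q)
    {s t r s' t' r' : ℤ} (h : s + t = r) (hs : s' + 1 = s) (ht : t' + 1 = t) (hr : r' + 1 = r)
    (θ : GrHom X Y s) (η : GrHom Y Z t) :
    GrHom.diff dX dZ hr (GrHom.comp h θ η) =
      GrHom.comp (by omega) (GrHom.diff dX dY hs θ) η +
        sgn s • GrHom.comp (by omega) θ (GrHom.diff dY dZ ht η) := by
  refine GrHom.ext fun a p q hq x => ?_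
  simp only [GrHom.add_apply, GrHom.zsmul_apply]
  rw [GrHom.diff_apply dX dZ hr _ a hq (p' := p - 1) (q' := q + 1) (by omega) (by omega),
    GrHom.comp_apply _ _ _ a (p' := p + s) (by omega) (by omega),
    GrHom.comp_apply _ _ _ a (p' := p + s') (by omega) (by omega),
    GrHom.comp_apply _ _ _ a (p' := p + s') (by omega) (by omega),
    GrHom.comp_apply _ _ _ a (p' := p + s) (by omega) (by omega),
    GrHom.diff_apply dX dY hs _ a _ (p' := p - 1) (q' := p + s) (by omega) (by omega),
    GrHom.diff_apply dY dZ ht _ a _ (p' := p + s') (q' := q + 1) (by omega) (by omega),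
    map_zsmul, map_sub, smul_smul, ← sgn_add, sgn_congr (p := s + (p + s)) (q := p) ⟨s, by ring⟩,
    ← smul_add]
  congr 1
  abel

lemma GrHom.id_comp {s : ℤ} (θ : GrHom X Y s) : GrHom.comp (zero_add s) (GrHom.id X) θ = θ := by
  refine GrHom.ext fun a p q hq x => ?_
  rw [GrHom.comp_apply _ _ _ a (add_zero p) hq, GrHom.id_apply]

lemma GrHom.comp_id {s : ℤ} (θ : GrHom X Y s) : GrHom.comp (add_zero s) θ (GrHom.id Y) = θ := by
  refine GrHom.ext fun a p q hq x => ?_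
  rw [GrHom.comp_apply _ _ _ a hq (add_zero q), GrHom.id_apply]

lemma GrHom.comp_assoc {p q r pq qr s : ℤ} (h₁ : p + q = pq) (h₂ : pq + r = s)
    (h₃ : q + r = qr) (h₄ : p + qr = s) (f : GrHom X Y p) (g : GrHom Y Z q) (k : GrHom Z W r) :
    GrHom.comp h₂ (GrHom.comp h₁ f g) k = GrHom.comp h₄ f (GrHom.comp h₃ g k) := by
  refine GrHom.ext fun a i j hij x => ?_
  rw [GrHom.comp_apply _ _ _ a (p' := i + pq) rfl (by omega),
    GrHom.comp_apply _ _ _ a (p' := i + p) rfl (by omega),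
    GrHom.comp_apply _ _ _ a (p' := i + p) rfl (by omega),
    GrHom.comp_apply _ _ _ a (p' := i + pq) (by omega) (by omega)]

end GrHom

section Hoch

variable {X Y : ℕ → ℤ → AddCommGrpCat.{u}}

/-- The underlying graded groups of the iterated Hochschild complex. -/
def hochIterX : ℕ → (ℕ → ℤ → AddCommGrpCat.{u}) → ℕ → ℤ → AddCommGrpCat.{u}
  | 0, X => X
  | n + 1, X => hochX (hochIterX n X)

/-- The map induced on iterated Hochschild complexes by a homogeneous map. -/
def hochIterMap {s : ℤ} (θ : GrHom X Y s) : ∀ n : ℕ, GrHom (hochIterX n X) (hochIterX n Y) s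
  | 0 => θ
  | n + 1 => hochMap (hochIterMap θ n)

namespace AinfProp

variable {E : AinfProp.{u}}

/-- The iterated Hochschild complex `C^n(Φ) = C(C^(n-1)(Φ))`, as a functor on `E`. -/
def hochIterStr (S : DGModule E.toDGCat X) : ∀ n : ℕ, DGModule E.toDGCat (hochIterX n X)
  | 0 => S
  | n + 1 => hochStr (hochIterStr S n)

lemma isNat_hochMap (S : DGModule E.toDGCat X) (T : DGModule E.toDGCat Y) {s : ℤ}
    (θ : GrHom X Y s) (hθ : GrHom.IsNat S T θ) : GrHom.IsNat (hochStr S) (hochStr T) (hochMap θ) := by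
  intro a b p q r p' r' h hp hr x f
  have : (hochMap θ b r r' hr).comp ((hochAct S h).flip f) =
      sgn (q * s) • ((hochAct T (p := p') (r := r') (by omega)).flip f).comp
        (hochMap θ a p p' hp) := by
    refine hoch_hom_ext fun j k hk x => ?_
    simp only [AddMonoidHom.comp_apply, AddMonoidHom.flip_apply, AddMonoidHom.zsmul_apply]
    rw [hochAct_inc S h hk (r' := k + q) (by omega) rfl, map_zsmul,
      hochMap_inc θ hr (q' := k + q + s) _ _ (by omega) rfl,
      hθ rfl rfl, hochMap_inc θ hp (q' := k + s) _ _ (by omega) rfl, map_zsmul (hochAct T _),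
      AddMonoidHom.zsmul_apply, hochAct_inc T _ _ (r' := k + q + s) (by omega) (by omega)]
    simp only [map_zsmul, smul_smul, ← sgn_add]
    congr 2
    ring
  exact DFunLike.congr_fun this x

lemma diff_hochMap (S : DGModule E.toDGCat X) (T : DGModule E.toDGCat Y) {s t : ℤ}
    (h : t + 1 = s) (θ : GrHom X Y s) (hθ : GrHom.IsNat S T θ) :
    GrHom.diff (hochD S) (hochD T) h (hochMap θ) = hochMap (GrHom.diff S.d T.d h θ) := by
  funext m p q hq
  refine hoch_hom_ext fun j k hk x => ?_
  rw [GrHom.diff_apply _ _ h _ m hq (p' := p - 1) (q' := q + 1) (by omega) (by omega),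
    hochMap_inc θ _ (q' := k + s) _ _ (by omega) rfl,
    hochMap_inc _ _ (q' := k + t) _ _ (by omega) rfl, map_zsmul,
    hochD_inc T (p := q + 1) rfl (q' := k + t) _ (by omega), hochD_inc S (q := p - 1) (by omega) (q' := k - 1) _ (by omega),
    GrHom.diff_apply _ _ h _ _ _ (p' := k - 1) (q' := k + s) (by omega) (by omega),
    map_add, map_zsmul, map_sum, hochMap_inc θ _ (q' := k + t) _ _ (by omega) (by omega)]
  have e : ∀ i ∈ Finset.range j, hochMap θ m (p - 1) q (by omega)
      (hochInc i (p' := p - 1 - i) (by omega) (S.act (by omega) x (E.hochOp m j i))) =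
      sgn (i * s) • sgn ((j - i - 1) * s) • hochInc i (p' := q - i) (by omega)
        (T.act (by omega) (θ _ k (k + s) rfl x) (E.hochOp m j i)) := by
    intro i _
    rw [hochMap_inc θ _ (q' := q - i) _ _ (by omega) (by omega), hθ _ rfl, map_zsmul]
    congr 3
    push_cast
    ring
  rw [Finset.sum_congr rfl e]
  simp only [smul_add, smul_sub, Finset.smul_sum, smul_smul, ← sgn_add, map_sub, map_zsmul]
  have e0 : ∀ A A' B B' C C' : hochX Y m q, A = A' → B = B' → C = C' →
      A + B - (C + B') = A' - C' := by
    rintro A A' B B' C C' rfl rfl rfl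
    abel
  apply e0
  · congr 1
    apply sgn_congr
    rw [← h, ← hk]
    exact ⟨j, by ring⟩
  · refine Finset.sum_congr rfl fun i _ => ?_
    congr 1
    apply sgn_congr
    exact ⟨s, by ring⟩
  · congr 1
    apply sgn_congr
    rw [← h, ← hk]
    exact ⟨j, by ring⟩

end AinfProp
end Hoch

lemma GrHom.isNat_diff {O : Type w} {A : DGCat.{u} O} {X Y : O → ℤ → AddCommGrpCat.{u}}
    (S : DGModule A X) (T : DGModule A Y) {s t : ℤ} (h : t + 1 = s) (θ : GrHom X Y s)
    (hθ : GrHom.IsNat S T θ) : GrHom.IsNat S T (GrHom.diff S.d T.d h θ) := by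
  intro a b p q r p' r' hr hp hr' x f
  rw [GrHom.diff_apply S.d T.d h θ b hr' (p' := r - 1) (q' := r' + 1) (by omega) rfl,
    GrHom.diff_apply S.d T.d h θ a hp (p' := p - 1) (q' := p' + 1) (by omega) rfl,
    hθ hr (p' := p' + 1) (by omega),
    S.d_act hr (p' := p - 1) (q' := q - 1) (by omega) (by omega) (by omega), map_zsmul,
    T.d_act _ (p' := p') (q' := q - 1) (by omega) (by omega) (by omega), map_add, map_zsmul,
    hθ _ (p' := p') (by omega), hθ _ (p' := p' + 1) (by omega), map_zsmul (T.act _),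
    AddMonoidHom.zsmul_apply, map_sub, AddMonoidHom.sub_apply]
  simp only [smul_add, smul_sub, smul_smul, ← sgn_add]
  have e0 : ∀ A A' B B' C C' : Y b r', A = A' → B = B' → C = C' →
      A + B - (C + B') = A' - C' := by
    rintro A A' B B' C C' rfl rfl rfl
    abel
  apply e0
  all_goals
    congr 1
    apply sgn_congr
    rw [← h, ← hr]
  · exact ⟨q, by ring⟩
  · refine ⟨t + 1, ?_⟩
    obtain rfl : p' = p + t := hp.symm
    ring
  · exact ⟨q, by ring⟩

/-- The differential of a natural transformation. -/
def DGTrans.diff {O : Type w} {A : DGCat.{u} O} {Φ Ψ : DGFunctor A} {s t : ℤ} (h : t + 1 = s)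
    (θ : DGTrans Φ Ψ s) : DGTrans Φ Ψ t where
  app := GrHom.diff Φ.str.d Ψ.str.d h θ.app
  naturality := GrHom.isNat_diff _ _ h _ θ.naturality

/-- Restriction along a dg-functor that is the identity on objects. -/
def DGModule.pullback {O : Type w} {A B : DGCat.{u} O} (F : A.Functor B)
    {X : O → ℤ → AddCommGrpCat.{u}} (S : DGModule B X) : DGModule A X where
  d := S.d
  shape := S.shape
  d_d := S.d_d
  act {a b p q r} h := (S.act h).compl₂ ((F.map a b).f q).hom
  act_id {a p} x := by
    have := F.map_id a
    simp [this, S.act_id]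
  act_comp h₁ h₂ h₃ h₄ x f g := by
    have := F.map_comp h₃ f g
    simp [this, S.act_comp h₁ h₂ h₃ h₄]
  d_act {a b _ q _ _ q' _} h hp hq hr x f := by
    have : (B.hom a b).d q q' ((F.map a b).f q f) = (F.map a b).f q' ((A.hom a b).d q q' f) := by
      have := (F.map a b).comm q q'
      exact congrArg (fun k => k.hom f) this
    simp only [AddMonoidHom.compl₂_apply]
    rw [S.d_act h hp hq hr, this]

/-- Restriction of a dg-functor `B ⟶ Ch` along a dg-functor `A ⟶ B`. -/
def DGFunctor.pullback {O : Type w} {A B : DGCat.{u} O} (F : A.Functor B) (Φ : DGFunctor B) :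
    DGFunctor A where
  X := Φ.X
  str := Φ.str.pullback F

/-- Restriction of a natural transformation. -/
def DGTrans.pullback {O : Type w} {A B : DGCat.{u} O} (F : A.Functor B) {Φ Ψ : DGFunctor B}
    {s : ℤ} (θ : DGTrans Φ Ψ s) : DGTrans (Φ.pullback F) (Ψ.pullback F) s where
  app := θ.app
  naturality _ _ _ _ _ _ _ h hp hr x _ := θ.naturality h hp hr x _

namespace AinfProp

/-- A dg-functor between props with `A_∞`-multiplication that is the identity on objects and
commutes with the functors from `A_∞`, that is, preserves the morphisms `id_a ⊗ m_s ⊗ id_b` and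
`id_a ⊗ σ ⊗ id_b`, for `σ` a symmetry, which generate the image of `A_∞`. Every symmetric
monoidal such functor that preserves the multiplications `m_s` is an example. -/
structure Hom (E E' : AinfProp.{u}) extends DGCat.Functor E.toDGCat E'.toDGCat where
  map_mul (a b : ℕ) {s n m : ℕ} {p : ℤ} (hs : 2 ≤ s) (hp : p + 2 = s) (hn : a + s + b = n)
    (hm : a + 1 + b = m) :
    (map n m).f p (E.win a b hn hm (E.mul s p hs hp)) = E'.win a b hn hm (E'.mul s p hs hp)
  map_braid (a b : ℕ) {s t c c' n m : ℕ} (h : s + t = c) (h' : t + s = c') (hn : a + c + b = n)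
    (hm : a + c' + b = m) :
    (map n m).f 0 (E.win a b hn hm (E.braid s t h h')) = E'.win a b hn hm (E'.braid s t h h')

namespace Hom

variable {E E' : AinfProp.{u}} (φ : Hom E E')

lemma map_block (a b : ℕ) {n k N K : ℕ} (hN : a + n + b = N) (hK : a + k + b = K) (i : ℕ) :
    (φ.map N K).f _ (E.win a b hN hK (E.block n k i)) = E'.win a b hN hK (E'.block n k i) := by
  unfold block
  split_ifs
  · rw [DGProp.win_win i (k - 1 - i) a b (a'' := a + i) (b'' := k - 1 - i + b) _ _ _ _ rfl rfl
      (by omega) (by omega), φ.map_mul, ← DGProp.win_win i (k - 1 - i) a b]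
    · rfl
    · rfl
  · simp only [map_zero]

lemma map_cyc (a b : ℕ) {n k N K : ℕ} (hN : a + n + b = N) (hK : a + k + b = K) (i : ℕ) :
    (φ.map N K).f _ (E.win a b hN hK (E.cyc n k i)) = E'.win a b hN hK (E'.cyc n k i) := by
  unfold cyc
  split_ifs
  · rw [map_zsmul, map_zsmul, map_zsmul, φ.map_block]
  · rw [map_zsmul, map_zsmul, map_zsmul, ← DGProp.comp_win _ _ _ hN hN hK,
      ← DGProp.comp_win _ _ _ hN hN hK, φ.map_comp, φ.map_block, φ.map_braid]
  · simp only [map_zero]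

lemma map_hochTerm (a b : ℕ) {n k N K : ℕ} (hN : a + n + b = N) (hK : a + k + b = K) :
    (φ.map N K).f _ (E.win a b hN hK (E.hochTerm n k)) = E'.win a b hN hK (E'.hochTerm n k) := by
  unfold hochTerm
  simp only [map_neg, map_sum, φ.map_cyc]

/-- Structures over `E` and `E'` with the same differentials, on which the terms of the
Hochschild differentials act in the same way. -/
def Agree {X : ℕ → ℤ → AddCommGrpCat.{u}} (S : DGModule E.toDGCat X)
    (S' : DGModule E'.toDGCat X) : Prop :=
  S.d = S'.d ∧ ∀ (a b : ℕ) {n k N K : ℕ} (hN : a + n + b = N) (hK : a + k + b = K) {p r : ℤ}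
    (h : p + ((n : ℤ) - k - 1) = r) (x : X N p),
    S.act h x (E.win a b hN hK (E.hochTerm n k)) = S'.act h x (E'.win a b hN hK (E'.hochTerm n k))

lemma agree_pullback {X : ℕ → ℤ → AddCommGrpCat.{u}} (S : DGModule E'.toDGCat X) :
    Agree (E := E) (S.pullback φ.toFunctor) S :=
  ⟨rfl, fun a b _ _ _ _ hN hK _ _ h x => congrArg (S.act h x) (φ.map_hochTerm a b hN hK)⟩

lemma Agree.hochStr {X : ℕ → ℤ → AddCommGrpCat.{u}} {S : DGModule E.toDGCat X}
    {S' : DGModule E'.toDGCat X} (H : Agree S S') : Agree (hochStr S) (hochStr S') := by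
  refine ⟨?_, fun a b n k N K hN hK p r h x => ?_⟩
  · funext m p q
    change hochD S m p q = hochD S' m p q
    by_cases hq : q + 1 = p
    · refine hoch_hom_ext fun j p' hp x => ?_
      rw [hochD_inc _ hq _ (q' := p' - 1) (by omega), hochD_inc _ hq _ (q' := p' - 1) (by omega),
        H.1]
      congr 2
      refine Finset.sum_congr rfl fun i _ => ?_
      congr 1
      exact H.2 ..
    · simp [hochD, hq]
  · have : (hochAct S h).flip (E.win a b hN hK (E.hochTerm n k)) =
        (hochAct S' h).flip (E'.win a b hN hK (E'.hochTerm n k)) := by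
      refine hoch_hom_ext fun j p' hp x => ?_
      simp only [AddMonoidHom.flip_apply]
      rw [hochAct_inc _ h hp (r' := r - j) (by omega) (by omega),
        hochAct_inc _ h hp (r' := r - j) (by omega) (by omega),
        DGProp.win_win a b (j + 1) 0 (a'' := j + 1 + a) (b'' := b) _ _ _ _ rfl (add_zero b)
          (by omega) (by omega),
        DGProp.win_win a b (j + 1) 0 (a'' := j + 1 + a) (b'' := b) _ _ _ _ rfl (add_zero b)
          (by omega) (by omega), H.2]
    exact DFunLike.congr_fun this x

lemma Agree.hochIterStr {X : ℕ → ℤ → AddCommGrpCat.{u}} {S : DGModule E.toDGCat X}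
    {S' : DGModule E'.toDGCat X} (H : Agree S S') :
    ∀ n : ℕ, Agree (hochIterStr S n) (hochIterStr S' n)
  | 0 => H
  | n + 1 => (H.hochIterStr n).hochStr

end Hom

variable (E : AinfProp.{u})

/-- The graded groups `C^n(Φ)(m)` underlying the functor `Φ ↦ C^n(Φ)(m)`. -/
def opX (n m : ℕ) (Φ : DGFunctor E.toDGCat) (p : ℤ) : AddCommGrpCat.{u} := hochIterX n Φ.X m p

/-- The differential of `C^n(Φ)(m)`. -/
def opD (n m : ℕ) (Φ : DGFunctor E.toDGCat) (p q : ℤ) : E.opX n m Φ p →+ E.opX n m Φ q :=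
  (hochIterStr Φ.str n).d m p q

/-- The action of a natural transformation on `C^n(-)(m)`. -/
def opMap (n m : ℕ) {Φ Ψ : DGFunctor E.toDGCat} {s : ℤ} (θ : DGTrans Φ Ψ s) {p q : ℤ}
    (h : p + s = q) : E.opX n m Φ p →+ E.opX n m Ψ q :=
  hochIterMap θ.app n m p q h

variable {E}

lemma isNat_hochIterMap {X Y : ℕ → ℤ → AddCommGrpCat.{u}} (S : DGModule E.toDGCat X)
    (T : DGModule E.toDGCat Y) {s : ℤ} (θ : GrHom X Y s) (hθ : GrHom.IsNat S T θ) :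
    ∀ n : ℕ, GrHom.IsNat (hochIterStr S n) (hochIterStr T n) (hochIterMap θ n)
  | 0 => hθ
  | n + 1 => isNat_hochMap _ _ _ (isNat_hochIterMap S T θ hθ n)

lemma diff_hochIterMap {X Y : ℕ → ℤ → AddCommGrpCat.{u}} (S : DGModule E.toDGCat X)
    (T : DGModule E.toDGCat Y) {s t : ℤ} (h : t + 1 = s) (θ : GrHom X Y s)
    (hθ : GrHom.IsNat S T θ) :
    ∀ n : ℕ, GrHom.diff (hochIterStr S n).d (hochIterStr T n).d h (hochIterMap θ n) =
      hochIterMap (GrHom.diff S.d T.d h θ) n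
  | 0 => rfl
  | n + 1 => by
    exact (diff_hochMap _ _ h _ (isNat_hochIterMap S T θ hθ n)).trans
      (congrArg hochMap (diff_hochIterMap S T h θ hθ n))

lemma opD_opD (n m : ℕ) (Φ : DGFunctor E.toDGCat) (p q r : ℤ) (x : E.opX n m Φ p) :
    E.opD n m Φ q r (E.opD n m Φ p q x) = 0 :=
  (hochIterStr Φ.str n).d_d m p q r x

lemma opD_opMap (n m : ℕ) {Φ Ψ : DGFunctor E.toDGCat} {s t : ℤ} (ht : t + 1 = s)
    (θ : DGTrans Φ Ψ s) {p q p' q' : ℤ} (hq' : p + s = q') (hp' : p' + 1 = p) (hq : q + 1 = q')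
    (x : E.opX n m Φ p) :
    E.opD n m Ψ q' q (E.opMap n m θ hq' x) =
      E.opMap n m θ (by omega) (E.opD n m Φ p p' x) +
        sgn p • E.opMap n m (θ.diff ht) (by omega) x := by
  have := GrHom.d_apply (hochIterStr Φ.str n).d (hochIterStr Ψ.str n).d ht
    (hochIterMap θ.app n) m (p := p) (q := q) (by omega) hp' hq x
  rw [diff_hochIterMap _ _ ht _ θ.naturality] at this
  exact this

/-- Naturality of a family of homogeneous maps `C^n₁(Φ)(m₁) ⟶ C^n₂(Φ)(m₂)` of degree `p`, with
respect to the natural transformations `θ : Φ ⟶ Ψ` of all degrees: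
`(x θ) ν_Ψ = (-1)^(|θ||ν|) (x ν_Φ) θ`. -/
def IsNatOp {n₁ m₁ n₂ m₂ : ℕ} {p : ℤ} (ν : GrHom (E.opX n₁ m₁) (E.opX n₂ m₂) p) : Prop :=
  ∀ ⦃Φ Ψ : DGFunctor E.toDGCat⦄ ⦃s : ℤ⦄ (θ : DGTrans Φ Ψ s) ⦃q r q' r' : ℤ⦄ (h : q + p = r)
    (hq : q + s = q') (hr : q' + p = r') (x : E.opX n₁ m₁ Φ q),
    ν Ψ q' r' hr (E.opMap n₁ m₁ θ hq x) =
      sgn (s * p) • E.opMap n₂ m₂ θ (by omega) (ν Φ q r h x)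

lemma isNatOp_diff {n₁ m₁ n₂ m₂ : ℕ} {p t : ℤ} (ht : t + 1 = p)
    {ν : GrHom (E.opX n₁ m₁) (E.opX n₂ m₂) p} (hν : IsNatOp ν) :
    IsNatOp (GrHom.diff (E.opD n₁ m₁) (E.opD n₂ m₂) ht ν) := by
  intro Φ Ψ s θ q r q' r' h hq hr x
  have hs : s - 1 + 1 = s := by omega
  rw [GrHom.diff_apply _ _ ht ν Ψ hr (p' := q' - 1) (q' := r' + 1) (by omega) rfl,
    GrHom.diff_apply _ _ ht ν Φ h (p' := q - 1) (q' := r + 1) (by omega) rfl,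
    hν θ (q := q) (r := r + 1) (by omega),
    opD_opMap n₁ m₁ hs θ _ (p' := q - 1) (by omega) (by omega), map_add, map_zsmul, map_zsmul,
    opD_opMap n₂ m₂ hs θ _ (p' := r) rfl (by omega),
    hν θ (q := q - 1) (r := r) (by omega), hν (θ.diff hs) (q := q) (r := r + 1) (by omega),
    map_zsmul, map_sub]
  simp only [smul_add, smul_sub, smul_smul, ← sgn_add]
  have e0 : ∀ A A' B B' C C' : E.opX n₂ m₂ Ψ r', A = A' → B = B' → C = C' →
      A + B - (C + B') = A' - C' := by
    rintro A A' B B' C C' rfl rfl rfl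
    abel
  apply e0
  all_goals
    congr 1
    apply sgn_congr
    rw [← ht, ← hq]
  · exact ⟨s, by ring⟩
  · refine ⟨t + 1, ?_⟩
    obtain rfl : r = q + t := h.symm
    ring
  · exact ⟨s, by ring⟩

lemma isNatOp_id (n m : ℕ) : IsNatOp (GrHom.id (E.opX n m)) := by
  intro Φ Ψ s θ q r q' r' h hq hr x
  obtain rfl : q = r := by omega
  obtain rfl : q' = r' := by omega
  rw [GrHom.id_apply, GrHom.id_apply, mul_zero, sgn_zero, one_smul]

lemma isNatOp_comp {n₁ m₁ n₂ m₂ n₃ m₃ : ℕ} {p q r : ℤ} (h : p + q = r)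
    {ν : GrHom (E.opX n₁ m₁) (E.opX n₂ m₂) p} {μ : GrHom (E.opX n₂ m₂) (E.opX n₃ m₃) q}
    (hν : IsNatOp ν) (hμ : IsNatOp μ) : IsNatOp (GrHom.comp h ν μ) := by
  intro Φ Ψ s θ i j i' j' hj hi hj' x
  rw [GrHom.comp_apply _ _ _ Ψ (p' := i' + p) rfl (by omega),
    GrHom.comp_apply _ _ _ Φ (p' := i + p) rfl (by omega), hν θ (r := i + p) rfl hi, map_zsmul,
    hμ θ (r := j) (by omega), smul_smul, ← sgn_add, ← mul_add]
  congr 3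

variable (E)

/-- The complex of natural transformations from `C^n₁(-)(m₁)` to `C^n₂(-)(m₂)`. -/
def opHom (n₁ m₁ n₂ m₂ : ℕ) (p : ℤ) : AddSubgroup (GrHom (E.opX n₁ m₁) (E.opX n₂ m₂) p) where
  carrier := {ν | IsNatOp ν}
  zero_mem' Φ Ψ s θ q r q' r' h hq hr x := by simp [GrHom.zero_apply]
  add_mem' hν hμ Φ Ψ s θ q r q' r' h hq hr x := by
    rw [GrHom.add_apply, GrHom.add_apply, hν θ h, hμ θ h, map_add, smul_add]
  neg_mem' hν Φ Ψ s θ q r q' r' h hq hr x := by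
    rw [GrHom.neg_apply, GrHom.neg_apply, hν θ h, map_neg, smul_neg]

/-- The differential of the complex of natural transformations. -/
def opHomD (n₁ m₁ n₂ m₂ : ℕ) (p q : ℤ) : E.opHom n₁ m₁ n₂ m₂ p →+ E.opHom n₁ m₁ n₂ m₂ q :=
  if h : q + 1 = p then
    ((GrHom.diff (E.opD n₁ m₁) (E.opD n₂ m₂) h).comp
      (E.opHom n₁ m₁ n₂ m₂ p).subtype).codRestrict (E.opHom n₁ m₁ n₂ m₂ q)
      fun ν => isNatOp_diff h ν.2
  else 0

lemma opHomD_coe {n₁ m₁ n₂ m₂ : ℕ} {p q : ℤ} (h : q + 1 = p) (ν : E.opHom n₁ m₁ n₂ m₂ p) :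
    (E.opHomD n₁ m₁ n₂ m₂ p q ν : GrHom (E.opX n₁ m₁) (E.opX n₂ m₂) q) =
      GrHom.diff (E.opD n₁ m₁) (E.opD n₂ m₂) h ν.1 := by
  rw [opHomD, dif_pos h]
  rfl

variable {E} in
/-- The composition of natural transformations. -/
def opComp {n₁ m₁ n₂ m₂ n₃ m₃ : ℕ} {p q r : ℤ} (h : p + q = r) :
    E.opHom n₁ m₁ n₂ m₂ p →+ E.opHom n₂ m₂ n₃ m₃ q →+ E.opHom n₁ m₁ n₃ m₃ r :=
  AddMonoidHom.mk' (fun ν => AddMonoidHom.mk'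
    (fun μ => ⟨GrHom.comp h ν.1 μ.1, isNatOp_comp h ν.2 μ.2⟩)
    (fun μ μ' => Subtype.ext (map_add (GrHom.comp h ν.1) μ.1 μ'.1)))
    (fun ν ν' => AddMonoidHom.ext fun μ => Subtype.ext
      (DFunLike.congr_fun (map_add (GrHom.comp h) ν.1 ν'.1) μ.1))

lemma opHomD_opComp {n₁ m₁ n₂ m₂ n₃ m₃ : ℕ} {p q r p' q' r' : ℤ} (h : p + q = r)
    (hp : p' + 1 = p) (hq : q' + 1 = q) (hr : r' + 1 = r) (ν : E.opHom n₁ m₁ n₂ m₂ p)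
    (μ : E.opHom n₂ m₂ n₃ m₃ q) :
    E.opHomD n₁ m₁ n₃ m₃ r r' (opComp h ν μ) =
      opComp (by omega) (E.opHomD n₁ m₁ n₂ m₂ p p' ν) μ +
        sgn p • opComp (by omega) ν (E.opHomD n₂ m₂ n₃ m₃ q q' μ) := by
  apply Subtype.ext
  refine (opHomD_coe E hr _).trans ((GrHom.diff_comp (E.opD n₁ m₁) (E.opD n₂ m₂) (E.opD n₃ m₃)
    h hp hq hr ν.1 μ.1).trans ?_)
  rw [← opHomD_coe E hp, ← opHomD_coe E hq]
  rfl

/-- The dg-category of formal operations: its objects are the pairs `(n, m)`, standing for the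
dg-functors `Φ ↦ C^n(Φ)(m)`, and its morphisms are the complexes of natural transformations. -/
def formalOps : DGCat.{u + 1} (ℕ × ℕ) where
  hom a b :=
    { X := fun p => AddCommGrpCat.of (E.opHom a.1 a.2 b.1 b.2 p)
      d := fun p q => AddCommGrpCat.ofHom (E.opHomD a.1 a.2 b.1 b.2 p q)
      shape := fun p q h => by
        have h : ¬ q + 1 = p := h
        rw [opHomD, dif_neg h]
        rfl
      d_comp_d' := fun p q r h h' => by
        have h : q + 1 = p := h
        have h' : r + 1 = q := h'
        refine AddCommGrpCat.hom_ext (AddMonoidHom.ext fun ν => Subtype.ext ?_)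
        change (E.opHomD a.1 a.2 b.1 b.2 q r (E.opHomD a.1 a.2 b.1 b.2 p q ν)).1 = 0
        rw [opHomD_coe _ h', opHomD_coe _ h]
        exact GrHom.diff_diff _ _ (opD_opD a.1 a.2) (opD_opD b.1 b.2) h h' ν.1 }
  comp h := opComp h
  id a := ⟨GrHom.id _, isNatOp_id a.1 a.2⟩
  id_comp f := Subtype.ext (GrHom.id_comp _)
  comp_id f := Subtype.ext (GrHom.comp_id _)
  assoc h₁ h₂ h₃ h₄ f g k := Subtype.ext (GrHom.comp_assoc h₁ h₂ h₃ h₄ _ _ _)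
  d_comp h hp hq hr f g := E.opHomD_opComp h hp hq hr f g

variable {E}

namespace Hom

variable {E E' : AinfProp.{u}} (φ : Hom E E')

/-- The family `Φ' ↦ ν_(φ^*Φ')`: since `C^n(φ^*Φ')(m) = C^n(Φ')(m)`, it is a family of maps
`C^n₁(Φ')(m₁) ⟶ C^n₂(Φ')(m₂)`. -/
def restrict {n₁ m₁ n₂ m₂ : ℕ} {p : ℤ} (ν : GrHom (E.opX n₁ m₁) (E.opX n₂ m₂) p) :
    GrHom (E'.opX n₁ m₁) (E'.opX n₂ m₂) p :=
  fun Φ => ν (Φ.pullback φ.toFunctor)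

lemma opD_pullback (n m : ℕ) (Φ : DGFunctor E'.toDGCat) :
    E.opD n m (Φ.pullback φ.toFunctor) = E'.opD n m Φ := by
  funext p q
  exact congrFun (congrFun (congrFun ((φ.agree_pullback Φ.str).hochIterStr n).1 m) p) q

lemma isNatOp_restrict {n₁ m₁ n₂ m₂ : ℕ} {p : ℤ} {ν : GrHom (E.opX n₁ m₁) (E.opX n₂ m₂) p}
    (hν : IsNatOp ν) : IsNatOp (φ.restrict ν) :=
  fun _ _ _ θ _ _ _ _ h hq hr x => hν (θ.pullback φ.toFunctor) h hq hr x

lemma restrict_diff {n₁ m₁ n₂ m₂ : ℕ} {p t : ℤ} (h : t + 1 = p)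
    (ν : GrHom (E.opX n₁ m₁) (E.opX n₂ m₂) p) :
    φ.restrict (GrHom.diff (E.opD n₁ m₁) (E.opD n₂ m₂) h ν) =
      GrHom.diff (E'.opD n₁ m₁) (E'.opD n₂ m₂) h (φ.restrict ν) := by
  refine GrHom.ext fun Φ q r hr x => ?_
  have h₁ := φ.opD_pullback n₁ m₁ Φ
  have h₂ := φ.opD_pullback n₂ m₂ Φ
  rw [GrHom.diff_apply _ _ h _ Φ hr (p' := q - 1) (q' := r + 1) (by omega) rfl, ← h₁, ← h₂]
  rfl

/-- The map `ν ↦ (Φ' ↦ ν_(φ^*Φ'))` on natural transformations. -/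
def opRestrict (n₁ m₁ n₂ m₂ : ℕ) (p : ℤ) :
    E.opHom n₁ m₁ n₂ m₂ p →+ E'.opHom n₁ m₁ n₂ m₂ p where
  toFun ν := ⟨φ.restrict ν.1, φ.isNatOp_restrict ν.2⟩
  map_zero' := rfl
  map_add' _ _ := rfl

lemma opHomD_opRestrict {n₁ m₁ n₂ m₂ : ℕ} {p q : ℤ} (h : q + 1 = p)
    (ν : E.opHom n₁ m₁ n₂ m₂ p) :
    E'.opHomD n₁ m₁ n₂ m₂ p q (φ.opRestrict n₁ m₁ n₂ m₂ p ν) =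
      φ.opRestrict n₁ m₁ n₂ m₂ q (E.opHomD n₁ m₁ n₂ m₂ p q ν) := by
  apply Subtype.ext
  refine (opHomD_coe E' h _).trans ((φ.restrict_diff h ν.1).symm.trans ?_)
  rw [← opHomD_coe E h]
  rfl

/-- The dg-functor between the dg-categories of formal operations that is induced by `φ`. It is
the identity on objects, and takes a natural transformation `ν` to the natural transformation
`Φ' ↦ ν_(φ^*Φ')`. -/
def mapFormalOps : DGCat.Functor E.formalOps E'.formalOps where
  map a b :=
    { f := fun p => AddCommGrpCat.ofHom (φ.opRestrict a.1 a.2 b.1 b.2 p)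
      comm' := fun _ _ h =>
        AddCommGrpCat.hom_ext (AddMonoidHom.ext fun ν => φ.opHomD_opRestrict h ν) }
  map_id _ := rfl
  map_comp _ _ _ := rfl

end Hom

end AinfProp

/-! The proof is an induction on $n_1$; the target $(n_2,m_2)$ is arbitrary throughout.

For $n_1=0$ the source is $\Phi\mapsto\Phi(a)$, which is represented by $\mathcal{E}(a,-)$. By the
enriched Yoneda lemma (`opEval_injective`, `opEval_surjective`, `opEval_opHomD`), evaluation at
$\mathrm{id}_a$ identifies the complex of operations with $C^{n_2}(\mathcal{E}(a,-))(m_2)$. Under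
this identification the comparison map becomes $C^{n_2}$ applied to the natural transformation
$\mathcal{E}(a,-)\to\varphi^*\mathcal{E}'(a,-)$ given by $\varphi$ (`opEval_opRestrict`). That
transformation is a quasi-isomorphism at each object, so it remains to see that $C$ preserves
quasi-isomorphisms (`coneExact_hochMap`). The summands of $l_1,\dots,l_N$ form a subcomplex, because
the $f_{n,k}$ strictly lower the index. These subcomplexes exhaust $C(\Phi)(m)$, and the successive
quotients are shifts of $\Phi(N+1+m)$.

For the induction step, $C^{n+1}(\Phi)(m)$ is as a graded group the direct sum of shifted copies of
$C^n(\Phi)(j+1+m)$, $j\ge 0$. An operation on it is therefore an arbitrary family of operations on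
the summands. The operations vanishing on $l_1,\dots,l_N$ form a decreasing filtration by
subcomplexes which is complete and separated. Its graded pieces are, up to shift and sign, the
complexes of operations out of $(n,N+1+m)$, where the induction hypothesis applies
(`coneExact_opRestrict_succ`).

Both filtration arguments are run on the mapping cone of the comparison map, whose acyclicity is the
condition `ConeExact` (`quasiIso_iff_coneExact`). A cone cycle is corrected one filtration level at
a time: in the first case this ends after finitely many corrections (`exists_eq_of_exhaustive`), in
the second the corrections have a convergent sum (`exists_eq_of_complete`). No boundedness of the
complexes is needed. -/

/-! ### Exactness of filtered complexes -/

/-- Acyclicity of the mapping cone of `f`, in terms of elements. -/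
def ConeExact {A : ℤ → Type u} {B : ℤ → Type v} [∀ p, AddCommGroup (A p)]
    [∀ p, AddCommGroup (B p)] (dA : ∀ p q, A p →+ A q) (dB : ∀ p q, B p →+ B q)
    (f : ∀ p, A p →+ B p) : Prop :=
  ∀ ⦃p q r s : ℤ⦄, q + 1 = p → p + 1 = r → s + 1 = q → ∀ (x : A q) (y : B p),
    dA q s x = 0 → f q x = dB p q y →
      ∃ (u : A p) (v : B r), dA p q u = x ∧ f p u + dB r p v = y

/-- A cycle lying in an exhaustive increasing filtration whose graded pieces are exact is a
boundary. -/
lemma exists_eq_of_exhaustive {K₁ K₂ K₃ : Type*} [AddCommGroup K₁] [AddCommGroup K₂]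
    [AddCommGroup K₃] (δ₁ : K₁ →+ K₂) (δ₂ : K₂ →+ K₃) (hδ : ∀ c, δ₂ (δ₁ c) = 0)
    (F : ℕ → AddSubgroup K₂) (hF : F 0 = ⊥)
    (hstep : ∀ N, ∀ k ∈ F (N + 1), δ₂ k = 0 → ∃ c, k - δ₁ c ∈ F N) :
    ∀ N, ∀ k ∈ F N, δ₂ k = 0 → ∃ c, δ₁ c = k := by
  intro N
  induction N with
  | zero =>
    intro k hk _
    rw [hF, AddSubgroup.mem_bot] at hk
    exact ⟨0, by rw [map_zero, hk]⟩
  | succ N ih =>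
    intro k hk hk0
    obtain ⟨c, hc⟩ := hstep N k hk hk0
    obtain ⟨c', hc'⟩ := ih _ hc (by rw [map_sub, hδ, hk0, sub_zero])
    exact ⟨c' + c, by rw [map_add, hc', sub_add_cancel]⟩

/-- A cycle of a complex with a complete separated decreasing filtration whose graded pieces are
exact is a boundary. -/
lemma exists_eq_of_complete {K₁ K₂ K₃ : Type*} [AddCommGroup K₁] [AddCommGroup K₂]
    [AddCommGroup K₃] (δ₁ : K₁ →+ K₂) (δ₂ : K₂ →+ K₃) (hδ : ∀ c, δ₂ (δ₁ c) = 0)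
    (F₁ : ℕ → AddSubgroup K₁) (F₂ : ℕ → AddSubgroup K₂) (hF : F₂ 0 = ⊤)
    (hFδ : ∀ N, ∀ c ∈ F₁ N, δ₁ c ∈ F₂ N) (hsep : ∀ k, (∀ N, k ∈ F₂ N) → k = 0)
    (hcompl : ∀ c : ℕ → K₁, (∀ N, c N ∈ F₁ N) →
      ∃ l, ∀ N, l - ∑ i ∈ Finset.range N, c i ∈ F₁ N)
    (hstep : ∀ N, ∀ k ∈ F₂ N, δ₂ k = 0 → ∃ c ∈ F₁ N, k - δ₁ c ∈ F₂ (N + 1))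
    (k : K₂) (hk : δ₂ k = 0) : ∃ c, δ₁ c = k := by
  choose! g hg hg' using hstep
  -- `κ N` is what remains of `k` after `N` corrections: a cycle of filtration level `N`, with `g N
  -- (κ N)` as the next correction.
  let κ : ℕ → K₂ := fun N => Nat.rec k (fun N x => x - δ₁ (g N x)) N
  have hκ : ∀ N, κ N ∈ F₂ N ∧ δ₂ (κ N) = 0 := by
    intro N
    induction N with
    | zero => exact ⟨hF ▸ AddSubgroup.mem_top _, hk⟩
    | succ N ih =>
      refine ⟨hg' N _ ih.1 ih.2, ?_⟩
      change δ₂ (κ N - δ₁ (g N (κ N))) = 0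
      rw [map_sub, hδ, ih.2, sub_zero]
  have hsum : ∀ N, k - δ₁ (∑ i ∈ Finset.range N, g i (κ i)) = κ N := by
    intro N
    induction N with
    | zero => simp [κ]
    | succ N ih =>
      rw [Finset.sum_range_succ, map_add, ← sub_sub, ih]
  obtain ⟨l, hl⟩ := hcompl (fun N => g N (κ N)) fun N => hg N _ (hκ N).1 (hκ N).2
  refine ⟨l, (sub_eq_zero.1 (hsep _ fun N => ?_)).symm⟩
  -- For every `N`, `k - δ₁ l` equals `κ N` minus `δ₁` of the tail of the series. Both lie in `F₂
  -- N`, so separatedness applies.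
  have := (F₂ N).sub_mem (hκ N).1 (hFδ N _ (hl N))
  rw [← hsum N, map_sub] at this
  convert this using 1
  abel

/-! ### Quasi-isomorphisms of complexes of abelian groups in terms of elements -/

/-- The model is kernel modulo image. Only the properties needed for diagram chases are kept, so
that the quotient is not unfolded again. -/
lemma CategoryTheory.ShortComplex.exists_leftHomologyData_ab (S : ShortComplex Ab.{u}) :
    ∃ h : S.LeftHomologyData, (∀ k : h.K, S.g (h.i k) = 0) ∧
      (∀ x : S.X₂, S.g x = 0 → ∃ k : h.K, h.i k = x) ∧ Function.Injective h.i ∧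
      Function.Surjective h.π ∧ ∀ k : h.K, h.π k = 0 ↔ ∃ z, S.f z = h.i k := by
  refine ⟨S.abLeftHomologyData, fun k => k.2, fun x hx => ⟨⟨x, hx⟩, rfl⟩, Subtype.val_injective,
    Quotient.mk_surjective, fun k => ?_⟩
  refine (QuotientAddGroup.eq_zero_iff (G := AddMonoidHom.ker S.g.hom)
    (N := AddMonoidHom.range S.abToCycles) k).trans (exists_congr fun z => ?_)
  exact Subtype.ext_iff

/-- The two clauses are injectivity and surjectivity of the induced map on homology, with classes
replaced by representing cycles. -/
lemma CategoryTheory.ShortComplex.ab_quasiIso_iff {S T : ShortComplex Ab.{u}} (φ : S ⟶ T) :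
    ShortComplex.QuasiIso φ ↔
      (∀ (x : S.X₂) (y : T.X₁), S.g x = 0 → φ.τ₂ x = T.f y → ∃ z, S.f z = x) ∧
        ∀ y : T.X₂, T.g y = 0 → ∃ (x : S.X₂) (z : T.X₁), S.g x = 0 ∧ φ.τ₂ x + T.f z = y := by
  obtain ⟨hS, zS, lS, iS, sS, πS⟩ := S.exists_leftHomologyData_ab
  obtain ⟨hT, zT, lT, iT, sT, πT⟩ := T.exists_leftHomologyData_ab
  let γ := ShortComplex.leftHomologyMapData φ hS hT
  have hK : ∀ x : hS.K, hT.i (γ.φK x) = φ.τ₂ (hS.i x) := fun x =>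
    ConcreteCategory.congr_hom γ.commi x
  have hH : ∀ x : hS.K, γ.φH (hS.π x) = hT.π (γ.φK x) := fun x =>
    ConcreteCategory.congr_hom γ.commπ x
  rw [γ.quasiIso_iff, ConcreteCategory.isIso_iff_bijective]
  refine and_congr ?_ ?_
  · have e : Function.Injective γ.φH ↔ ∀ x, γ.φH x = 0 → x = 0 :=
      injective_iff_map_eq_zero γ.φH.hom
    refine e.trans ⟨fun h x y hx hy => ?_, fun h x hx => ?_⟩
    · obtain ⟨k, rfl⟩ := lS x hx
      refine (πS k).1 (h _ ?_)
      rw [hH, πT]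
      exact ⟨y, by rw [hK, hy]⟩
    · obtain ⟨x, rfl⟩ := sS x
      rw [hH, πT] at hx
      obtain ⟨z, hz⟩ := hx
      rw [πS]
      exact h _ z (zS x) (by rw [hz, hK])
  · refine ⟨fun h y hy => ?_, fun h y => ?_⟩
    · obtain ⟨k, rfl⟩ := lT y hy
      obtain ⟨x, hx⟩ := h (hT.π k)
      obtain ⟨x, rfl⟩ := sS x
      rw [hH] at hx
      obtain ⟨z, hz⟩ := (πT (k - γ.φK x)).1 (by rw [map_sub, hx, sub_self])
      exact ⟨hS.i x, z, zS x, by rw [hz, ← hK, map_sub, add_sub_cancel]⟩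
    · obtain ⟨y, rfl⟩ := sT y
      obtain ⟨x, z, hx, hz⟩ := h (hT.i y) (zT y)
      obtain ⟨k, rfl⟩ := lS x hx
      refine ⟨hS.π k, ?_⟩
      rw [hH, eq_comm, ← sub_eq_zero, ← map_sub, πT]
      exact ⟨z, by rw [map_sub, hK, ← hz, add_sub_cancel_left]⟩

lemma quasiIsoAt_iff_ab {K L : ChainComplex AddCommGrpCat.{u} ℤ} (f : K ⟶ L) {p q r : ℤ}
    (hr : p + 1 = r) (hq : q + 1 = p) : QuasiIsoAt f p ↔
      (∀ (x : K.X p) (y : L.X r), K.d p q x = 0 → f.f p x = L.d r p y → ∃ z, K.d r p z = x) ∧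
        ∀ y : L.X p, L.d p q y = 0 →
          ∃ (x : K.X p) (z : L.X r), K.d p q x = 0 ∧ f.f p x + L.d r p z = y :=
  (quasiIsoAt_iff' f r p q ((ComplexShape.down ℤ).prev_eq' hr)
    ((ComplexShape.down ℤ).next_eq' hq)).trans (ShortComplex.ab_quasiIso_iff _)

/-- For a cone cycle $(x,y)$, injectivity on $H_q$ gives $z$ with $dz=x$. Then $y-f(z)$ is a cycle,
and surjectivity on $H_p$ makes it $f$ of a cycle plus a boundary; adding that cycle to $z$ solves
both equations. -/
lemma quasiIso_iff_coneExact {K L : ChainComplex AddCommGrpCat.{u} ℤ} (f : K ⟶ L) :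
    _root_.QuasiIso f ↔ ConeExact (A := fun p => K.X p) (B := fun p => L.X p)
      (fun p q => (K.d p q).hom) (fun p q => (L.d p q).hom) (fun p => (f.f p).hom) := by
  have hf : ∀ p q (x : K.X p), L.d p q (f.f p x) = f.f q (K.d p q x) := fun p q x =>
    ConcreteCategory.congr_hom (f.comm p q) x
  rw [quasiIso_iff]
  refine ⟨fun h p q r s hq hr hs x y hx hy => ?_, fun h p => ?_⟩
  · obtain ⟨z, hz⟩ := ((quasiIsoAt_iff_ab f hq hs).1 (h q)).1 x y hx hy
    replace hy : f.f q x = L.d p q y := hy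
    obtain ⟨x', v, hx', hv⟩ := ((quasiIsoAt_iff_ab f hr hq).1 (h p)).2 (y - f.f p z) <| by
      rw [map_sub, hf, hz, hy, sub_self]
    refine ⟨z + x', v, ?_, ?_⟩
    · change K.d p q (z + x') = x
      rw [map_add, hz, hx', add_zero]
    · change f.f p (z + x') + L.d r p v = y
      rw [map_add, add_assoc, hv, add_sub_cancel]
  · refine (quasiIsoAt_iff_ab f (r := p + 1) (q := p - 1) rfl (by omega)).2
      ⟨fun x y hx hy => ?_, fun y hy => ?_⟩
    -- Injectivity in degree `p` is the first component of cone exactness one degree higher;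
    -- surjectivity is cone exactness for the cycles $(0,y)$.
    · obtain ⟨u, -, hu, -⟩ := h (p := p + 1) (q := p) (r := p + 2) (s := p - 1) rfl (by omega)
        (by omega) x y hx hy
      exact ⟨u, hu⟩
    · obtain ⟨u, v, hu, hv⟩ := h (p := p) (q := p - 1) (r := p + 1) (s := p - 2) (by omega) rfl
        (by omega) 0 y (map_zero _) (by rw [map_zero]; exact hy.symm)
      exact ⟨u, v, hu, hv⟩

/-! ### The Hochschild complex preserves quasi-isomorphisms -/

section Hoch

variable {X Y : ℕ → ℤ → AddCommGrpCat.{u}}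

/-- The coefficient of `l_{j+1}`. -/
def hochCoeff (j : ℕ) {m : ℕ} {p' p : ℤ} (h : p' + j = p) : hochX X m p →+ X (j + 1 + m) p' :=
  hochDesc fun i p'' h' => if hi : i = j then
    (eqToHom (by subst hi; congr 1; omega : X (i + 1 + m) p'' = X (j + 1 + m) p')).hom else 0

lemma hochCoeff_inc_self {j m : ℕ} {p' p : ℤ} (h : p' + j = p) (x : X (j + 1 + m) p') :
    hochCoeff j h (hochInc j h x) = x := by
  simp [hochCoeff]

lemma hochCoeff_inc_of_ne {i j m : ℕ} {p' p'' p : ℤ} (hij : i ≠ j) (h : p' + j = p)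
    (h' : p'' + i = p) (x : X (i + 1 + m) p'') : hochCoeff j h (hochInc i h' x) = 0 := by
  simp [hochCoeff, hij]

/-- The projection to the summands of `l_1, …, l_N`. -/
def hochTrunc (N : ℕ) {m : ℕ} {p : ℤ} : hochX X m p →+ hochX X m p :=
  hochDesc fun j _ h => if j < N then hochInc j h else 0

lemma hochTrunc_inc_of_lt {N j m : ℕ} {p' p : ℤ} (hj : j < N) (h : p' + j = p)
    (x : X (j + 1 + m) p') : hochTrunc N (hochInc j h x) = hochInc j h x := by
  simp [hochTrunc, hj]

lemma hochTrunc_inc_of_le {N j m : ℕ} {p' p : ℤ} (hj : N ≤ j) (h : p' + j = p)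
    (x : X (j + 1 + m) p') : hochTrunc N (hochInc j h x) = 0 := by
  simp [hochTrunc, hj.not_gt]

lemma hochTrunc_zero {m : ℕ} {p : ℤ} (x : hochX X m p) : hochTrunc 0 x = 0 := by
  have : hochTrunc 0 = (0 : hochX X m p →+ _) :=
    hoch_hom_ext fun j p' hp x => hochTrunc_inc_of_le (Nat.zero_le j) hp x
  exact DFunLike.congr_fun this x

/-- Successive truncations differ by the single summand of $l_{N+1}$. Hence an element supported on
$l_1,\dots,l_{N+1}$ whose top coefficient vanishes is supported on $l_1,\dots,l_N$. -/
lemma hochTrunc_succ {N m : ℕ} {p p' : ℤ} (h : p' + N = p) (x : hochX X m p) :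
    hochTrunc (N + 1) x = hochTrunc N x + hochInc N h (hochCoeff N h x) := by
  have : hochTrunc (N + 1) = hochTrunc N + (hochInc N h).comp (hochCoeff (X := X) (m := m) N h) := by
    refine hoch_hom_ext fun j p'' hp x => ?_
    rw [AddMonoidHom.add_apply, AddMonoidHom.comp_apply]
    rcases lt_trichotomy j N with hj | rfl | hj
    · rw [hochTrunc_inc_of_lt (by omega), hochTrunc_inc_of_lt hj, hochCoeff_inc_of_ne hj.ne,
        map_zero, add_zero]
    · obtain rfl : p'' = p' := by omega
      rw [hochTrunc_inc_of_lt (by omega), hochTrunc_inc_of_le le_rfl, hochCoeff_inc_self, zero_add]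
    · rw [hochTrunc_inc_of_le (by omega), hochTrunc_inc_of_le hj.le, hochCoeff_inc_of_ne hj.ne',
        map_zero, add_zero]
  exact DFunLike.congr_fun this x

lemma hochTrunc_hochTrunc {M N m : ℕ} (h : M ≤ N) {p : ℤ} (x : hochX X m p) :
    hochTrunc N (hochTrunc M x) = hochTrunc M x := by
  have : (hochTrunc N).comp (hochTrunc M) = (hochTrunc M : hochX X m p →+ _) := by
    refine hoch_hom_ext fun j p' hp x => ?_
    rw [AddMonoidHom.comp_apply]
    rcases lt_or_ge j M with hj | hj
    · rw [hochTrunc_inc_of_lt hj, hochTrunc_inc_of_lt (hj.trans_le h)]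
    · rw [hochTrunc_inc_of_le hj, map_zero]
  exact DFunLike.congr_fun this x

/-- Elements of a direct sum have finite support, so the filtration by truncations is exhaustive. -/
lemma exists_hochTrunc_eq {m : ℕ} {p : ℤ} (x : hochX X m p) :
    ∃ M, ∀ N, M ≤ N → hochTrunc N x = x := by
  suffices ∃ M, hochTrunc M x = x by
    obtain ⟨M, hM⟩ := this
    exact ⟨M, fun N h => by rw [← hM, hochTrunc_hochTrunc h]⟩
  have hadd : ∀ x y : hochX X m p, (∃ M, hochTrunc M x = x) → (∃ N, hochTrunc N y = y) →
      ∃ M, hochTrunc M (x + y) = x + y := by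
    rintro x y ⟨M, hM⟩ ⟨N, hN⟩
    refine ⟨max M N, ?_⟩
    rw [map_add, ← hM, ← hN, hochTrunc_hochTrunc (le_max_left M N),
      hochTrunc_hochTrunc (le_max_right M N)]
  induction x using DirectSum.induction_on with
  | zero => exact ⟨0, map_zero _⟩
  | of j x =>
    refine ⟨j + 1, ?_⟩
    have := hochTrunc_inc_of_lt (X := X) (m := m) (Nat.lt_succ_self j) (sub_add_cancel p j) x
    simp only [hochInc, eqToHom_refl] at this
    exact this
  | add x y hx hy => exact hadd x y hx hy

lemma hochTrunc_hochMap {s : ℤ} (θ : GrHom X Y s) (N : ℕ) {m : ℕ} {p q : ℤ} (h : p + s = q)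
    (x : hochX X m p) : hochTrunc N (hochMap θ m p q h x) = hochMap θ m p q h (hochTrunc N x) := by
  have : (hochTrunc N).comp (hochMap θ m p q h) = (hochMap θ m p q h).comp (hochTrunc N) := by
    refine hoch_hom_ext fun j p' hp x => ?_
    rw [AddMonoidHom.comp_apply, AddMonoidHom.comp_apply,
      hochMap_inc θ h j hp (q' := p' + s) (by omega) rfl, map_zsmul]
    rcases lt_or_ge j N with hj | hj
    · rw [hochTrunc_inc_of_lt hj, hochTrunc_inc_of_lt hj,
        hochMap_inc θ h j hp (q' := p' + s) (by omega) rfl]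
    · rw [hochTrunc_inc_of_le hj, hochTrunc_inc_of_le hj, map_zero, smul_zero]
  exact DFunLike.congr_fun this x

lemma hochCoeff_hochMap (θ : GrHom X Y 0) (j : ℕ) {m : ℕ} {p p' : ℤ} (h : p' + j = p)
    (x : hochX X m p) : hochCoeff j h (hochMap θ m p p (add_zero p) x) =
      θ _ p' p' (add_zero p') (hochCoeff j h x) := by
  have : (hochCoeff j h).comp (hochMap θ m p p (add_zero p)) =
      (θ _ p' p' (add_zero p')).comp (hochCoeff j h) := by
    refine hoch_hom_ext fun i p'' hp x => ?_
    rw [AddMonoidHom.comp_apply, AddMonoidHom.comp_apply,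
      hochMap_inc θ _ i hp (q' := p'') hp (add_zero _), mul_zero, sgn_zero, one_smul]
    by_cases hi : i = j
    · subst hi
      obtain rfl : p'' = p' := by omega
      rw [hochCoeff_inc_self, hochCoeff_inc_self]
    · rw [hochCoeff_inc_of_ne hi, hochCoeff_inc_of_ne hi, map_zero]
  exact DFunLike.congr_fun this x

namespace AinfProp

variable {E : AinfProp.{u}}

/-- The differential carries the summand of $l_n$ into those of $l_k$ with $k\le n$, so the image of
a truncation is a subcomplex. -/
lemma hochTrunc_hochD (S : DGModule E.toDGCat X) (N : ℕ) {m : ℕ} {p q : ℤ} (x : hochX X m p) :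
    hochTrunc N (hochD S m p q (hochTrunc N x)) = hochD S m p q (hochTrunc N x) := by
  by_cases hq : q + 1 = p
  swap
  · simp [hochD, hq]
  have : ((hochTrunc N).comp (hochD S m p q)).comp (hochTrunc N) =
      (hochD S m p q).comp (hochTrunc N) := by
    refine hoch_hom_ext fun j p' hp x => ?_
    simp only [AddMonoidHom.comp_apply]
    rcases lt_or_ge j N with hj | hj
    · rw [hochTrunc_inc_of_lt hj, hochD_inc S hq hp (q' := p' - 1) (by omega), map_add, map_zsmul,
        map_sum, hochTrunc_inc_of_lt hj]
      congr 2
      refine Finset.sum_congr rfl fun i hi => hochTrunc_inc_of_lt ?_ _ _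
      exact (Finset.mem_range.1 hi).trans hj
    · rw [hochTrunc_inc_of_le hj, map_zero, map_zero]
  exact DFunLike.congr_fun this x

/-- The terms $f_{n,k}$ have $k<n$, so on elements supported on $l_1,\dots,l_{N+1}$ only the
internal differential reaches $l_{N+1}$. This identifies the graded piece of the filtration with
$X(N+1+m)$ shifted by $N$, without a sign. -/
lemma hochCoeff_hochD (S : DGModule E.toDGCat X) (N : ℕ) {m : ℕ} {p q p' q' : ℤ} (hq : q + 1 = p)
    (hp' : p' + N = p) (hq' : q' + N = q) (x : hochX X m p) (hx : hochTrunc (N + 1) x = x) :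
    hochCoeff N hq' (hochD S m p q x) = S.d _ p' q' (hochCoeff N hp' x) := by
  have : ((hochCoeff N hq').comp (hochD S m p q)).comp (hochTrunc (N + 1)) =
      ((S.d _ p' q').comp (hochCoeff N hp')).comp (hochTrunc (N + 1)) := by
    refine hoch_hom_ext fun j p'' hp x => ?_
    simp only [AddMonoidHom.comp_apply]
    rcases lt_or_ge j (N + 1) with hj | hj
    · rw [hochTrunc_inc_of_lt hj, hochD_inc S hq hp (q' := p'' - 1) (by omega), map_add, map_zsmul,
        map_sum, Finset.sum_eq_zero, smul_zero, add_zero]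
      · by_cases h : j = N
        · subst h
          obtain rfl : p'' = p' := by omega
          obtain rfl : q' = p'' - 1 := by omega
          rw [hochCoeff_inc_self, hochCoeff_inc_self]
        · rw [hochCoeff_inc_of_ne h, hochCoeff_inc_of_ne h, map_zero]
      · intro i hi
        rw [Finset.mem_range] at hi
        exact hochCoeff_inc_of_ne (by omega) _ _ _
    · rw [hochTrunc_inc_of_le hj, map_zero, map_zero, map_zero, map_zero]
  have := DFunLike.congr_fun this x
  simpa only [AddMonoidHom.comp_apply, hx] using this

/-- The Hochschild complex preserves quasi-isomorphisms. -/
lemma coneExact_hochMap (S : DGModule E.toDGCat X) (T : DGModule E.toDGCat Y) (θ : GrHom X Y 0)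
    (hθ : ∀ m p q x, hochD T m p q (hochMap θ m p p (add_zero p) x) =
      hochMap θ m q q (add_zero q) (hochD S m p q x))
    (hc : ∀ a, ConeExact (S.d a) (T.d a) fun p => θ a p p (add_zero p)) (m : ℕ) :
    ConeExact (hochD S m) (hochD T m) fun p => hochMap θ m p p (add_zero p) := by
  intro p q r s hq hr hs x y hx hy
  -- `δ₁` and `δ₂` are consecutive cone differentials around `(x, y)`. The opposite signs on the
  -- differential of the target make their composite zero.
  let δ₁ : hochX X m p × hochX Y m r →+ hochX X m q × hochX Y m p :=
    ((hochD S m p q).comp (AddMonoidHom.fst _ _)).prod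
      ((hochMap θ m p p (add_zero p)).coprod (hochD T m r p))
  let δ₂ : hochX X m q × hochX Y m p →+ hochX X m s × hochX Y m q :=
    ((hochD S m q s).comp (AddMonoidHom.fst _ _)).prod
      ((hochMap θ m q q (add_zero q)).coprod (-hochD T m p q))
  have e₁ : ∀ c, δ₁ c = (hochD S m p q c.1, hochMap θ m p p (add_zero p) c.1 + hochD T m r p c.2) :=
    fun _ => rfl
  have e₂ : ∀ c, δ₂ c =
      (hochD S m q s c.1, hochMap θ m q q (add_zero q) c.1 + -hochD T m p q c.2) := fun _ => rfl
  have dS : ∀ p q r x, hochD S m q r (hochD S m p q x) = 0 := (hochStr S).d_d m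
  have dT : ∀ p q r x, hochD T m q r (hochD T m p q x) = 0 := (hochStr T).d_d m
  have hδ : ∀ c, δ₂ (δ₁ c) = 0 := by
    intro c
    rw [e₁, e₂, dS, map_add, dT, hθ, add_zero, add_neg_cancel]
    rfl
  -- `F N` consists of the pairs with both components supported on $l_1,\dots,l_N$, written as the
  -- kernel of $1-{}$truncation.
  let F : ℕ → AddSubgroup (hochX X m q × hochX Y m p) := fun N =>
    ((AddMonoidHom.id _ - hochTrunc N).ker).prod ((AddMonoidHom.id _ - hochTrunc N).ker)
  have hF : ∀ N c, c ∈ F N ↔ hochTrunc N c.1 = c.1 ∧ hochTrunc N c.2 = c.2 := by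
    intro N c
    simp only [F, AddSubgroup.mem_prod, AddMonoidHom.mem_ker, AddMonoidHom.sub_apply,
      AddMonoidHom.id_apply, sub_eq_zero]
    exact and_congr eq_comm eq_comm
  have hF0 : F 0 = ⊥ := by
    rw [eq_bot_iff]
    intro c hc
    rw [hF, hochTrunc_zero, hochTrunc_zero] at hc
    exact Prod.ext hc.1.symm hc.2.symm
  have hstep : ∀ N, ∀ k ∈ F (N + 1), δ₂ k = 0 → ∃ c, k - δ₁ c ∈ F N := by
    intro N k hk hk0
    rw [hF] at hk
    rw [e₂, Prod.mk_eq_zero, add_neg_eq_zero] at hk0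
    have hp' : p - N + N = p := by omega
    have hq' : q - N + N = q := by omega
    have hr' : r - N + N = r := by omega
    -- The coefficients of $l_{N+1}$ form a cone cycle for `θ` at the object `N + 1 + m`. All
    -- degrees drop by `N` because $|l_{N+1}|=N$.
    obtain ⟨u, v, hu, hv⟩ := hc (N + 1 + m) (p := p - N) (q := q - N) (r := r - N) (s := s - N)
      (by omega) (by omega) (by omega) (hochCoeff N hq' k.1) (hochCoeff N hp' k.2)
      (by rw [← hochCoeff_hochD S N hs hq' (by omega) _ hk.1, hk0.1, map_zero])
      (by rw [← hochCoeff_hochMap, hk0.2, hochCoeff_hochD T N hq hp' hq' _ hk.2])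
    refine ⟨(hochInc N hp' u, hochInc N hr' v), ?_⟩
    have tu := hochTrunc_inc_of_lt (Nat.lt_succ_self N) hp' u
    have tv := hochTrunc_inc_of_lt (Nat.lt_succ_self N) hr' v
    rw [hF, e₁]
    -- Subtracting the boundary of the lifted solution keeps level `N + 1` and kills the top
    -- coefficient; this is what lowers the level.
    have descend : ∀ {Z : ℕ → ℤ → AddCommGrpCat.{u}} {i : ℤ} (h : i - N + N = i) (z : hochX Z m i),
        hochTrunc (N + 1) z = z → hochCoeff N h z = 0 → hochTrunc N z = z := by
      intro Z i h z h1 h2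
      rw [hochTrunc_succ h, h2, map_zero, add_zero] at h1
      exact h1
    constructor
    · apply descend hq'
      · rw [Prod.fst_sub, map_sub, hk.1, ← tu, hochTrunc_hochD]
      · rw [Prod.fst_sub, map_sub, hochCoeff_hochD S N hq hp' hq' _ tu, hochCoeff_inc_self, hu,
          sub_self]
    · apply descend hp'
      · rw [Prod.snd_sub, map_sub, hk.2, map_add, hochTrunc_hochMap, ← tv, hochTrunc_hochD, tu]
      · rw [Prod.snd_sub, map_sub, map_add, hochCoeff_hochMap,
          hochCoeff_hochD T N hr hr' hp' _ tv, hochCoeff_inc_self, hochCoeff_inc_self, hv, sub_self]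
  obtain ⟨M, hM⟩ := exists_hochTrunc_eq x
  obtain ⟨N, hN⟩ := exists_hochTrunc_eq y
  obtain ⟨⟨u, v⟩, huv⟩ := exists_eq_of_exhaustive δ₁ δ₂ hδ F hF0 hstep (max M N) (x, y)
    ((hF _ _).2 ⟨hM _ (le_max_left M N), hN _ (le_max_right M N)⟩)
    (by rw [e₂, Prod.mk_eq_zero, add_neg_eq_zero]; exact ⟨hx, hy⟩)
  rw [e₁, Prod.mk_inj] at huv
  exact ⟨u, v, huv⟩

lemma hochMap_zero {s : ℤ} : hochMap (0 : GrHom X Y s) = 0 := by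
  funext m p q h
  refine hoch_hom_ext fun j p' hp x => ?_
  rw [hochMap_inc _ h j hp (q' := p' + s) (by omega) rfl, GrHom.zero_apply, map_zero, smul_zero]
  rfl

lemma hochIterMap_zero {s : ℤ} : ∀ n, hochIterMap (0 : GrHom X Y s) n = 0
  | 0 => rfl
  | n + 1 => (congrArg hochMap (hochIterMap_zero n)).trans hochMap_zero

/-- A degree 0 transformation with zero differential commutes with the differentials. Iterated
Hochschild complexes respect the differential of transformations (`diff_hochIterMap`), so this
persists at every level. -/
lemma hochIterStr_d_hochIterMap (S : DGModule E.toDGCat X) (T : DGModule E.toDGCat Y)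
    (θ : GrHom X Y 0) (hθ : GrHom.IsNat S T θ)
    (hd : GrHom.diff S.d T.d (neg_add_cancel 1) θ = 0) (n m : ℕ) (p q : ℤ)
    (x : hochIterX n X m p) :
    (hochIterStr T n).d m p q (hochIterMap θ n m p p (add_zero p) x) =
      hochIterMap θ n m q q (add_zero q) ((hochIterStr S n).d m p q x) := by
  by_cases hq : q + 1 = p
  · have := GrHom.d_apply (hochIterStr S n).d (hochIterStr T n).d (neg_add_cancel 1)
      (hochIterMap θ n) m (p := p) (q := q) (by omega) hq hq x
    rw [diff_hochIterMap S T _ θ hθ, hd, hochIterMap_zero, GrHom.zero_apply, smul_zero] at this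
    exact this.trans (add_zero _)
  · rw [(hochIterStr T n).shape m p q hq, (hochIterStr S n).shape m p q hq,
      AddMonoidHom.zero_apply, AddMonoidHom.zero_apply, map_zero]

/-- The iterated Hochschild complex preserves quasi-isomorphisms. -/
lemma coneExact_hochIterMap (S : DGModule E.toDGCat X) (T : DGModule E.toDGCat Y)
    (θ : GrHom X Y 0) (hθ : GrHom.IsNat S T θ)
    (hd : GrHom.diff S.d T.d (neg_add_cancel 1) θ = 0)
    (hc : ∀ a, ConeExact (S.d a) (T.d a) fun p => θ a p p (add_zero p)) :
    ∀ n m : ℕ, ConeExact ((hochIterStr S n).d m) ((hochIterStr T n).d m)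
      fun p => hochIterMap θ n m p p (add_zero p)
  | 0 => hc
  | n + 1 => coneExact_hochMap (hochIterStr S n) (hochIterStr T n) (hochIterMap θ n)
      -- The level is `n + 1`: its differential is by definition `hochD` of the structure at level
      -- `n`.
      (hochIterStr_d_hochIterMap S T θ hθ hd (n + 1)) (coneExact_hochIterMap S T θ hθ hd hc n)

end AinfProp
end Hoch

/-! ### Representable dg-functors -/

section Representable

variable {O : Type w}

/-- The representable dg-functor `A(a, -)`. -/
abbrev DGCat.rep (A : DGCat.{u} O) (a : O) : DGFunctor A where
  X b p := (A.hom a b).X p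
  str :=
    { d := fun b p q => ((A.hom a b).d p q).hom
      shape := fun b p q h => by rw [(A.hom a b).shape p q h]; rfl
      d_d := fun b p q r x => ConcreteCategory.congr_hom ((A.hom a b).d_comp_d p q r) x
      act := fun h => A.comp h
      act_id := A.comp_id
      act_comp := A.assoc
      d_act := A.d_comp }

variable {A : DGCat.{u} O}

/-- The natural transformation `A(a, -) ⟶ Φ` corresponding to an element of `Φ(a)`. -/
def DGTrans.ofElement (Φ : DGFunctor A) {a : O} {s : ℤ} (y : Φ.X a s) :
    DGTrans (A.rep a) Φ s where
  -- Koszul sign for exchanging a morphism of degree `p` with `y` of degree `s`: the transformation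
  -- is written after its argument, but the result is `y` acted on by that argument.
  app _ p _ h := sgn (p * s) • Φ.str.act ((add_comm s p).trans h) y
  naturality b c p q r p' r' h hp hr x f := by
    simp only [AddMonoidHom.zsmul_apply, map_zsmul]
    rw [Φ.str.act_comp ((add_comm s p).trans hp) _ h, smul_smul, ← sgn_add]
    · congr 2
      rw [← h]; ring
    · omega

lemma DGTrans.ofElement_app (Φ : DGFunctor A) {a b : O} {s p q : ℤ} (y : Φ.X a s) (h : p + s = q)
    (h' : s + p = q) (f : (A.hom a b).X p) :
    (DGTrans.ofElement Φ y).app b p q h f = sgn (p * s) • Φ.str.act h' y f := rfl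

lemma DGTrans.ofElement_app_id (Φ : DGFunctor A) {a : O} {s : ℤ} (y : Φ.X a s) :
    (DGTrans.ofElement Φ y).app a 0 s (zero_add s) (A.id a) = y := by
  rw [DGTrans.ofElement_app _ _ _ (add_zero s), Φ.str.act_id, zero_mul, sgn_zero, one_smul]

lemma DGTrans.ofElement_app_add (Φ : DGFunctor A) {a : O} {s : ℤ} (y z : Φ.X a s) :
    (DGTrans.ofElement Φ (y + z)).app =
      (DGTrans.ofElement Φ y).app + (DGTrans.ofElement Φ z).app := by
  refine GrHom.ext fun b p q h f => ?_
  rw [GrHom.add_apply, DGTrans.ofElement_app _ _ _ (by omega),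
    DGTrans.ofElement_app _ _ _ (by omega), DGTrans.ofElement_app _ _ _ (by omega), map_add,
    AddMonoidHom.add_apply, smul_add]

lemma DGTrans.ofElement_app_zero (Φ : DGFunctor A) {a : O} {s : ℤ} :
    (DGTrans.ofElement Φ (0 : Φ.X a s)).app = 0 := by
  have := DGTrans.ofElement_app_add Φ (0 : Φ.X a s) 0
  rw [add_zero] at this
  exact left_eq_add.1 this

lemma DGTrans.ofElement_id (a : O) :
    (DGTrans.ofElement (A.rep a) (A.id a)).app = GrHom.id (A.rep a).X := by
  refine GrHom.ext fun b p q h f => ?_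
  obtain rfl : p = q := by omega
  rw [DGTrans.ofElement_app _ _ _ (zero_add p), mul_zero, sgn_zero, one_smul, GrHom.id_apply]
  exact A.id_comp f

/-- In $d(y\cdot f)=dy\cdot f\pm y\cdot df$ the second term cancels against the contribution of the
differential of $A(a,-)$. With the Koszul sign of `DGTrans.ofElement`, the Yoneda correspondence is
thus a chain map on the nose. -/
lemma DGTrans.diff_ofElement (Φ : DGFunctor A) {a : O} {s t : ℤ} (h : t + 1 = s) (y : Φ.X a s) :
    GrHom.diff (A.rep a).str.d Φ.str.d h (DGTrans.ofElement Φ y).app =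
      (DGTrans.ofElement Φ (Φ.str.d a s t y)).app := by
  refine GrHom.ext fun b p q hq f => ?_
  rw [GrHom.diff_apply _ _ h _ b hq (p' := p - 1) (q' := q + 1) (by omega) rfl,
    DGTrans.ofElement_app _ _ _ (by omega), DGTrans.ofElement_app _ _ _ (by omega),
    DGTrans.ofElement_app _ _ _ (by omega), map_zsmul,
    Φ.str.d_act _ h (q' := p - 1) (by omega) rfl]
  simp only [smul_add, smul_sub, smul_smul, ← sgn_add]
  have e : ∀ {G : Type u} [AddCommGroup G] (a b c d : G), a = d → b = c → a + b - c = d := by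
    intro G _ a b c d h1 h2
    rw [h1, h2, add_sub_cancel_right]
  refine e _ _ _ _ ?_ ?_
  · congr 1
    exact sgn_congr ⟨p, by rw [← h]; ring⟩
  · congr 1
    exact sgn_congr ⟨s, by ring⟩

/-- The Yoneda correspondence is natural in the functor, because `θ` commutes with the action up to
the Koszul sign. This supplies the naturality of the operation built in `opEval_surjective`. -/
lemma DGTrans.ofElement_comp {Φ Ψ : DGFunctor A} {a : O} {q s q' : ℤ} (hq : q + s = q')
    (θ : DGTrans Φ Ψ s) (y : Φ.X a q) :
    (DGTrans.ofElement Ψ (θ.app a q q' hq y)).app =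
      GrHom.comp hq (DGTrans.ofElement Φ y).app θ.app := by
  refine GrHom.ext fun b p r h f => ?_
  rw [GrHom.comp_apply _ _ _ b (p' := p + q) rfl (by omega),
    DGTrans.ofElement_app _ _ _ (by omega), DGTrans.ofElement_app _ _ _ (by omega), map_zsmul,
    θ.naturality _ hq (by omega), smul_smul, ← sgn_add]
  congr 2
  rw [← hq]; ring

/-- The natural transformation `A(a, -) ⟶ F^* B(a, -)` given by a dg-functor `F`. -/
def DGCat.Functor.repTrans {B : DGCat.{u} O} (F : A.Functor B) (a : O) :
    DGTrans (A.rep a) ((B.rep a).pullback F) 0 :=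
  DGTrans.ofElement ((B.rep a).pullback F) (B.id a)

/-- Identifies the components with those of `F`, so that a quasi-isomorphism hypothesis on `F`
applies to the transformation of representables. -/
lemma DGCat.Functor.repTrans_app {B : DGCat.{u} O} (F : A.Functor B) (a b : O) {p : ℤ}
    (f : (A.hom a b).X p) :
    (F.repTrans a).app b p p (add_zero p) f = (F.map a b).f p f := by
  refine (DGTrans.ofElement_app _ _ _ (zero_add p) f).trans ?_
  rw [mul_zero, sgn_zero, one_smul]
  exact B.id_comp ((F.map a b).f p f)

end Representable

/-! ### Additivity and functoriality of the iterated Hochschild complex -/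

section Hoch

variable {X Y Z : ℕ → ℤ → AddCommGrpCat.{u}}

lemma hochMap_add {s : ℤ} (θ η : GrHom X Y s) : hochMap (θ + η) = hochMap θ + hochMap η := by
  funext m p q h
  refine hoch_hom_ext fun j p' hp x => ?_
  rw [hochMap_inc _ h j hp (q' := p' + s) (by omega) rfl]
  change _ = hochMap θ m p q h _ + hochMap η m p q h _
  rw [hochMap_inc _ h j hp (q' := p' + s) (by omega) rfl,
    hochMap_inc _ h j hp (q' := p' + s) (by omega) rfl, GrHom.add_apply, map_add, smul_add]

lemma hochMap_id : hochMap (GrHom.id X) = GrHom.id (hochX X) := by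
  funext m p q h
  obtain rfl : p = q := by omega
  refine hoch_hom_ext fun j p' hp x => ?_
  rw [hochMap_inc _ h j hp hp (add_zero _), GrHom.id_apply, GrHom.id_apply, mul_zero, sgn_zero,
    one_smul]

lemma hochMap_comp {s t r : ℤ} (h : s + t = r) (θ : GrHom X Y s) (η : GrHom Y Z t) :
    hochMap (GrHom.comp h θ η) = GrHom.comp h (hochMap θ) (hochMap η) := by
  funext m p q hq
  refine hoch_hom_ext fun j p' hp x => ?_
  have hs : sgn (j * r) = sgn (j * s + j * t) := by rw [← h, mul_add]
  rw [hochMap_inc _ hq j hp (q' := p' + r) (by omega) rfl,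
    GrHom.comp_apply h _ _ _ (p' := p + s) rfl (by omega),
    hochMap_inc _ _ j hp (q' := p' + s) (by omega) rfl, map_zsmul,
    hochMap_inc _ _ j _ (q' := p' + r) (by omega) (by omega), smul_smul, ← sgn_add,
    GrHom.comp_apply h _ _ _ (p' := p' + s) rfl (by omega), hs]

lemma hochIterMap_add {s : ℤ} (θ η : GrHom X Y s) :
    ∀ n, hochIterMap (θ + η) n = hochIterMap θ n + hochIterMap η n
  | 0 => rfl
  | n + 1 => (congrArg hochMap (hochIterMap_add θ η n)).trans (hochMap_add _ _)

lemma hochIterMap_id : ∀ n, hochIterMap (GrHom.id X) n = GrHom.id (hochIterX n X)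
  | 0 => rfl
  | n + 1 => (congrArg hochMap (hochIterMap_id n)).trans hochMap_id

lemma hochIterMap_comp {s t r : ℤ} (h : s + t = r) (θ : GrHom X Y s) (η : GrHom Y Z t) :
    ∀ n, hochIterMap (GrHom.comp h θ η) n = GrHom.comp h (hochIterMap θ n) (hochIterMap η n)
  | 0 => rfl
  | n + 1 => (congrArg hochMap (hochIterMap_comp h θ η n)).trans (hochMap_comp h _ _)

end Hoch

/-! ### Operations out of $\Phi\mapsto\Phi(a)$: the case $n_1=0$ -/

namespace AinfProp

section Yoneda

variable {E : AinfProp.{u}}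

/-- The universal element of the dg-functor `Φ ↦ C^0(Φ)(a) = Φ(a)`. -/
def universalElement (E : AinfProp.{u}) (a : ℕ) : E.opX 0 a (E.rep a) 0 := E.id a

lemma opMap_ofElement_universalElement {Φ : DGFunctor E.toDGCat} {a : ℕ} {s : ℤ}
    (y : E.opX 0 a Φ s) :
    E.opMap 0 a (DGTrans.ofElement Φ y) (zero_add s) (E.universalElement a) = y :=
  DGTrans.ofElement_app_id Φ y

/-- The value of a natural transformation `Φ(a) ⟶ C^n(Φ)(m)` at the universal element. -/
def opEval (a n m : ℕ) (p : ℤ) : E.opHom 0 a n m p →+ E.opX n m (E.rep a) p where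
  toFun ν := ν.1 (E.rep a) 0 p (zero_add p) (E.universalElement a)
  map_zero' := rfl
  map_add' _ _ := rfl

/-- Every `y` is the image of the universal element under `DGTrans.ofElement Φ y`, so naturality
determines `ν` everywhere from its value at that element. -/
lemma opHom_apply_eq {a n m : ℕ} {p : ℤ} (ν : E.opHom 0 a n m p) (Φ : DGFunctor E.toDGCat)
    {q r : ℤ} (h : q + p = r) (h' : p + q = r) (y : E.opX 0 a Φ q) :
    ν.1 Φ q r h y = sgn (q * p) • E.opMap n m (DGTrans.ofElement Φ y) h' (opEval a n m p ν) := by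
  have := ν.2 (DGTrans.ofElement Φ y) (zero_add p) (zero_add q) h (E.universalElement a)
  rw [opMap_ofElement_universalElement] at this
  exact this

lemma opEval_injective (a n m : ℕ) (p : ℤ) : Function.Injective (opEval (E := E) a n m p) := by
  intro ν μ h
  refine Subtype.ext (GrHom.ext fun Φ q r hr y => ?_)
  rw [opHom_apply_eq ν Φ hr (by omega), opHom_apply_eq μ Φ hr (by omega), h]

/-- The formula of `opHom_apply_eq` serves as the definition of the operation with given value `x`.
Naturality comes from `DGTrans.ofElement_comp` and functoriality of the iterated Hochschild complex;
the value is `x` since the transformation attached to the identity is the identity. -/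
lemma opEval_surjective (a n m : ℕ) (p : ℤ) : Function.Surjective (opEval (E := E) a n m p) := by
  intro x
  refine ⟨⟨fun Φ q r h => AddMonoidHom.mk' (fun y => sgn (q * p) •
    E.opMap n m (DGTrans.ofElement Φ y) ((add_comm p q).trans h) x) fun y z => ?_, ?_⟩, ?_⟩
  · rw [← smul_add]
    congr 1
    have := DGTrans.ofElement_app_add Φ (a := a) y z
    exact congrArg (fun θ => θ m p r ((add_comm p q).trans h) x)
      ((congrArg (fun θ => hochIterMap θ n) this).trans (hochIterMap_add _ _ n))
  · intro Φ Ψ s θ q r q' r' h hq hr y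
    have e := congrArg (fun θ => hochIterMap θ n) (DGTrans.ofElement_comp hq θ (a := a) y)
    have e' := congrArg (fun θ => θ m p r' ((add_comm p q').trans hr) x)
      (e.trans (hochIterMap_comp hq _ _ n))
    have e'' := e'.trans (GrHom.comp_apply hq _ _ m (p' := r) ((add_comm p q).trans h) (by omega)
      _ x)
    refine (congrArg (sgn (q' * p) • ·) e'').trans ?_
    change _ = sgn (s * p) • E.opMap n m θ _ (sgn (q * p) • _)
    -- Since $q'=q+s$, the sign splits into the one required by naturality and the one in the
    -- definition for `Φ`.
    have hs : sgn (q' * p) = sgn (s * p + q * p) := by rw [← hq, add_mul, add_comm]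
    rw [map_zsmul, smul_smul, ← sgn_add, hs]
    rfl
  · change sgn (0 * p) • E.opMap n m (DGTrans.ofElement (E.rep a) (E.id a)) _ x = x
    rw [zero_mul, sgn_zero, one_smul]
    exact (congrArg (fun θ => θ m p p (add_zero p) x)
      ((congrArg (fun θ => hochIterMap θ n) (DGTrans.ofElement_id a)).trans
        (hochIterMap_id n))).trans (GrHom.id_apply _ _ _)

/-- The universal element is a cycle of degree 0, so only the differential of the value survives,
with sign $+1$. -/
lemma opEval_opHomD {a n m : ℕ} {p q : ℤ} (hq : q + 1 = p) (ν : E.opHom 0 a n m p) :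
    opEval a n m q (E.opHomD 0 a n m p q ν) = E.opD n m (E.rep a) p q (opEval a n m p ν) := by
  have h0 : (-1 : ℤ) + 1 = 0 := by norm_num
  have hd : E.opD 0 a (E.rep a) 0 (-1) (E.universalElement a) = 0 := DGProp.d_id a h0
  change (E.opHomD 0 a n m p q ν).1 _ _ _ _ _ = _
  rw [opHomD_coe E hq, GrHom.diff_apply _ _ hq _ _ _ (p' := -1) (q' := p) h0 hq, hd, map_zero,
    sub_zero, sgn_zero, one_smul]
  rfl

namespace Hom

variable {E' : AinfProp.{u}} (φ : Hom E E')

/-- The left side is the component of `ν` at $\varphi^*\mathcal{E}'(a,-)$, taken at the identity of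
`a`. Yoneda computes it by pushing the value of `ν` along the transformation attached to that
identity, which is `φ.repTrans a`. -/
lemma opEval_opRestrict {a n m : ℕ} {p : ℤ} (ν : E.opHom 0 a n m p) :
    opEval a n m p (φ.opRestrict 0 a n m p ν) =
      E.opMap n m (φ.repTrans a) (add_zero p) (opEval a n m p ν) := by
  have := opHom_apply_eq ν ((E'.rep a).pullback φ.toFunctor) (zero_add p) (add_zero p)
    (E'.id a)
  rw [zero_mul, sgn_zero, one_smul] at this
  exact this

/-- Here the hypothesis on `φ` enters: it says that $\mathcal{E}(a,-)\to\varphi^*\mathcal{E}'(a,-)$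
is a quasi-isomorphism at each object, and iterated Hochschild complexes preserve this. -/
lemma coneExact_opMap_repTrans (hφ : φ.toFunctor.IsQuasiIso) (a n m : ℕ) :
    ConeExact (E.opD n m (E.rep a)) (E'.opD n m (E'.rep a))
      fun p => E.opMap n m (φ.repTrans a) (add_zero p) := by
  -- The target becomes the Hochschild complex over `E` of the restricted functor, so that both
  -- functors live over the same prop.
  rw [← φ.opD_pullback]
  refine coneExact_hochIterMap (E.rep a).str ((E'.rep a).pullback φ.toFunctor).str
    (φ.repTrans a).app (φ.repTrans a).naturality ?_ (fun b => ?_) n m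
  -- The transformation is closed because it corresponds to the identity of `a`, which is a cycle.
  · refine (DGTrans.diff_ofElement _ _ _).trans ?_
    have h0 : (-1 : ℤ) + 1 = 0 := by norm_num
    have : ((E'.rep a).pullback φ.toFunctor).str.d a 0 (-1) (E'.id a) = 0 := DGProp.d_id a h0
    rw [this, DGTrans.ofElement_app_zero]
  · have := (quasiIso_iff_coneExact _).1 (hφ a b)
    have e : (fun p => ((φ.map a b).f p).hom) =
        fun p => (φ.repTrans a).app b p p (add_zero p) := by
      funext p
      exact AddMonoidHom.ext fun f => (φ.repTrans_app a b f).symm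
    rw [e] at this
    exact this

/-- Cone exactness is transported along the Yoneda bijections `opEval`, which commute with the
differentials and turn restriction into `opMap` of `φ.repTrans a`. -/
lemma coneExact_opRestrict_zero (hφ : φ.toFunctor.IsQuasiIso) (a n m : ℕ) :
    ConeExact (E.opHomD 0 a n m) (E'.opHomD 0 a n m) (φ.opRestrict 0 a n m) := by
  intro p q r s hq hr hs x y hx hy
  obtain ⟨u, v, hu, hv⟩ := φ.coneExact_opMap_repTrans hφ a n m hq hr hs (opEval a n m q x)
    (opEval a n m p y) (by rw [← opEval_opHomD hs, hx, map_zero])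
    ((φ.opEval_opRestrict x).symm.trans (by rw [hy, opEval_opHomD hq]))
  obtain ⟨u, rfl⟩ := opEval_surjective a n m p u
  obtain ⟨v, rfl⟩ := opEval_surjective a n m r v
  refine ⟨u, v, opEval_injective a n m q ?_, opEval_injective a n m p ?_⟩
  · rw [opEval_opHomD hq, hu]
  · rw [map_add, opEval_opHomD hr, φ.opEval_opRestrict]
    exact hv

end Hom

end Yoneda

end AinfProp

/-! ### Operations out of a Hochschild complex: the induction step -/

namespace AinfProp

section Slices

variable {E : AinfProp.{u}}

/-- The inclusion `x ↦ x ⊗ l_{j+1}` of `C^n(Φ)(j + 1 + m)` in `C^{n+1}(Φ)(m)`. -/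
def opInc (n m : ℕ) (Φ : DGFunctor E.toDGCat) (j : ℕ) {p' p : ℤ} (h : p' + j = p) :
    E.opX n (j + 1 + m) Φ p' →+ E.opX (n + 1) m Φ p :=
  hochInc (X := hochIterX n Φ.X) j h

/-- Homomorphisms out of `C^{n+1}(Φ)(m)`. -/
def opDesc (n m : ℕ) (Φ : DGFunctor E.toDGCat) {p : ℤ} {B : Type*} [AddCommGroup B]
    (F : ∀ (j : ℕ) (p' : ℤ), p' + j = p → (E.opX n (j + 1 + m) Φ p' →+ B)) :
    E.opX (n + 1) m Φ p →+ B :=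
  hochDesc (X := hochIterX n Φ.X) F

lemma opDesc_opInc {n m : ℕ} {Φ : DGFunctor E.toDGCat} {p : ℤ} {B : Type*} [AddCommGroup B]
    (F : ∀ (j : ℕ) (p' : ℤ), p' + j = p → (E.opX n (j + 1 + m) Φ p' →+ B)) (j : ℕ) {p' : ℤ}
    (h : p' + j = p) (x : E.opX n (j + 1 + m) Φ p') :
    opDesc n m Φ F (opInc n m Φ j h x) = F j p' h x :=
  hochDesc_inc (X := hochIterX n Φ.X) F j h x

lemma op_hom_ext {n m : ℕ} {Φ : DGFunctor E.toDGCat} {p : ℤ} {B : Type*} [AddCommGroup B]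
    {f g : E.opX (n + 1) m Φ p →+ B}
    (h : ∀ (j : ℕ) (p' : ℤ) (hp : p' + j = p) (x : E.opX n (j + 1 + m) Φ p'),
      f (opInc n m Φ j hp x) = g (opInc n m Φ j hp x)) : f = g :=
  hoch_hom_ext (X := hochIterX n Φ.X) h

lemma opMap_opInc (n m : ℕ) {Φ Ψ : DGFunctor E.toDGCat} {s : ℤ} (θ : DGTrans Φ Ψ s)
    {p q p' q' : ℤ} (h : p + s = q) (j : ℕ) (hp : p' + j = p) (hq : q' + j = q) (hs : p' + s = q')
    (x : E.opX n (j + 1 + m) Φ p') :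
    E.opMap (n + 1) m θ h (opInc n m Φ j hp x) =
      sgn (j * s) • opInc n m Ψ j hq (E.opMap n (j + 1 + m) θ hs x) :=
  hochMap_inc (hochIterMap θ.app n) h j hp hq hs x

/-- Only the position of the remaining terms matters: they lie in summands of index below `j`. Their
values are left unspecified because the lemma is applied to operations vanishing on those summands.
-/
lemma exists_opD_opInc (n m : ℕ) (Φ : DGFunctor E.toDGCat) {p q p' q' : ℤ} (hq : q + 1 = p)
    (j : ℕ) (hp : p' + j = p) (hq' : q' + j = q) (x : E.opX n (j + 1 + m) Φ p') :
    ∃ z : ∀ i : ℕ, E.opX n (i + 1 + m) Φ (q - i),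
      E.opD (n + 1) m Φ p q (opInc n m Φ j hp x) =
        opInc n m Φ j hq' (E.opD n (j + 1 + m) Φ p' q' x) +
          sgn p' • ∑ i ∈ Finset.range j, opInc n m Φ i (sub_add_cancel q i) (z i) :=
  ⟨_, hochD_inc (hochIterStr Φ.str n) hq hp hq' x⟩

variable {n m n' m' : ℕ}

/-- The restriction of a natural transformation on `C^{n+1}(-)(m)` to the summand
`C^n(-)(j + 1 + m)`. -/
def opSlice (j : ℕ) {p : ℤ} :
    E.opHom (n + 1) m n' m' p →+ E.opHom n (j + 1 + m) n' m' (p + j) where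
  toFun ν := ⟨fun Φ q r h => (ν.1 Φ (q + j) r (by omega)).comp (opInc n m Φ j rfl), by
    intro Φ Ψ s θ q r q' r' h hq hr x
    have := ν.2 θ (q := q + j) (r := r) (q' := q' + j) (r' := r') (by omega) (by omega) (by omega)
      (opInc n m Φ j rfl x)
    rw [opMap_opInc n m θ _ j rfl rfl hq, map_zsmul] at this
    -- Moving `θ` past $l_{j+1}$ produced $(-1)^{js}$. Multiplying by this sign cancels it on the
    -- left and turns $(-1)^{sp}$ into $(-1)^{s(p+j)}$, the naturality sign for degree `p + j`.
    have h2 := congrArg (sgn (j * s) • ·) this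
    simp only [smul_smul, ← sgn_add] at h2
    rw [sgn_congr (p := j * s + j * s) (q := 0) ⟨j * s, by ring⟩, sgn_zero, one_smul] at h2
    refine h2.trans ?_
    have hs : sgn (j * s + s * p) = sgn (s * (p + j)) := by congr 1; ring
    rw [hs]
    rfl⟩
  map_zero' := rfl
  map_add' _ _ := rfl

lemma opSlice_apply (j : ℕ) {p : ℤ} (ν : E.opHom (n + 1) m n' m' p) (Φ : DGFunctor E.toDGCat)
    {q r i : ℤ} (h : q + (p + j) = r) (hi : q + j = i) (hi' : i + p = r)
    (x : E.opX n (j + 1 + m) Φ q) :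
    (opSlice j ν).1 Φ q r h x = ν.1 Φ i r hi' (opInc n m Φ j hi x) := by
  subst hi
  rfl

lemma opHom_ext {p : ℤ} {ν μ : E.opHom (n + 1) m n' m' p}
    (h : ∀ j, opSlice j ν = opSlice j μ) : ν = μ := by
  refine Subtype.ext ?_
  funext Φ q r hr
  refine op_hom_ext fun j p' hp x => ?_
  rw [← opSlice_apply j ν Φ (by omega) hp, ← opSlice_apply j μ Φ (by omega) hp, h]

/-- The natural transformation on `C^{n+1}(-)(m)` with given restrictions to the summands. -/
def opGlue {p : ℤ} (F : ∀ j : ℕ, E.opHom n (j + 1 + m) n' m' (p + j)) :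
    E.opHom (n + 1) m n' m' p :=
  ⟨fun Φ q r h => opDesc n m Φ fun j p' hp => (F j).1 Φ p' r (by omega), by
    intro Φ Ψ s θ q r q' r' h hq hr x
    have : (opDesc n m Ψ fun j p' hp => (F j).1 Ψ p' r' (by omega)).comp
        (E.opMap (n + 1) m θ hq) = sgn (s * p) • (E.opMap n' m' θ (by omega)).comp
          (opDesc n m Φ fun j p' hp => (F j).1 Φ p' r (by omega)) := by
      refine op_hom_ext fun j p' hp x => ?_
      simp only [AddMonoidHom.comp_apply, AddMonoidHom.zsmul_apply]
      rw [opMap_opInc n m θ hq j hp (q' := p' + s) (by omega) rfl, map_zsmul, opDesc_opInc,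
        opDesc_opInc, (F j).2 θ (r := r) (by omega) rfl, smul_smul, ← sgn_add]
      congr 1
      exact sgn_congr ⟨j * s, by ring⟩
    exact DFunLike.congr_fun this x⟩

/-- With `opHom_ext`, this identifies operations out of $C^{n+1}(-)(m)$ with the full product over
`j` of operations out of $C^n(-)(j+1+m)$. There is no finiteness condition on the family, hence the
need for a complete filtration. -/
lemma opSlice_opGlue {p : ℤ} (F : ∀ j : ℕ, E.opHom n (j + 1 + m) n' m' (p + j)) (j : ℕ) :
    opSlice j (opGlue F) = F j := by
  refine Subtype.ext (GrHom.ext fun Φ q r h x => ?_)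
  rw [opSlice_apply j _ Φ h rfl (by omega)]
  exact opDesc_opInc _ j rfl x

/-- The natural transformations on `C^{n+1}(-)(m)` that vanish on the summands of
`l_1, …, l_N`. -/
def opFiltration (n m n' m' : ℕ) (p : ℤ) (N : ℕ) : AddSubgroup (E.opHom (n + 1) m n' m' p) :=
  ⨅ (j : ℕ) (_ : j < N), (opSlice j).ker

lemma mem_opFiltration {p : ℤ} {N : ℕ} {ν : E.opHom (n + 1) m n' m' p} :
    ν ∈ opFiltration n m n' m' p N ↔ ∀ j < N, opSlice j ν = 0 := by
  simp [opFiltration, AddSubgroup.mem_iInf]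

/-- Slicing is not a chain map in general, since the differential sends $l_{j+1}$ also to lower
summands. For `j ≤ N` those extra terms are killed by `ν`. The sign $(-1)^j$ arises because
`GrHom.diff` involves the degree of the argument, which $l_{j+1}$ raises by `j`. The case `j < N`
makes the filtration stable; `j = N` describes its graded piece. -/
lemma opSlice_opHomD {p q : ℤ} (hq : q + 1 = p) {N : ℕ} {ν : E.opHom (n + 1) m n' m' p}
    (hν : ν ∈ opFiltration n m n' m' p N) {j : ℕ} (hj : j ≤ N) :
    opSlice j (E.opHomD (n + 1) m n' m' p q ν) =
      sgn j • E.opHomD n (j + 1 + m) n' m' (p + j) (q + j) (opSlice j ν) := by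
  rw [mem_opFiltration] at hν
  refine Subtype.ext (GrHom.ext fun Φ a b h x => ?_)
  have hlow : ∀ i < j, ∀ {a' i' : ℤ} (ha : a' + i = i') (hb : i' + p = b)
      (z : E.opX n (i + 1 + m) Φ a'), ν.1 Φ i' b hb (opInc n m Φ i ha z) = 0 := by
    intro i hi a' i' ha hb z
    rw [← opSlice_apply i ν Φ (by omega) ha, hν i (by omega)]
    rfl
  rw [opSlice_apply j _ Φ h rfl (by omega), opHomD_coe E hq]
  change _ = sgn j • (E.opHomD n (j + 1 + m) n' m' (p + j) (q + j) (opSlice j ν)).1 Φ a b h x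
  rw [opHomD_coe E (by omega),
    GrHom.diff_apply _ _ hq _ _ _ (p' := a + j - 1) (q' := b + 1) (by omega) rfl,
    GrHom.diff_apply _ _ _ _ _ h (p' := a - 1) (q' := b + 1) (by omega) rfl,
    opSlice_apply j ν Φ _ rfl (by omega), opSlice_apply j ν Φ _ (i := a + j - 1) (by omega) (by omega)]
  obtain ⟨z, hz⟩ := exists_opD_opInc n m Φ (p := a + j) (q := a + j - 1) (by omega) j rfl
    (q' := a - 1) (by omega) x
  rw [hz, map_add, map_zsmul, map_sum,
    Finset.sum_eq_zero fun i hi => hlow i (Finset.mem_range.1 hi) _ _ _, smul_zero, add_zero,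
    smul_smul, sgn_add, mul_comm]

lemma opHomD_mem_opFiltration {p q : ℤ} (hq : q + 1 = p) {N : ℕ}
    {ν : E.opHom (n + 1) m n' m' p} (hν : ν ∈ opFiltration n m n' m' p N) :
    E.opHomD (n + 1) m n' m' p q ν ∈ opFiltration n m n' m' q N := by
  rw [mem_opFiltration]
  intro j hj
  rw [opSlice_opHomD hq hν hj.le, mem_opFiltration.1 hν j hj, map_zero, smul_zero]

/-- The infinite sum makes sense slice by slice: on the slice `j` every `c i` with `i > j` vanishes.
-/
lemma opFiltration_complete {p : ℤ} (c : ℕ → E.opHom (n + 1) m n' m' p)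
    (hc : ∀ N, c N ∈ opFiltration n m n' m' p N) :
    ∃ l, ∀ N, l - ∑ i ∈ Finset.range N, c i ∈ opFiltration n m n' m' p N := by
  -- The range `j + 1` includes `i = j`: membership of `c j` in level `j` says nothing about its
  -- slice `j`.
  refine ⟨opGlue fun j => opSlice j (∑ i ∈ Finset.range (j + 1), c i), fun N => ?_⟩
  rw [mem_opFiltration]
  intro j hj
  rw [map_sub, opSlice_opGlue, ← Finset.sum_range_add_sum_Ico _ (show j + 1 ≤ N from hj), map_add,
    map_sum _ _ (Finset.Ico _ _), Finset.sum_eq_zero (s := Finset.Ico _ _), add_zero, sub_self]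
  intro i hi
  exact mem_opFiltration.1 (hc i) j (by have := Finset.mem_Ico.1 hi; omega)

/-- Every operation on the slice `N` lifts to level `N` of the filtration, by extending it by zero
on the other summands. With `mem_opFiltration_succ` this shows that the slice computes the graded
piece. -/
lemma exists_mem_opFiltration {p : ℤ} (N : ℕ) (u : E.opHom n (N + 1 + m) n' m' (p + N)) :
    ∃ ν ∈ opFiltration n m n' m' p N, opSlice N ν = u := by
  refine ⟨opGlue (Pi.single N u), ?_, ?_⟩
  · rw [mem_opFiltration]
    intro j hj
    rw [opSlice_opGlue, Pi.single_eq_of_ne hj.ne]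
  · rw [opSlice_opGlue, Pi.single_eq_same]

lemma mem_opFiltration_succ {p : ℤ} {N : ℕ} {ν : E.opHom (n + 1) m n' m' p}
    (h : ν ∈ opFiltration n m n' m' p N) (h' : opSlice N ν = 0) :
    ν ∈ opFiltration n m n' m' p (N + 1) := by
  rw [mem_opFiltration] at h ⊢
  intro j hj
  rcases Nat.lt_succ_iff_lt_or_eq.1 hj with hj | rfl
  · exact h j hj
  · exact h'

lemma opHomD_opHomD (n m n' m' : ℕ) {p q r : ℤ} (ν : E.opHom n m n' m' p) :
    E.opHomD n m n' m' q r (E.opHomD n m n' m' p q ν) = 0 :=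
  ConcreteCategory.congr_hom ((E.formalOps.hom (n, m) (n', m')).d_comp_d p q r) ν

namespace Hom

variable {E' : AinfProp.{u}} (φ : Hom E E')

lemma opSlice_opRestrict (j : ℕ) {p : ℤ} (ν : E.opHom (n + 1) m n' m' p) :
    opSlice j (φ.opRestrict (n + 1) m n' m' p ν) =
      φ.opRestrict n (j + 1 + m) n' m' (p + j) (opSlice j ν) := rfl

lemma opRestrict_mem_opFiltration {p : ℤ} {N : ℕ} {ν : E.opHom (n + 1) m n' m' p}
    (hν : ν ∈ opFiltration n m n' m' p N) :
    φ.opRestrict (n + 1) m n' m' p ν ∈ opFiltration n m n' m' p N := by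
  rw [mem_opFiltration] at hν ⊢
  intro j hj
  rw [φ.opSlice_opRestrict, hν j hj, map_zero]

/-- Restriction along `φ` acts on each slice separately, so the mapping cone inherits the complete
separated filtration. Its graded pieces are, up to signs, the cones assumed exact. -/
lemma coneExact_opRestrict_succ
    (hc : ∀ j, ConeExact (E.opHomD n (j + 1 + m) n' m') (E'.opHomD n (j + 1 + m) n' m')
      (φ.opRestrict n (j + 1 + m) n' m')) :
    ConeExact (E.opHomD (n + 1) m n' m') (E'.opHomD (n + 1) m n' m')
      (φ.opRestrict (n + 1) m n' m') := by
  intro p q r s hq hr hs x y hx hy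
  let δ₁ : E.opHom (n + 1) m n' m' p × E'.opHom (n + 1) m n' m' r →+
      E.opHom (n + 1) m n' m' q × E'.opHom (n + 1) m n' m' p :=
    ((E.opHomD (n + 1) m n' m' p q).comp (AddMonoidHom.fst _ _)).prod
      ((φ.opRestrict (n + 1) m n' m' p).coprod (E'.opHomD (n + 1) m n' m' r p))
  let δ₂ : E.opHom (n + 1) m n' m' q × E'.opHom (n + 1) m n' m' p →+
      E.opHom (n + 1) m n' m' s × E'.opHom (n + 1) m n' m' q :=
    ((E.opHomD (n + 1) m n' m' q s).comp (AddMonoidHom.fst _ _)).prod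
      ((φ.opRestrict (n + 1) m n' m' q).coprod (-E'.opHomD (n + 1) m n' m' p q))
  have e₁ : ∀ c, δ₁ c = (E.opHomD (n + 1) m n' m' p q c.1,
      φ.opRestrict (n + 1) m n' m' p c.1 + E'.opHomD (n + 1) m n' m' r p c.2) := fun _ => rfl
  have e₂ : ∀ c, δ₂ c = (E.opHomD (n + 1) m n' m' q s c.1,
      φ.opRestrict (n + 1) m n' m' q c.1 + -E'.opHomD (n + 1) m n' m' p q c.2) := fun _ => rfl
  have hδ : ∀ c, δ₂ (δ₁ c) = 0 := by
    intro c
    rw [e₁, e₂, opHomD_opHomD, map_add, opHomD_opHomD, φ.opHomD_opRestrict hq, add_zero,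
      add_neg_cancel]
    rfl
  have hδ₂ : ∀ c, δ₂ c = 0 ↔ E.opHomD (n + 1) m n' m' q s c.1 = 0 ∧
      φ.opRestrict (n + 1) m n' m' q c.1 = E'.opHomD (n + 1) m n' m' p q c.2 := by
    intro c
    rw [e₂, Prod.mk_eq_zero, add_neg_eq_zero]
  suffices ∃ c, δ₁ c = (x, y) by
    obtain ⟨⟨u, v⟩, huv⟩ := this
    rw [e₁, Prod.mk_inj] at huv
    exact ⟨u, v, huv⟩
  refine exists_eq_of_complete δ₁ δ₂ hδ
    (fun N => (opFiltration n m n' m' p N).prod (opFiltration n m n' m' r N))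
    (fun N => (opFiltration n m n' m' q N).prod (opFiltration n m n' m' p N))
    ?_ ?_ ?_ ?_ ?_ (x, y) ((hδ₂ _).2 ⟨hx, hy⟩)
  · rw [eq_top_iff]
    intro c _
    rw [AddSubgroup.mem_prod, mem_opFiltration, mem_opFiltration]
    exact ⟨fun j hj => absurd hj (Nat.not_lt_zero j), fun j hj => absurd hj (Nat.not_lt_zero j)⟩
  · intro N c hN
    rw [AddSubgroup.mem_prod] at hN ⊢
    exact ⟨opHomD_mem_opFiltration hq hN.1, AddSubgroup.add_mem _
      (φ.opRestrict_mem_opFiltration hN.1) (opHomD_mem_opFiltration hr hN.2)⟩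
  -- Separatedness: level `j + 1` already forces the slice `j` to vanish.
  · intro k hk
    refine Prod.ext (opHom_ext fun j => ?_) (opHom_ext fun j => ?_)
    · exact (mem_opFiltration.1 (hk (j + 1)).1 j (Nat.lt_succ_self j)).trans (map_zero _).symm
    · exact (mem_opFiltration.1 (hk (j + 1)).2 j (Nat.lt_succ_self j)).trans (map_zero _).symm
  · intro c hN
    obtain ⟨l, hl⟩ := opFiltration_complete (fun N => (c N).1) fun N => (hN N).1
    obtain ⟨l', hl'⟩ := opFiltration_complete (fun N => (c N).2) fun N => (hN N).2
    refine ⟨(l, l'), fun N => ?_⟩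
    rw [AddSubgroup.mem_prod, Prod.fst_sub, Prod.snd_sub, Prod.fst_sum, Prod.snd_sum]
    exact ⟨hl N, hl' N⟩
  · intro N k hN hk
    rw [AddSubgroup.mem_prod] at hN
    rw [hδ₂] at hk
    have h₁ := congrArg (opSlice N) hk.1
    rw [opSlice_opHomD hs hN.1 le_rfl, map_zero] at h₁
    have h₂ := congrArg (opSlice N) hk.2
    rw [opSlice_opHomD hq hN.2 le_rfl, φ.opSlice_opRestrict] at h₂
    -- On the slice `N` the differential carries $(-1)^N$ while restriction does not. Rescaling the
    -- first component here, and the lift of `v` below, by this sign matches the two cone equations.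
    obtain ⟨u, v, hu, hv⟩ := hc N (p := p + N) (q := q + N) (r := r + N) (s := s + N) (by omega)
      (by omega) (by omega) (sgn N • opSlice N k.1) (opSlice N k.2) (by rw [map_zsmul, h₁])
      (by rw [map_zsmul, h₂, smul_smul, sgn_mul_self, one_smul])
    obtain ⟨u', hu', rfl⟩ := exists_mem_opFiltration N u
    obtain ⟨v', hv', rfl⟩ := exists_mem_opFiltration N v
    have hv'' := AddSubgroup.zsmul_mem _ hv' (sgn N)
    refine ⟨(u', sgn N • v'), AddSubgroup.mem_prod.2 ⟨hu', hv''⟩, ?_⟩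
    rw [AddSubgroup.mem_prod]
    refine ⟨mem_opFiltration_succ ?_ ?_, mem_opFiltration_succ ?_ ?_⟩
    · exact AddSubgroup.sub_mem _ hN.1 (opHomD_mem_opFiltration hq hu')
    · change opSlice N (k.1 - E.opHomD (n + 1) m n' m' p q u') = 0
      rw [map_sub, opSlice_opHomD hq hu' le_rfl, hu, smul_smul, sgn_mul_self, one_smul, sub_self]
    · exact AddSubgroup.sub_mem _ hN.2 (AddSubgroup.add_mem _ (φ.opRestrict_mem_opFiltration hu')
        (opHomD_mem_opFiltration hr hv''))
    · change opSlice N (k.2 - (φ.opRestrict (n + 1) m n' m' p u' +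
        E'.opHomD (n + 1) m n' m' r p (sgn N • v'))) = 0
      rw [map_sub, map_add, opSlice_opHomD hr hv'' le_rfl, map_zsmul, map_zsmul, smul_smul,
        sgn_mul_self, one_smul, φ.opSlice_opRestrict, hv, sub_self]

/-- The induction on `n` is uniform in `m`, because splitting off one Hochschild complex replaces
`m` by every `j + 1 + m`. -/
lemma coneExact_opRestrict (hφ : φ.toFunctor.IsQuasiIso) (n' m' : ℕ) :
    ∀ n m, ConeExact (E.opHomD n m n' m') (E'.opHomD n m n' m') (φ.opRestrict n m n' m')
  | 0, m => φ.coneExact_opRestrict_zero hφ m n' m'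
  | n + 1, m => φ.coneExact_opRestrict_succ fun j => coneExact_opRestrict hφ n' m' n (j + 1 + m)

end Hom

end Slices

end AinfProp

theorem corollary2 (E E' : AinfProp.{u}) (φ : AinfProp.Hom E E')
    (hφ : φ.toFunctor.IsQuasiIso) : φ.mapFormalOps.IsQuasiIso := fun a b =>
  (quasiIso_iff_coneExact _).2 (φ.coneExact_opRestrict hφ b.1 b.2 a.1 a.2)
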